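/- **Setting.** Let $(M,g)$ be a $(4n+p)$-dimensional smooth Riemannian manifold (Hausdorff, second countable, without boundary) with a $p$-dimensional foliation $\mathcal F$ given by a cocycle $\{U_i,f_i,\gamma_{ij}\}$ modelled on a $4n$-manifold $N_0$: the $U_i$ form an open cover of $M$, the $f_i:U_i\to N_0$ are submersions with connected fibres (the plaques of $\mathcal F$), and the $\gamma_{ij}$ are local diffeomorphisms of $N_0$ with $f_i=\gamma_{ij}\circ f_j$ on $U_i\cap U_j$. Suppose that $\mathcal F$ is *transversely quaternion Kähler*: $N_0$ carries a quaternion Kähler structure $(g_0,Q_0)$, i.e. a Riemannian metric $g_0$ and a rank $3$ subbundle $Q_0\subset\mathrm{End}(TN_0)$ which is locally spanned by almost hypercomplex structures $(I,J,K)$ ($I^2=J^2=K^2=-1$, $IJ=K$ and cyclically) for which $g_0$ is Hermitian, and which is parallel for the Levi-Civita connection of $g_0$; and the $\gamma_{ij}$ are local isometries of $g_0$ whose induced maps of $\mathrm{End}(TN_0)$ preserve $Q_0$. Suppose also that $g$ is bundle-like and induces this transverse metric, i.e. the $f_i$ are Riemannian submersions. A *basic* $k$-form is a smooth $k$-form $\alpha$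 on $M$ with $i_X\alpha=i_Xd\alpha=0$ for all $X\in T\mathcal F$. Write $\nu=(T\mathcal F)^{\perp}\cong TM/T\mathcal F$ for the normal bundle and $Q\subset\mathrm{End}(\nu)$ for the subbundle corresponding to $Q_0$ under the $f_i$. Locally choose $I,J,K\in Q$ that form an almost hypercomplex structure of $\nu$, let $\Omega_A(u,v)=g(Au,v)$ for $u,v\in\nu$ (extended by zero to $T\mathcal F$), and let $$\Omega=\Omega_I\wedge\Omega_I+\Omega_J\wedge\Omega_J+\Omega_K\wedge\Omega_K ,$$ a $4$-form which does not depend on the choice. Let $\bar *$ be the Hodge star operator from basic $k$-forms to basic $(4n-k)$-forms defined by $g|_\nu$ and the orientation of $\nu$ given by the orthonormal frames $(e_1,Ie_1,Je_1,Ke_1,\dots,e_n,Ie_n,Je_n,Ke_n)$. For basic forms $\alpha$ put $$L\alpha=\Omega\wedge\alpha,\qquad \Lambda\alpha=\bar *(\Omega\wedge\bar *\alpha),$$ so that $L$ raises the degree by $4$ and $\Lambda$ lowers it by $4$ ($\Lambda=0$ in degrees $<4$). A basic form $\alpha$ is *effective* if $\Lambda\alpha=0$. **Theorem.** Every basic form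 $\omega$ of degree $k\le n+1$ on $(M,\mathcal F)$ can be written as $$\omega=\sum_{i=0}^{[k/4]}L^i\,\omega_e^{\,k-4i},$$ where each $\omega_e^{\,k-4i}$ is an effective basic $(k-4i)$-form. -/

import Mathlib

open scoped Manifold ContDiff Topology Nat

noncomputable section

namespace QKFoliation

/-! ### Exterior algebra of a real vector space -/

section LinearAlgebra

variable {V : Type*} [AddCommGroup V] [Module ℝ V]

/-- The exterior product of a `k`-form and an `l`-form (a sum over `(k,l)`-shuffles), as a form of
degree `m = k + l`. -/
def wedge {k l m : ℕ} (h : k + l = m) (α : V [⋀^Fin k]→ₗ[ℝ] ℝ) (β : V [⋀^Fin l]→ₗ[ℝ] ℝ) :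
    V [⋀^Fin m]→ₗ[ℝ] ℝ :=
  ((LinearMap.mul' ℝ ℝ).compAlternatingMap (α.domCoprod β)).domDomCongr
    (finSumFinEquiv.trans (finCongr h))

/-- The same form, its degree written differently. -/
def castDegree {k l : ℕ} (h : k = l) (α : V [⋀^Fin k]→ₗ[ℝ] ℝ) : V [⋀^Fin l]→ₗ[ℝ] ℝ :=
  α.domDomCongr (finCongr h)

/-- The form `w ↦ τ (u, w)` obtained by inserting the vectors `u` in the first slots of `τ`. -/
def insertLeft {ι κ : Type*} (τ : V [⋀^ι ⊕ κ]→ₗ[ℝ] ℝ) (u : ι → V) : V [⋀^κ]→ₗ[ℝ] ℝ where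
  toFun w := τ (Sum.elim u w)
  map_update_add' w i a b := by
    classical
    have key : ∀ c : V, Sum.elim u (Function.update w i c) =
        Function.update (Sum.elim u w) (Sum.inr i) c := fun c => by
      rw [Sum.update_elim_inr]
    rw [key, key, key, τ.map_update_add]
  map_update_smul' w i c a := by
    classical
    have key : ∀ c : V, Sum.elim u (Function.update w i c) =
        Function.update (Sum.elim u w) (Sum.inr i) c := fun c => by
      rw [Sum.update_elim_inr]
    rw [key, key, τ.map_update_smul]
  map_eq_zero_of_eq' w i j hw hij :=
    τ.map_eq_zero_of_eq (Sum.elim u w) (i := Sum.inr i) (j := Sum.inr j) hw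
      (fun h => hij (Sum.inr_injective h))

variable [TopologicalSpace V]

/-- The `2`-form `Ω_A(u, v) = g(A u, v)` of an endomorphism `A` that is skew-symmetric for the
symmetric bilinear form `g`; it is written in antisymmetrised form so as to be alternating for
every `A`, see `fundamentalForm_apply`. -/
def fundamentalForm (g : V →L[ℝ] V →L[ℝ] ℝ) (A : V →L[ℝ] V) : V [⋀^Fin 2]→ₗ[ℝ] ℝ where
  toFun v := (1 / 2 : ℝ) * (g (A (v 0)) (v 1) - g (A (v 1)) (v 0))
  map_update_add' v i a b := by
    fin_cases i <;> simp [Function.update] <;> ring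
  map_update_smul' v i c a := by
    fin_cases i <;> simp [Function.update] <;> ring
  map_eq_zero_of_eq' v i j hv hij := by
    fin_cases i <;> fin_cases j <;> simp_all

theorem fundamentalForm_apply (g : V →L[ℝ] V →L[ℝ] ℝ) (A : V →L[ℝ] V)
    (hA : ∀ u v, g (A u) v = -g (A v) u) (v : Fin 2 → V) :
    fundamentalForm g A v = g (A (v 0)) (v 1) := by
  change (1 / 2 : ℝ) * (g (A (v 0)) (v 1) - g (A (v 1)) (v 0)) = _
  rw [hA (v 1) (v 0)]; ring

/-- `(I, J, K)` restricts to an (almost) hypercomplex structure of the subspace `H`. -/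
structure IsHypercomplexOn (H : Submodule ℝ V) (I J K : V →L[ℝ] V) : Prop where
  mapsTo_I : ∀ u ∈ H, I u ∈ H
  mapsTo_J : ∀ u ∈ H, J u ∈ H
  mapsTo_K : ∀ u ∈ H, K u ∈ H
  I_I : ∀ u ∈ H, I (I u) = -u
  J_J : ∀ u ∈ H, J (J u) = -u
  K_K : ∀ u ∈ H, K (K u) = -u
  I_J : ∀ u ∈ H, I (J u) = K u
  J_K : ∀ u ∈ H, J (K u) = I u
  K_I : ∀ u ∈ H, K (I u) = J u

variable [IsTopologicalAddGroup V] [ContinuousSMul ℝ V]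

/-- A quaternionic frame of a `4n`-dimensional subspace `H` of `V`, for a bilinear form `g` and a
space `Q` of endomorphisms: a hypercomplex structure `(I, J, K)` of `H` in `Q`, and a
`g`-orthonormal basis `(e_a, I e_a, J e_a, K e_a)`, `1 ≤ a ≤ n`, of `H`. It identifies `H` with
the Euclidean space `ℍⁿ`. -/
structure QuaternionicFrame (n : ℕ) (g : V →L[ℝ] V →L[ℝ] ℝ) (H : Submodule ℝ V)
    (Q : Submodule ℝ (V →L[ℝ] V)) where
  I : V →L[ℝ] V
  J : V →L[ℝ] V
  K : V →L[ℝ] V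
  I_mem : I ∈ Q
  J_mem : J ∈ Q
  K_mem : K ∈ Q
  hypercomplex : IsHypercomplexOn H I J K
  e : Fin n × Fin 4 → V
  e_mem : ∀ c, e c ∈ H
  orthonormal : ∀ c d, g (e c) (e d) = if c = d then 1 else 0
  span_eq : Submodule.span ℝ (Set.range e) = H
  e_one : ∀ a, e (a, 1) = I (e (a, 0))
  e_two : ∀ a, e (a, 2) = J (e (a, 0))
  e_three : ∀ a, e (a, 3) = K (e (a, 0))

namespace QuaternionicFrame

variable {n : ℕ} {g : V →L[ℝ] V →L[ℝ] ℝ} {H : Submodule ℝ V} {Q : Submodule ℝ (V →L[ℝ] V)}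
  (b : QuaternionicFrame n g H Q)

/-- The frame in the order `e_1, I e_1, J e_1, K e_1, e_2, I e_2, …`. -/
def vec (i : Fin (4 * n)) : V :=
  b.e (finProdFinEquiv.symm (finCongr (mul_comm 4 n) i))

/-- The volume form `a_1 ∧ b_1 ∧ c_1 ∧ d_1 ∧ ⋯ ∧ a_n ∧ b_n ∧ c_n ∧ d_n` of the coframe
`g(e_a, ·), g(I e_a, ·), g(J e_a, ·), g(K e_a, ·)`. -/
def vol : V [⋀^Fin (4 * n)]→ₗ[ℝ] ℝ :=
  Matrix.detRowAlternating.compLinearMap (LinearMap.pi fun i => (g (b.vec i)).toLinearMap)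

/-- The form `Ω = Ω_I ∧ Ω_I + Ω_J ∧ Ω_J + Ω_K ∧ Ω_K`. -/
def krainesForm : V [⋀^Fin 4]→ₗ[ℝ] ℝ :=
  wedge rfl (fundamentalForm g b.I) (fundamentalForm g b.I)
    + wedge rfl (fundamentalForm g b.J) (fundamentalForm g b.J)
    + wedge rfl (fundamentalForm g b.K) (fundamentalForm g b.K)

/-- The Hodge star operator of `H`,
`(⋆α)(w) = 1/k! ∑_{s_1, …, s_k} α(e_{s_1}, …, e_{s_k}) vol(e_{s_1}, …, e_{s_k}, w)`,
so that `α ∧ ⋆α = |α|² vol` for forms `α` of `H`. -/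
def star {k l : ℕ} (h : k + l = 4 * n) (α : V [⋀^Fin k]→ₗ[ℝ] ℝ) : V [⋀^Fin l]→ₗ[ℝ] ℝ :=
  (k ! : ℝ)⁻¹ • ∑ s : Fin k → Fin (4 * n), α (b.vec ∘ s) •
    insertLeft (b.vol.domDomCongr (finSumFinEquiv.trans (finCongr h)).symm) (b.vec ∘ s)

end QuaternionicFrame

end LinearAlgebra

/-! ### Differential forms on a manifold -/

section Forms

/-- An alternating form on a finite dimensional space is continuous. -/
theorem continuous_alternatingMap {m k : ℕ}
    (α : EuclideanSpace ℝ (Fin m) [⋀^Fin k]→ₗ[ℝ] ℝ) : Continuous α := by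
  let b := (EuclideanSpace.basisFun (Fin m) ℝ).toBasis
  have h : ∀ v : Fin k → EuclideanSpace ℝ (Fin m),
      α v = ∑ r : Fin k → Fin m, (∏ i, v i (r i)) • α (fun i => b (r i)) := by
    intro v
    have hv : v = fun i => ∑ c, v i c • b c := by
      funext i
      conv_lhs => rw [← b.sum_repr (v i)]
      rfl
    conv_lhs => rw [hv]
    have := α.toMultilinearMap.map_sum (fun (i : Fin k) (c : Fin m) => v i c • b c)
    refine this.trans (Finset.sum_congr rfl fun r _ => ?_)
    exact α.toMultilinearMap.map_smul_univ _ _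
  rw [show (α : (Fin k → EuclideanSpace ℝ (Fin m)) → ℝ) = _ from funext h]
  fun_prop

/-- An alternating form on `ℝᵐ`, as a continuous alternating form. -/
def toContinuous {m k : ℕ} (α : EuclideanSpace ℝ (Fin m) [⋀^Fin k]→ₗ[ℝ] ℝ) :
    EuclideanSpace ℝ (Fin m) [⋀^Fin k]→L[ℝ] ℝ :=
  { α with cont := continuous_alternatingMap α }

variable (m : ℕ) (M : Type*) [TopologicalSpace M] [ChartedSpace (EuclideanSpace ℝ (Fin m)) M]

/-- Fields of alternating `k`-forms on the tangent spaces of an `m`-manifold `M` (no smoothness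
is required here, see `IsSmooth`). -/
abbrev FormField (k : ℕ) : Type _ :=
  ∀ x : M, (TangentSpace (𝓡 m) x) [⋀^Fin k]→ₗ[ℝ] ℝ

variable {m M} {k : ℕ}

/-- The expression of a form in the chart at `x₀`: its pullback by the inverse of the chart. -/
def inChart (α : FormField m M k) (x₀ : M) (y : EuclideanSpace ℝ (Fin m)) :
    EuclideanSpace ℝ (Fin m) [⋀^Fin k]→L[ℝ] ℝ :=
  toContinuous ((α ((extChartAt (𝓡 m) x₀).symm y)).compLinearMap
    (mfderiv 𝓘(ℝ, EuclideanSpace ℝ (Fin m)) (𝓡 m) (extChartAt (𝓡 m) x₀).symm y).toLinearMap)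

/-- `α` is a (smooth) differential form: it is smooth in every preferred chart. -/
def IsSmooth (α : FormField m M k) : Prop :=
  ∀ x₀ : M, ContDiffOn ℝ ∞ (inChart α x₀) (extChartAt (𝓡 m) x₀).target

/-- The exterior derivative, computed at `x` in the chart at `x`. -/
def extDer (α : FormField m M k) : FormField m M (k + 1) := fun x =>
  (extDeriv (inChart α x) (extChartAt (𝓡 m) x x)).toAlternatingMap.compLinearMap
    (mfderiv (𝓡 m) 𝓘(ℝ, EuclideanSpace ℝ (Fin m)) (extChartAt (𝓡 m) x) x).toLinearMap

end Forms

/-! ### Quaternion Kähler manifolds -/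

/-- A (smooth) Riemannian metric on an `m`-manifold. -/
abbrev Metric (m : ℕ) (M : Type*) [TopologicalSpace M]
    [ChartedSpace (EuclideanSpace ℝ (Fin m)) M] [IsManifold (𝓡 m) ∞ M] : Type _ :=
  Bundle.ContMDiffRiemannianMetric (𝓡 m) ∞ (EuclideanSpace ℝ (Fin m))
    (fun x : M => TangentSpace (𝓡 m) x)

section Geometry

variable {m : ℕ} {N : Type*} [TopologicalSpace N]
  [ChartedSpace (EuclideanSpace ℝ (Fin m)) N] [IsManifold (𝓡 m) ∞ N]

/-- A field of vectors, as a map to the tangent bundle. -/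
def vecSection (X : ∀ y : N, TangentSpace (𝓡 m) y) (y : N) : TangentBundle (𝓡 m) N :=
  ⟨y, X y⟩

/-- A field of endomorphisms of the tangent spaces, as a map to the bundle `End(TN)`. -/
def endSection (A : ∀ y : N, TangentSpace (𝓡 m) y →L[ℝ] TangentSpace (𝓡 m) y) (y : N) :
    Bundle.TotalSpace (EuclideanSpace ℝ (Fin m) →L[ℝ] EuclideanSpace ℝ (Fin m))
      (fun y : N => TangentSpace (𝓡 m) y →L[ℝ] TangentSpace (𝓡 m) y) :=
  ⟨y, A y⟩

/-- Smoothness at `y` of a field of endomorphisms of the tangent spaces. -/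
def SmoothEndAt (A : ∀ y : N, TangentSpace (𝓡 m) y →L[ℝ] TangentSpace (𝓡 m) y) (y : N) : Prop :=
  ContMDiffAt (𝓡 m)
    ((𝓡 m).prod 𝓘(ℝ, EuclideanSpace ℝ (Fin m) →L[ℝ] EuclideanSpace ℝ (Fin m))) ∞
    (endSection A) y

/-- `cov` is the Levi-Civita connection of `g`: it is torsion-free and compatible with `g`. -/
structure IsLeviCivita (g : Metric m N)
    (cov : CovariantDerivative (𝓡 m) (EuclideanSpace ℝ (Fin m))
      (fun y : N => TangentSpace (𝓡 m) y)) : Prop where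
  torsion_free : ∀ (X Y : ∀ y : N, TangentSpace (𝓡 m) y) (y : N),
    MDifferentiableAt (𝓡 m) (𝓡 m).tangent (vecSection X) y →
    MDifferentiableAt (𝓡 m) (𝓡 m).tangent (vecSection Y) y →
      cov Y y (X y) - cov X y (Y y) = VectorField.mlieBracket (𝓡 m) X Y y
  compatible : ∀ (X Y : ∀ y : N, TangentSpace (𝓡 m) y) (y : N) (v : TangentSpace (𝓡 m) y),
    MDifferentiableAt (𝓡 m) (𝓡 m).tangent (vecSection X) y →
    MDifferentiableAt (𝓡 m) (𝓡 m).tangent (vecSection Y) y →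
      mfderiv (𝓡 m) 𝓘(ℝ, ℝ) (fun z => g.inner z (X z) (Y z)) y v
        = g.inner y (cov X y v) (Y y) + g.inner y (X y) (cov Y y v)

/-- The connection on `End(TN)` induced by `cov`, `(∇_v A) Y = ∇_v (A Y) - A (∇_v Y)`, preserves
the subbundle `Q`: `∇_v A` lies in `Q` for every local section `A` of `Q`. -/
def PreservesSubbundle
    (cov : CovariantDerivative (𝓡 m) (EuclideanSpace ℝ (Fin m))
      (fun y : N => TangentSpace (𝓡 m) y))
    (Q : ∀ y : N, Submodule ℝ (TangentSpace (𝓡 m) y →L[ℝ] TangentSpace (𝓡 m) y)) : Prop :=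
  ∀ (A : ∀ y : N, TangentSpace (𝓡 m) y →L[ℝ] TangentSpace (𝓡 m) y) (y : N),
    (∀ᶠ z in 𝓝 y, SmoothEndAt A z ∧ A z ∈ Q z) →
    ∀ v : TangentSpace (𝓡 m) y, ∃ B ∈ Q y, ∀ Y : ∀ z : N, TangentSpace (𝓡 m) z,
      MDifferentiableAt (𝓡 m) (𝓡 m).tangent (vecSection Y) y →
        cov (fun z => A z (Y z)) y v - A y (cov Y y v) = B (Y y)

end Geometry

/-- A quaternion Kähler structure `(g, Q)` on a `4n`-manifold: a Riemannian metric `g` and a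
rank `3` subbundle `Q` of `End(TN)`, locally spanned by almost hypercomplex structures for which
`g` is Hermitian, and parallel for the Levi-Civita connection of `g`. -/
structure QuaternionKahler (n : ℕ) (N : Type*) [TopologicalSpace N]
    [ChartedSpace (EuclideanSpace ℝ (Fin (4 * n))) N] [IsManifold (𝓡 (4 * n)) ∞ N] where
  g : Metric (4 * n) N
  Q : ∀ y : N, Submodule ℝ (TangentSpace (𝓡 (4 * n)) y →L[ℝ] TangentSpace (𝓡 (4 * n)) y)
  rank_eq : ∀ y, Module.finrank ℝ (Q y) = 3
  locally_spanned : ∀ y₀ : N, ∃ W : Set N, IsOpen W ∧ y₀ ∈ W ∧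
    ∃ I J K : ∀ y : N, TangentSpace (𝓡 (4 * n)) y →L[ℝ] TangentSpace (𝓡 (4 * n)) y,
      ∀ y ∈ W, SmoothEndAt I y ∧ SmoothEndAt J y ∧ SmoothEndAt K y ∧
        IsHypercomplexOn ⊤ (I y) (J y) (K y) ∧
        Q y = Submodule.span ℝ {I y, J y, K y} ∧
        ∀ A ∈ ({I y, J y, K y} : Set (TangentSpace (𝓡 (4 * n)) y →L[ℝ] _)),
          ∀ u v, g.inner y (A u) (A v) = g.inner y u v
  parallel : ∃ cov : CovariantDerivative (𝓡 (4 * n)) (EuclideanSpace ℝ (Fin (4 * n)))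
      (fun y : N => TangentSpace (𝓡 (4 * n)) y),
    IsLeviCivita g cov ∧ PreservesSubbundle cov Q

/-! ### Foliations -/

/-- A cocycle `{U_i, f_i, γ_ij}` modelled on the `4n`-manifold `N` that defines a foliation of
dimension `p` of the `(4n+p)`-manifold `M`: the leaves are locally the fibres of the submersions
`f_i : U_i → N`, and `f_i = γ_ij ∘ f_j` on `U_i ∩ U_j` for local diffeomorphisms `γ_ij`, defined
on a neighbourhood of `f_j(U_i ∩ U_j)`. -/
structure FoliationCocycle (n p : ℕ) (ι M N : Type*)
    [TopologicalSpace M] [ChartedSpace (EuclideanSpace ℝ (Fin (4 * n + p))) M]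
    [TopologicalSpace N] [ChartedSpace (EuclideanSpace ℝ (Fin (4 * n))) N] where
  U : ι → Set M
  isOpen_U : ∀ i, IsOpen (U i)
  cover : ∀ x, ∃ i, x ∈ U i
  f : ι → M → N
  submersion : ∀ i, ∀ x ∈ U i, Manifold.IsSubmersionAt (𝓡 (4 * n + p)) (𝓡 (4 * n)) ∞ (f i) x
  connected_fibers : ∀ i y, IsPreconnected (U i ∩ f i ⁻¹' {y})
  γ : ι → ι → N → N
  localDiffeo : ∀ i j,
    IsLocalDiffeomorphOn (𝓡 (4 * n)) (𝓡 (4 * n)) ∞ (γ i j) (f j '' (U i ∩ U j))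
  compat : ∀ i j, ∀ x ∈ U i ∩ U j, f i x = γ i j (f j x)

namespace FoliationCocycle

variable {n p : ℕ} {ι M N : Type*}
  [TopologicalSpace M] [ChartedSpace (EuclideanSpace ℝ (Fin (4 * n + p))) M]
  [TopologicalSpace N] [ChartedSpace (EuclideanSpace ℝ (Fin (4 * n))) N]
  (F : FoliationCocycle n p ι M N)

/-- The differential of the submersion `f_i` at `x`. -/
def df (i : ι) (x : M) :
    TangentSpace (𝓡 (4 * n + p)) x →L[ℝ] TangentSpace (𝓡 (4 * n)) (F.f i x) :=
  mfderiv (𝓡 (4 * n + p)) (𝓡 (4 * n)) (F.f i) x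

/-- The tangent space at `x` of the leaf through `x`: the kernel of `d f_i` for `U_i ∋ x`. -/
def leafTangent (x : M) : Submodule ℝ (TangentSpace (𝓡 (4 * n + p)) x) :=
  ⨅ (i : ι) (_ : x ∈ F.U i), LinearMap.ker (F.df i x).toLinearMap

/-- Basic forms: differential forms `α` with `i_X α = i_X dα = 0` for all `X` tangent to the
leaves. -/
structure IsBasic {k : ℕ} (α : FormField (4 * n + p) M k) : Prop where
  smooth : IsSmooth α
  horizontal : ∀ (x : M) (v : Fin k → TangentSpace (𝓡 (4 * n + p)) x),
    (∃ j, v j ∈ F.leafTangent x) → α x v = 0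
  extDer_horizontal : ∀ (x : M) (v : Fin (k + 1) → TangentSpace (𝓡 (4 * n + p)) x),
    (∃ j, v j ∈ F.leafTangent x) → extDer α x v = 0

variable [IsManifold (𝓡 (4 * n + p)) ∞ M] [IsManifold (𝓡 (4 * n)) ∞ N]

/-- The foliation is transversely quaternion Kähler, with transverse structure `S`: the `γ_ij` are
local isometries and the induced maps of `End(TN)`, `B ↦ dγ ∘ B ∘ dγ⁻¹`, preserve `Q`. -/
structure IsTransverselyQK (S : QuaternionKahler n N) : Prop where
  isometry : ∀ i j, ∀ y ∈ F.f j '' (F.U i ∩ F.U j), ∀ u v : TangentSpace (𝓡 (4 * n)) y,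
    S.g.inner (F.γ i j y) (mfderiv (𝓡 (4 * n)) (𝓡 (4 * n)) (F.γ i j) y u)
      (mfderiv (𝓡 (4 * n)) (𝓡 (4 * n)) (F.γ i j) y v) = S.g.inner y u v
  preserves : ∀ i j, ∀ y ∈ F.f j '' (F.U i ∩ F.U j), ∀ B ∈ S.Q y, ∃ B' ∈ S.Q (F.γ i j y),
    (mfderiv (𝓡 (4 * n)) (𝓡 (4 * n)) (F.γ i j) y).comp B
      = B'.comp (mfderiv (𝓡 (4 * n)) (𝓡 (4 * n)) (F.γ i j) y)

variable (g : Metric (4 * n + p) M) (S : QuaternionKahler n N)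

/-- The `g`-orthogonal complement of the tangent space of the leaf; it is identified with the
fibre `T_xM / T_xF` of the normal bundle. -/
def normal (x : M) : Submodule ℝ (TangentSpace (𝓡 (4 * n + p)) x) where
  carrier := {u | ∀ v ∈ F.leafTangent x, g.inner x v u = 0}
  add_mem' := fun {a b} ha hb v hv => by
    rw [map_add, ha v hv, hb v hv, add_zero]
  zero_mem' := fun v _ => map_zero _
  smul_mem' := fun c a ha v hv => by
    rw [map_smul, ha v hv, smul_zero]

/-- `g` is a bundle-like metric inducing the transverse metric of `S`: the `f_i` are Riemannian
submersions. -/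
def IsBundleLike : Prop :=
  ∀ i, ∀ x ∈ F.U i, ∀ u ∈ F.normal g x, ∀ v ∈ F.normal g x,
    S.g.inner (F.f i x) (F.df i x u) (F.df i x v) = g.inner x u v

/-- The rank `3` bundle of endomorphisms of the normal bundle that corresponds to `Q` under the
`f_i`. An endomorphism of the normal space is extended by `0` to the tangent space of the leaf. -/
def normalQ (x : M) :
    Submodule ℝ (TangentSpace (𝓡 (4 * n + p)) x →L[ℝ] TangentSpace (𝓡 (4 * n + p)) x) where
  carrier := {A | (∀ v ∈ F.leafTangent x, A v = 0) ∧ (∀ v, A v ∈ F.normal g x) ∧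
    ∀ i, x ∈ F.U i → ∃ B ∈ S.Q (F.f i x), (F.df i x).comp A = B.comp (F.df i x)}
  add_mem' := by
    rintro A A' ⟨h1, h2, h3⟩ ⟨h1', h2', h3'⟩
    refine ⟨fun v hv => by simp [h1 v hv, h1' v hv],
      fun v => (F.normal g x).add_mem (h2 v) (h2' v), fun i hi => ?_⟩
    obtain ⟨B, hB, e⟩ := h3 i hi
    obtain ⟨B', hB', e'⟩ := h3' i hi
    exact ⟨B + B', (S.Q _).add_mem hB hB', by
      rw [ContinuousLinearMap.comp_add, ContinuousLinearMap.add_comp, e, e']⟩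
  zero_mem' := ⟨fun v _ => rfl, fun v => (F.normal g x).zero_mem,
    fun i _ => ⟨0, (S.Q _).zero_mem, by simp⟩⟩
  smul_mem' := by
    rintro c A ⟨h1, h2, h3⟩
    refine ⟨fun v hv => by simp [h1 v hv],
      fun v => (F.normal g x).smul_mem c (h2 v), fun i hi => ?_⟩
    obtain ⟨B, hB, e⟩ := h3 i hi
    exact ⟨c • B, (S.Q _).smul_mem c hB, by
      rw [ContinuousLinearMap.comp_smul, ContinuousLinearMap.smul_comp, e]⟩

/-- Quaternionic frames of the normal space at `x`. -/
abbrev NormalFrame (x : M) : Type _ :=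
  QuaternionicFrame n (g.inner x) (F.normal g x) (F.normalQ g S x)

open scoped Classical in
/-- The basic `4`-form `Ω = Ω_I ∧ Ω_I + Ω_J ∧ Ω_J + Ω_K ∧ Ω_K`, which does not depend on the
frame. (The value `0` is never used: for a transversely quaternion Kähler foliation with a
bundle-like metric, frames exist at every point.) -/
def Omega : FormField (4 * n + p) M 4 := fun x =>
  if h : Nonempty (F.NormalFrame g S x) then h.some.krainesForm else 0

open scoped Classical in
/-- The transverse Hodge star operator `*̄` from `k`-forms to `l`-forms, `k + l = 4n`, defined by
the metric and the quaternionic orientation of the normal bundle. -/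
def starBar {k l : ℕ} (h : k + l = 4 * n) (α : FormField (4 * n + p) M k) :
    FormField (4 * n + p) M l := fun x =>
  if h' : Nonempty (F.NormalFrame g S x) then h'.some.star h (α x) else 0

/-- `L α = Ω ∧ α`. -/
def L {k : ℕ} (α : FormField (4 * n + p) M k) : FormField (4 * n + p) M (k + 4) := fun x =>
  wedge (Nat.add_comm 4 k) (F.Omega g S x) (α x)

/-- The iterates `L^i`. -/
def Lpow {k : ℕ} (α : FormField (4 * n + p) M k) : (i : ℕ) → FormField (4 * n + p) M (k + 4 * i)
  | 0 => α
  | i + 1 => F.L g S (Lpow α i)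

/-- `Λ α = *̄(Ω ∧ *̄ α)`, from `k`-forms to `(k-4)`-forms. There are no nonzero forms of negative
degree, nor nonzero basic forms of degree `> 4n`, so that `Λ = 0` for `k < 4` and `k > 4n`. -/
def Lam {k : ℕ} (α : FormField (4 * n + p) M k) : FormField (4 * n + p) M (k - 4) :=
  if h : 4 ≤ k ∧ k ≤ 4 * n then
    F.starBar g S (k := 4 + (4 * n - k)) (l := k - 4) (by omega) fun x =>
      wedge rfl (F.Omega g S x)
        (F.starBar g S (k := k) (l := 4 * n - k) (by omega) α x)
  else 0

/-- A form is effective if it is annihilated by `Λ`. -/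
def IsEffective {k : ℕ} (α : FormField (4 * n + p) M k) : Prop := F.Lam g S α = 0

end FoliationCocycle

end QKFoliation

end

/-! At each point a quaternionic frame identifies horizontal forms with forms on `ℝ⁴ⁿ` and `Ω` with
one fixed form `modelForm n`. There `⋆(Ω ∧ ⋆ ·)` is a nonzero multiple of the contraction with `Ω`
(`hodgeStar_wedge_hodgeStar`), and this contraction is, up to a positive factor, adjoint to `Ω ∧ ·`
(`formInner_wedge`). So every form is an effective form plus some `Ω ∧ β`, and induction on the
degree, applied to `β`, gives the sum.

The point is to choose `β` basic. Let `U` be the contraction with `Ω` followed by `Ω ∧ ·`. By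
adjointness `ker U² = ker U`, so some polynomial `q` satisfies `U q(U) U = U`, and `α - U q(U) α` is
then killed by the contraction (`exists_polynomial_contraction`). Since `q` is computed in the
model, the same `q` serves all points: `β`, the contraction of `q(U) α`, comes from `α` by finitely
many uses of `Ω ∧ ·` and the contraction, with constant coefficients. It is enough that these two
operators preserve basic forms.

For this, basic forms are described as the forms that are locally pulled back from smooth forms by
the `f_i` (`isBasic_iff_isPullbackAt`). Pullbacks are basic because `d` is natural; conversely, in a
chart that straightens `f_i`, horizontality of `α` and `dα` makes the coefficients constant along
the plaques. The form `Ω` is a local pullback because two hypercomplex bases of the same rank `3`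
space differ by an orthogonal matrix (`quaternionicForm_eq_of_mem_span`, `Omega_eq`). The
contraction preserves local pullbacks because an orthonormal frame may be traded for any basis and
its inverse Gram matrix (`contraction_eq_sum_basis`). The frames, which are chosen point by point
without any continuity, thereby drop out. -/

noncomputable section

namespace QKFoliation

open Equiv

/-! ### Wedge product, contraction and Hodge star of alternating forms -/

section ExteriorAlgebra

variable {V V' : Type*} [AddCommGroup V] [Module ℝ V] [AddCommGroup V'] [Module ℝ V']

theorem alternating_sum_apply {ι κ : Type*} (s : Finset κ) (f : κ → V [⋀^ι]→ₗ[ℝ] ℝ) (v : ι → V) :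
    (∑ c ∈ s, f c) v = ∑ c ∈ s, f c v := by
  classical
  induction s using Finset.induction_on with
  | empty => simp
  | insert c s hc ih => rw [Finset.sum_insert hc, Finset.sum_insert hc, AlternatingMap.add_apply, ih]

/-- Each `(k,l)`-shuffle stands for a coset of `S_k × S_l`, on which the signed summand is constant;
summing over all permutations counts it `k! l!` times. This removes the quotient from all later
computations. -/
theorem wedge_apply {k l m : ℕ} (h : k + l = m) (α : V [⋀^Fin k]→ₗ[ℝ] ℝ)
    (β : V [⋀^Fin l]→ₗ[ℝ] ℝ) (v : Fin m → V) :
    wedge h α β v = ((k ! : ℝ) * l !)⁻¹ * ∑ σ : Perm (Fin k ⊕ Fin l), ((Perm.sign σ : ℤ) : ℝ) *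
      (α (fun i => v (finCongr h (finSumFinEquiv (σ (Sum.inl i))))) *
        β (fun i => v (finCongr h (finSumFinEquiv (σ (Sum.inr i)))))) := by
  have key := congrArg (fun τ : V [⋀^Fin k ⊕ Fin l]→ₗ[ℝ] (TensorProduct ℝ ℝ ℝ) =>
    LinearMap.mul' ℝ ℝ (τ (fun i => v (finCongr h (finSumFinEquiv i)))))
    (MultilinearMap.domCoprod_alternization_eq α β)
  simp only [MultilinearMap.alternatization_apply, Fintype.card_fin] at key
  have h2 : ((k ! : ℝ) * l !) * wedge h α β v = ∑ σ : Perm (Fin k ⊕ Fin l),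
      ((Perm.sign σ : ℤ) : ℝ) *
      (α (fun i => v (finCongr h (finSumFinEquiv (σ (Sum.inl i))))) *
        β (fun i => v (finCongr h (finSumFinEquiv (σ (Sum.inr i)))))) := by
    rw [map_sum] at key
    calc _ = LinearMap.mul' ℝ ℝ (((k ! * l !) • α.domCoprod β)
          fun i => v (finCongr h (finSumFinEquiv i))) := by
          rw [AlternatingMap.smul_apply, map_nsmul, nsmul_eq_mul]
          push_cast
          rfl
      _ = _ := by
          rw [← key]
          refine Finset.sum_congr rfl fun σ _ => ?_
          rw [MultilinearMap.domDomCongr_apply, MultilinearMap.domCoprod_apply,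
            Units.smul_def, map_zsmul, zsmul_eq_mul]
          rfl
  rw [← h2, inv_mul_cancel_left₀ (by positivity)]

theorem wedge_compLinearMap {k l m : ℕ} (h : k + l = m) (α : V [⋀^Fin k]→ₗ[ℝ] ℝ)
    (β : V [⋀^Fin l]→ₗ[ℝ] ℝ) (f : V' →ₗ[ℝ] V) :
    wedge h (α.compLinearMap f) (β.compLinearMap f) = (wedge h α β).compLinearMap f := by
  ext v
  simp only [wedge_apply, AlternatingMap.compLinearMap_apply]

theorem wedge_add_left {k l m : ℕ} (h : k + l = m) (α α' : V [⋀^Fin k]→ₗ[ℝ] ℝ)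
    (β : V [⋀^Fin l]→ₗ[ℝ] ℝ) : wedge h (α + α') β = wedge h α β + wedge h α' β := by
  ext v
  simp only [wedge_apply, AlternatingMap.add_apply, add_mul, mul_add, Finset.sum_add_distrib]

theorem wedge_add_right {k l m : ℕ} (h : k + l = m) (α : V [⋀^Fin k]→ₗ[ℝ] ℝ)
    (β β' : V [⋀^Fin l]→ₗ[ℝ] ℝ) : wedge h α (β + β') = wedge h α β + wedge h α β' := by
  ext v
  simp only [wedge_apply, AlternatingMap.add_apply, mul_add, Finset.sum_add_distrib]

theorem wedge_smul_left {k l m : ℕ} (h : k + l = m) (c : ℝ) (α : V [⋀^Fin k]→ₗ[ℝ] ℝ)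
    (β : V [⋀^Fin l]→ₗ[ℝ] ℝ) : wedge h (c • α) β = c • wedge h α β := by
  ext v
  simp only [wedge_apply, AlternatingMap.smul_apply, smul_eq_mul, Finset.mul_sum]
  exact Finset.sum_congr rfl fun σ _ => by ring

theorem wedge_smul_right {k l m : ℕ} (h : k + l = m) (c : ℝ) (α : V [⋀^Fin k]→ₗ[ℝ] ℝ)
    (β : V [⋀^Fin l]→ₗ[ℝ] ℝ) : wedge h α (c • β) = c • wedge h α β := by
  ext v
  simp only [wedge_apply, AlternatingMap.smul_apply, smul_eq_mul, Finset.mul_sum]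
  exact Finset.sum_congr rfl fun σ _ => by ring

/-- Exterior multiplication as a bilinear map. -/
def wedgeBilin {k l m : ℕ} (h : k + l = m) :
    (V [⋀^Fin k]→ₗ[ℝ] ℝ) →ₗ[ℝ] (V [⋀^Fin l]→ₗ[ℝ] ℝ) →ₗ[ℝ] (V [⋀^Fin m]→ₗ[ℝ] ℝ) :=
  LinearMap.mk₂ ℝ (wedge h) (wedge_add_left h) (wedge_smul_left h) (wedge_add_right h)
    (wedge_smul_right h)

theorem wedgeBilin_apply {k l m : ℕ} (h : k + l = m) (α : V [⋀^Fin k]→ₗ[ℝ] ℝ)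
    (β : V [⋀^Fin l]→ₗ[ℝ] ℝ) : wedgeBilin h α β = wedge h α β := rfl

/-- The blocks of `Fin m` for `k + l = m`. -/
abbrev blockEquiv {k l m : ℕ} (h : k + l = m) : Fin k ⊕ Fin l ≃ Fin m :=
  finSumFinEquiv.trans (finCongr h)

/-- The interior product of a form with an `r`-form, with respect to a family of vectors `e`
(usually an orthonormal frame). -/
def contraction {N r j m : ℕ} (h : r + j = m) (e : Fin N → V) (η : V [⋀^Fin r]→ₗ[ℝ] ℝ)
    (a : V [⋀^Fin m]→ₗ[ℝ] ℝ) : V [⋀^Fin j]→ₗ[ℝ] ℝ :=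
  ∑ t : Fin r → Fin N, η (e ∘ t) • insertLeft (a.domDomCongr (blockEquiv h).symm) (e ∘ t)

theorem contraction_apply {N r j m : ℕ} (h : r + j = m) (e : Fin N → V)
    (η : V [⋀^Fin r]→ₗ[ℝ] ℝ) (a : V [⋀^Fin m]→ₗ[ℝ] ℝ) (w : Fin j → V) :
    contraction h e η a w =
      ∑ t : Fin r → Fin N, η (e ∘ t) * a (Sum.elim (e ∘ t) w ∘ (blockEquiv h).symm) := by
  rw [contraction, alternating_sum_apply]
  rfl

/-- Used with `f` the coordinate map of a frame, to pass to `ℝ⁴ⁿ`, and with `f` a differential, to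
pass to the transverse manifold. -/
theorem contraction_compLinearMap {N r j m : ℕ} (h : r + j = m) (e : Fin N → V')
    (η : V [⋀^Fin r]→ₗ[ℝ] ℝ) (a : V [⋀^Fin m]→ₗ[ℝ] ℝ) (f : V' →ₗ[ℝ] V) :
    contraction h e (η.compLinearMap f) (a.compLinearMap f) =
      (contraction h (f ∘ e) η a).compLinearMap f := by
  ext w
  simp only [contraction_apply, AlternatingMap.compLinearMap_apply]
  refine Finset.sum_congr rfl fun t _ => ?_
  congr 2
  funext i
  simp only [Function.comp_apply]
  rcases (blockEquiv h).symm i with x | x <;> rfl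

theorem contraction_add {N r j m : ℕ} (h : r + j = m) (e : Fin N → V)
    (η : V [⋀^Fin r]→ₗ[ℝ] ℝ) (a b : V [⋀^Fin m]→ₗ[ℝ] ℝ) :
    contraction h e η (a + b) = contraction h e η a + contraction h e η b := by
  ext w
  simp only [contraction_apply, AlternatingMap.add_apply, mul_add, Finset.sum_add_distrib]

theorem contraction_smul {N r j m : ℕ} (h : r + j = m) (e : Fin N → V)
    (η : V [⋀^Fin r]→ₗ[ℝ] ℝ) (c : ℝ) (a : V [⋀^Fin m]→ₗ[ℝ] ℝ) :
    contraction h e η (c • a) = c • contraction h e η a := by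
  ext w
  simp only [contraction_apply, AlternatingMap.smul_apply, smul_eq_mul, Finset.mul_sum]
  exact Finset.sum_congr rfl fun t _ => by ring

/-- Contraction with `η` as a linear map. -/
def contractionHom {N r j m : ℕ} (h : r + j = m) (e : Fin N → V) (η : V [⋀^Fin r]→ₗ[ℝ] ℝ) :
    (V [⋀^Fin m]→ₗ[ℝ] ℝ) →ₗ[ℝ] (V [⋀^Fin j]→ₗ[ℝ] ℝ) where
  toFun := contraction h e η
  map_add' := contraction_add h e η
  map_smul' := contraction_smul h e η

/-- The Hodge star operator of a family of vectors `e` and a volume form `μ`. -/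
def hodgeStar {N k l : ℕ} (e : Fin N → V) (μ : V [⋀^Fin N]→ₗ[ℝ] ℝ) (h : k + l = N)
    (α : V [⋀^Fin k]→ₗ[ℝ] ℝ) : V [⋀^Fin l]→ₗ[ℝ] ℝ :=
  (k ! : ℝ)⁻¹ • ∑ s : Fin k → Fin N, α (e ∘ s) •
    insertLeft (μ.domDomCongr (blockEquiv h).symm) (e ∘ s)

theorem hodgeStar_apply {N k l : ℕ} (e : Fin N → V) (μ : V [⋀^Fin N]→ₗ[ℝ] ℝ) (h : k + l = N)
    (α : V [⋀^Fin k]→ₗ[ℝ] ℝ) (w : Fin l → V) :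
    hodgeStar e μ h α w = (k ! : ℝ)⁻¹ * ∑ s : Fin k → Fin N, α (e ∘ s) *
      μ (Sum.elim (e ∘ s) w ∘ (blockEquiv h).symm) := by
  rw [hodgeStar, AlternatingMap.smul_apply, alternating_sum_apply]
  rfl

theorem hodgeStar_compLinearMap {N k l : ℕ} (e : Fin N → V') (μ : V [⋀^Fin N]→ₗ[ℝ] ℝ)
    (h : k + l = N) (a : V [⋀^Fin k]→ₗ[ℝ] ℝ) (f : V' →ₗ[ℝ] V) :
    hodgeStar e (μ.compLinearMap f) h (a.compLinearMap f) =
      (hodgeStar (f ∘ e) μ h a).compLinearMap f := by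
  ext w
  simp only [hodgeStar_apply, AlternatingMap.compLinearMap_apply]
  congr 1
  refine Finset.sum_congr rfl fun t _ => ?_
  congr 2
  funext i
  simp only [Function.comp_apply]
  rcases (blockEquiv h).symm i with x | x <;> rfl

/-- Summation of a wedge product against an alternating function of the indices. -/
theorem sum_wedge_mul {N r l m : ℕ} (h : r + l = m) (e : Fin N → V)
    (η : V [⋀^Fin r]→ₗ[ℝ] ℝ) (β : V [⋀^Fin l]→ₗ[ℝ] ℝ) (T : (Fin m → Fin N) → ℝ)
    (hT : ∀ (σ : Perm (Fin m)) t, T (t ∘ σ) = ((Perm.sign σ : ℤ) : ℝ) * T t) :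
    ∑ t : Fin m → Fin N, wedge h η β (e ∘ t) * T t =
      ((r ! : ℝ) * l !)⁻¹ * m ! * ∑ t : Fin r → Fin N, ∑ u : Fin l → Fin N,
        η (e ∘ t) * β (e ∘ u) * T (Sum.elim t u ∘ (blockEquiv h).symm) := by
  -- Every `σ` contributes the same amount: after reindexing the pairs `(t, u)` by `σ`, the sign in
  -- the wedge product cancels the sign produced by `T`.
  have h1 : ∀ σ : Perm (Fin r ⊕ Fin l), ∑ t : Fin m → Fin N, ((Perm.sign σ : ℤ) : ℝ) *
      (η (fun i => (e ∘ t) (finCongr h (finSumFinEquiv (σ (Sum.inl i))))) *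
        β (fun i => (e ∘ t) (finCongr h (finSumFinEquiv (σ (Sum.inr i)))))) * T t =
      ∑ t : Fin r → Fin N, ∑ u : Fin l → Fin N,
        η (e ∘ t) * β (e ∘ u) * T (Sum.elim t u ∘ (blockEquiv h).symm) := by
    intro σ
    rw [← Fintype.sum_prod_type']
    let E : (Fin r → Fin N) × (Fin l → Fin N) ≃ (Fin m → Fin N) :=
      (Equiv.sumArrowEquivProdArrow (Fin r) (Fin l) (Fin N)).symm.trans
        (Equiv.arrowCongr (σ.trans (blockEquiv h)) (Equiv.refl _))
    refine (Fintype.sum_equiv E _ _ fun p => ?_).symm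
    have hE : ∀ i, E p (finCongr h (finSumFinEquiv (σ i))) = Sum.elim p.1 p.2 i := by
      intro i
      simp [E, Equiv.arrowCongr, Equiv.sumArrowEquivProdArrow]
    have hE2 : E p = (Sum.elim p.1 p.2 ∘ (blockEquiv h).symm) ∘
        ((blockEquiv h).permCongr σ⁻¹) := by
      funext i
      simp [E, Equiv.arrowCongr, Equiv.sumArrowEquivProdArrow, Perm.inv_def]
    have hs : ((Perm.sign σ : ℤ) : ℝ) * ((Perm.sign σ : ℤ) : ℝ) = 1 := by
      rw [← Int.cast_mul, ← Units.val_mul, Int.units_mul_self]; simp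
    rw [show T (E p) = _ from (congrArg T hE2).trans (hT _ _)]
    simp only [Function.comp_def, hE, Sum.elim_inl, Sum.elim_inr, Perm.sign_permCongr,
      Perm.sign_inv]
    linear_combination (-(η (fun i => e (p.1 i)) * β (fun i => e (p.2 i)) *
      T (fun i => Sum.elim p.1 p.2 ((blockEquiv h).symm i)))) * hs
  simp only [wedge_apply]
  simp_rw [mul_assoc, ← Finset.mul_sum, Finset.sum_mul]
  rw [Finset.sum_comm]
  simp_rw [← mul_assoc]
  simp_rw [← mul_assoc] at h1
  simp_rw [h1]
  rw [Finset.sum_const, Finset.card_univ, Fintype.card_perm, nsmul_eq_mul]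
  simp only [Fintype.card_sum, Fintype.card_fin, h]
  simp_rw [mul_assoc, ← Finset.mul_sum]

end ExteriorAlgebra

/-! ### Forms on `ℝᴺ` with its standard basis -/

section Model

variable {N : ℕ}

/-- The standard basis of `ℝᴺ`. -/
abbrev stdVec (N : ℕ) (i : Fin N) : Fin N → ℝ := Pi.single i 1

theorem ext_stdVec {k : ℕ} {a b : (Fin N → ℝ) [⋀^Fin k]→ₗ[ℝ] ℝ}
    (h : ∀ r : Fin k → Fin N, Function.Injective r → a (stdVec N ∘ r) = b (stdVec N ∘ r)) :
    a = b := by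
  refine Module.Basis.ext_alternating (Pi.basisFun ℝ (Fin N)) fun v hv => ?_
  simpa [Function.comp_def, stdVec] using h v hv

/-! ### Complementary multi-indices and the volume form -/

section Volume

variable {k l : ℕ} (h : k + l = N) (μ : (Fin N → ℝ) [⋀^Fin N]→ₗ[ℝ] ℝ)

/-- The value of `μ` on the standard vectors with indices `s` and `t`. -/
def volEntry (s : Fin k → Fin N) (t : Fin l → Fin N) : ℝ :=
  μ (stdVec N ∘ Sum.elim s t ∘ (blockEquiv h).symm)

variable {h μ}

theorem injective_of_volEntry_ne_zero {s : Fin k → Fin N} {t : Fin l → Fin N}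
    (hst : volEntry h μ s t ≠ 0) : Function.Injective (Sum.elim s t) := by
  by_contra hc
  refine hst (μ.map_eq_zero_of_not_injective _ fun hi => hc ?_)
  have h2 : Function.Injective (Sum.elim s t ∘ (blockEquiv h).symm) :=
    Function.Injective.of_comp hi
  exact (Equiv.injective_comp _ _).1 h2

/-- Complementary `s` and `t` list the whole basis once, so the entry is the sign of a permutation.
-/
theorem volEntry_sq (hμ : μ (stdVec N) = 1) {s : Fin k → Fin N} {t : Fin l → Fin N}
    (hst : Function.Injective (Sum.elim s t)) : volEntry h μ s t * volEntry h μ s t = 1 := by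
  have hb : Function.Bijective (Sum.elim s t ∘ (blockEquiv h).symm) := by
    rw [← Finite.injective_iff_bijective]
    exact hst.comp (blockEquiv h).symm.injective
  have : volEntry h μ s t = ((Perm.sign (Equiv.ofBijective _ hb) : ℤ) : ℝ) := by
    have := μ.map_perm (stdVec N) (Equiv.ofBijective _ hb)
    rw [hμ, Units.smul_def, zsmul_eq_mul, mul_one] at this
    exact this
  rw [this, ← Int.cast_mul, ← Units.val_mul, Int.units_mul_self]; simp

theorem volEntry_comp_left (s : Fin k → Fin N) (t : Fin l → Fin N) (σ : Perm (Fin k)) :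
    volEntry h μ (s ∘ σ) t = ((Perm.sign σ : ℤ) : ℝ) * volEntry h μ s t := by
  have := μ.map_perm (stdVec N ∘ Sum.elim s t ∘ (blockEquiv h).symm)
    ((blockEquiv h).permCongr (Equiv.sumCongr σ (Equiv.refl _)))
  rw [Perm.sign_permCongr, Perm.sign_sumCongr, Perm.sign_refl, mul_one, Units.smul_def,
    zsmul_eq_mul] at this
  rw [volEntry, volEntry, ← this]
  congr 1
  funext i
  simp only [Function.comp_apply, Equiv.permCongr_apply, Equiv.symm_apply_apply]
  rcases (blockEquiv h).symm i with x | x <;> simp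

theorem volEntry_comp_right (s : Fin k → Fin N) (t : Fin l → Fin N) (σ : Perm (Fin l)) :
    volEntry h μ s (t ∘ σ) = ((Perm.sign σ : ℤ) : ℝ) * volEntry h μ s t := by
  have := μ.map_perm (stdVec N ∘ Sum.elim s t ∘ (blockEquiv h).symm)
    ((blockEquiv h).permCongr (Equiv.sumCongr (Equiv.refl _) σ))
  rw [Perm.sign_permCongr, Perm.sign_sumCongr, Perm.sign_refl, one_mul, Units.smul_def,
    zsmul_eq_mul] at this
  rw [volEntry, volEntry, ← this]
  congr 1
  funext i
  simp only [Function.comp_apply, Equiv.permCongr_apply, Equiv.symm_apply_apply]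
  rcases (blockEquiv h).symm i with x | x <;> simp

theorem exists_perm_of_range_subset {k : ℕ} {κ : Type*} {r s : Fin k → κ}
    (hs : Function.Injective s) (hrs : Set.range s ⊆ Set.range r) :
    ∃ σ : Perm (Fin k), s = r ∘ σ := by
  choose σ hσ using fun i => hrs ⟨i, rfl⟩
  have hi : Function.Injective σ := fun i j hij => hs (by rw [← hσ i, ← hσ j, hij])
  exact ⟨Equiv.ofBijective σ (Finite.injective_iff_bijective.1 hi), funext fun i => (hσ i).symm⟩

theorem injective_comp_perm {k : ℕ} {κ : Type*} {r : Fin k → κ} (hr : Function.Injective r) :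
    Function.Injective fun σ : Perm (Fin k) => r ∘ σ := fun _ _ h =>
  Equiv.ext fun i => hr (congrFun h i)

theorem range_left_subset {s r : Fin k → Fin N} {t : Fin l → Fin N} (h : k + l = N)
    (hst : Function.Injective (Sum.elim s t)) (hrt : Function.Injective (Sum.elim r t)) :
    Set.range s ⊆ Set.range r := by
  rintro _ ⟨i, rfl⟩
  have hb : Function.Bijective (Sum.elim r t ∘ (blockEquiv h).symm) := by
    rw [← Finite.injective_iff_bijective]
    exact hrt.comp (blockEquiv h).symm.injective
  obtain ⟨y, hy⟩ := hb.2 (s i)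
  simp only [Function.comp_apply] at hy
  rcases hc : (blockEquiv h).symm y with x | x
  · rw [hc] at hy; exact ⟨x, hy⟩
  · rw [hc] at hy
    have := @hst (Sum.inr x) (Sum.inl i) hy
    simp at this

theorem range_right_subset {s : Fin k → Fin N} {t r : Fin l → Fin N} (h : k + l = N)
    (hst : Function.Injective (Sum.elim s t)) (hrt : Function.Injective (Sum.elim s r)) :
    Set.range t ⊆ Set.range r := by
  rintro _ ⟨i, rfl⟩
  have hb : Function.Bijective (Sum.elim s r ∘ (blockEquiv h).symm) := by
    rw [← Finite.injective_iff_bijective]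
    exact hrt.comp (blockEquiv h).symm.injective
  obtain ⟨y, hy⟩ := hb.2 (t i)
  simp only [Function.comp_apply] at hy
  rcases hc : (blockEquiv h).symm y with x | x
  · rw [hc] at hy
    have := @hst (Sum.inl x) (Sum.inr i) hy
    simp at this
  · rw [hc] at hy; exact ⟨x, hy⟩

theorem sign_mul_self_real {κ : Type*} [DecidableEq κ] [Fintype κ] (σ : Perm κ) :
    ((Perm.sign σ : ℤ) : ℝ) * ((Perm.sign σ : ℤ) : ℝ) = 1 := by
  rw [← Int.cast_mul, ← Units.val_mul, Int.units_mul_self]; simp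

/-- Only multi-indices complementary to `t` contribute. These are the `k!` rearrangements of `r`,
and the signs from `a` and from the volume form cancel. -/
theorem sum_mul_volEntry (a : (Fin N → ℝ) [⋀^Fin k]→ₗ[ℝ] ℝ) (r : Fin k → Fin N)
    (t : Fin l → Fin N) (hrt : Function.Injective (Sum.elim r t)) :
    ∑ s : Fin k → Fin N, a (stdVec N ∘ s) * volEntry h μ s t =
      k ! * (a (stdVec N ∘ r) * volEntry h μ r t) := by
  have hr : Function.Injective r := hrt.comp Sum.inl_injective
  rw [← Fintype.sum_of_injective (fun σ : Perm (Fin k) => r ∘ σ) (injective_comp_perm hr)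
    (fun _ => a (stdVec N ∘ r) * volEntry h μ r t)]
  · rw [Finset.sum_const, Finset.card_univ, Fintype.card_perm, Fintype.card_fin, nsmul_eq_mul]
  · intro s hs
    by_cases h0 : volEntry h μ s t = 0
    · rw [h0, mul_zero]
    · have hst := injective_of_volEntry_ne_zero h0
      obtain ⟨σ, rfl⟩ := exists_perm_of_range_subset (s := s) (hst.comp Sum.inl_injective)
        (range_left_subset h hst hrt)
      exact absurd ⟨σ, rfl⟩ hs
  · intro σ
    have h1 := a.map_perm (stdVec N ∘ r) σ
    rw [Units.smul_def, zsmul_eq_mul] at h1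
    rw [volEntry_comp_left, ← Function.comp_assoc, h1]
    linear_combination (-(a (stdVec N ∘ r) * volEntry h μ r t)) * sign_mul_self_real σ

theorem exists_complement (h : k + l = N) {r : Fin k → Fin N} (hr : Function.Injective r) :
    ∃ t : Fin l → Fin N, Function.Injective (Sum.elim r t) := by
  have hc : Fintype.card {x // x ∉ Set.range r} = l := by
    classical
    rw [Fintype.card_subtype_compl, Fintype.card_fin,
      show Fintype.card {x // x ∈ Set.range r} = k from by
        rw [← Fintype.card_congr (Equiv.ofInjective r hr), Fintype.card_fin]]
    omega
  let E := Fintype.equivFinOfCardEq hc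
  refine ⟨fun i => (E.symm i).1, ?_⟩
  rintro (i | i) (j | j) hij
  · exact congrArg _ (hr hij)
  · exact absurd ⟨i, hij⟩ (E.symm j).2
  · exact absurd ⟨j, hij.symm⟩ (E.symm i).2
  · exact congrArg _ (E.symm.injective (Subtype.ext hij))

theorem sum_volEntry_sq (hμ : μ (stdVec N) = 1) {r : Fin k → Fin N} (hr : Function.Injective r) :
    ∑ t : Fin l → Fin N, volEntry h μ r t * volEntry h μ r t = l ! := by
  obtain ⟨t₀, ht₀⟩ := exists_complement h hr
  rw [← Fintype.sum_of_injective (fun σ : Perm (Fin l) => t₀ ∘ σ)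
    (injective_comp_perm (ht₀.comp Sum.inr_injective)) (fun _ => (1 : ℝ))]
  · rw [Finset.sum_const, Finset.card_univ, Fintype.card_perm, Fintype.card_fin, nsmul_eq_mul,
      mul_one]
  · intro t ht
    by_cases h0 : volEntry h μ r t = 0
    · rw [h0, mul_zero]
    · have hst := injective_of_volEntry_ne_zero h0
      obtain ⟨σ, rfl⟩ := exists_perm_of_range_subset (s := t) (hst.comp Sum.inr_injective)
        (range_right_subset h hst ht₀)
      exact absurd ⟨σ, rfl⟩ ht
  · intro σ
    rw [volEntry_comp_right]
    linear_combination (-(volEntry h μ r t₀ * volEntry h μ r t₀)) * sign_mul_self_real σ -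
      volEntry_sq (h := h) hμ ht₀

/-- This is `⋆⋆ = ±1` without normalisation: for a basis multi-index `u`, the inner sum collapses to
one term, counted `k!` times, and the squares of the volume entries add up to `l!`. -/
theorem sum_sum_mul_volEntry (hμ : μ (stdVec N) = 1) (a : (Fin N → ℝ) [⋀^Fin k]→ₗ[ℝ] ℝ)
    (u : Fin k → Fin N → ℝ) :
    ∑ t : Fin l → Fin N, (∑ s : Fin k → Fin N, a (stdVec N ∘ s) * volEntry h μ s t) *
      μ (Sum.elim u (stdVec N ∘ t) ∘ (blockEquiv h).symm) = k ! * l ! * a u := by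
  -- Fixing the last `l` arguments of `μ` leaves an alternating form in `u`, so the identity need
  -- only be checked on basis vectors.
  let R : (Fin l → Fin N) → (Fin N → ℝ) [⋀^Fin k]→ₗ[ℝ] ℝ := fun t =>
    insertLeft (μ.domDomCongr ((Equiv.sumComm _ _).trans (blockEquiv h)).symm) (stdVec N ∘ t)
  have hR : ∀ t u, R t u = μ (Sum.elim u (stdVec N ∘ t) ∘ (blockEquiv h).symm) := by
    intro t u
    change μ (fun i => Sum.elim (stdVec N ∘ t) u
      (((Equiv.sumComm _ _).trans (blockEquiv h)).symm i)) = _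
    congr 1
    funext i
    simp only [Equiv.symm_trans_apply, Function.comp_apply, Equiv.sumComm_symm,
      Equiv.sumComm_apply]
    simp only [← Equiv.symm_trans_apply]
    rcases (blockEquiv h).symm i with x | x <;> rfl
  have key : ∑ t : Fin l → Fin N, (∑ s : Fin k → Fin N, a (stdVec N ∘ s) * volEntry h μ s t) •
      R t = ((k ! : ℝ) * l !) • a := by
    refine ext_stdVec fun r hr => ?_
    rw [alternating_sum_apply, AlternatingMap.smul_apply, smul_eq_mul]
    have hrt : ∀ t, R t (stdVec N ∘ r) = volEntry h μ r t := by
      intro t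
      rw [hR, volEntry, ← Function.comp_assoc, Sum.comp_elim]
    have : ∀ t ∈ (Finset.univ : Finset (Fin l → Fin N)),
        ((∑ s : Fin k → Fin N, a (stdVec N ∘ s) * volEntry h μ s t) • R t) (stdVec N ∘ r) =
        k ! * a (stdVec N ∘ r) * (volEntry h μ r t * volEntry h μ r t) := by
      intro t _
      rw [AlternatingMap.smul_apply, smul_eq_mul, hrt]
      by_cases h0 : volEntry h μ r t = 0
      · rw [h0]; ring
      · rw [sum_mul_volEntry a r t (injective_of_volEntry_ne_zero h0)]; ring
    rw [Finset.sum_congr rfl this, ← Finset.mul_sum, sum_volEntry_sq hμ hr]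
    ring
  have := congrArg (fun b : (Fin N → ℝ) [⋀^Fin k]→ₗ[ℝ] ℝ => b u) key
  simp only [alternating_sum_apply, AlternatingMap.smul_apply, smul_eq_mul, hR] at this
  exact this

end Volume

/-- The permutation that exchanges the last two of three blocks. -/
def blockSwap {r l j k m : ℕ} (hk : r + j = k) (hm : r + l = m) (h₁ : k + l = N)
    (h₂ : m + j = N) : Perm (Fin N) :=
  (blockEquiv h₂).symm.trans <|
    ((Equiv.sumCongr (blockEquiv hm).symm (Equiv.refl (Fin j))).trans <|
      (Equiv.sumAssoc _ _ _).trans <|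
      (Equiv.sumCongr (Equiv.refl (Fin r)) (Equiv.sumComm _ _)).trans <|
      (Equiv.sumAssoc _ _ _).symm.trans <|
      Equiv.sumCongr (blockEquiv hk) (Equiv.refl (Fin l))).trans <| blockEquiv h₁

/-- The operator `⋆(η ∧ ⋆ ·)` is, up to a nonzero constant, the contraction with `η`. -/
theorem hodgeStar_wedge_hodgeStar {r l j k m : ℕ} (hk : r + j = k) (hm : r + l = m)
    (h₁ : k + l = N) (h₂ : m + j = N) {μ : (Fin N → ℝ) [⋀^Fin N]→ₗ[ℝ] ℝ}
    (hμ : μ (stdVec N) = 1) (η : (Fin N → ℝ) [⋀^Fin r]→ₗ[ℝ] ℝ)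
    (a : (Fin N → ℝ) [⋀^Fin k]→ₗ[ℝ] ℝ) :
    hodgeStar (stdVec N) μ h₂ (wedge hm η (hodgeStar (stdVec N) μ h₁ a)) =
      (((Perm.sign (blockSwap hk hm h₁ h₂) : ℤ) : ℝ) * (r ! : ℝ)⁻¹) •
        contraction hk (stdVec N) η a := by
  ext w
  set ε : ℝ := ((Perm.sign (blockSwap hk hm h₁ h₂) : ℤ) : ℝ) with hε
  rw [hodgeStar_apply, AlternatingMap.smul_apply, smul_eq_mul, contraction_apply,
    sum_wedge_mul hm (stdVec N) η _
      (fun t => μ (Sum.elim (stdVec N ∘ t) w ∘ (blockEquiv h₂).symm))]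
  swap
  · intro σ t
    have := μ.map_perm (Sum.elim (stdVec N ∘ t) w ∘ (blockEquiv h₂).symm)
      ((blockEquiv h₂).permCongr (Equiv.sumCongr σ (Equiv.refl _)))
    rw [Perm.sign_permCongr, Perm.sign_sumCongr, Perm.sign_refl, mul_one, Units.smul_def,
      zsmul_eq_mul] at this
    rw [← this]
    congr 1
    funext i
    simp only [Function.comp_apply, Equiv.permCongr_apply, Equiv.symm_apply_apply]
    rcases (blockEquiv h₂).symm i with x | x <;> simp
  -- Exchanging the blocks `u` and `w` puts the double sum into the shape of `sum_sum_mul_volEntry`;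
  -- the sign depends on the degrees alone.
  have hsw : ∀ (t : Fin r → Fin N) (u : Fin l → Fin N),
      μ (Sum.elim (stdVec N ∘ Sum.elim t u ∘ (blockEquiv hm).symm) w ∘ (blockEquiv h₂).symm) =
      ε * μ (Sum.elim (Sum.elim (stdVec N ∘ t) w ∘ (blockEquiv hk).symm) (stdVec N ∘ u) ∘
        (blockEquiv h₁).symm) := by
    intro t u
    have := μ.map_perm (Sum.elim (Sum.elim (stdVec N ∘ t) w ∘ (blockEquiv hk).symm)
      (stdVec N ∘ u) ∘ (blockEquiv h₁).symm) (blockSwap hk hm h₁ h₂)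
    rw [Units.smul_def, zsmul_eq_mul] at this
    rw [hε, ← this]
    congr 1
    funext i
    unfold blockSwap
    generalize blockEquiv h₂ = A₂
    generalize blockEquiv h₁ = A₁
    generalize blockEquiv hm = Am
    generalize blockEquiv hk = Ak
    simp only [Function.comp_apply, Equiv.trans_apply, Equiv.sumCongr_apply,
      Equiv.symm_apply_apply]
    rcases A₂.symm i with x | x
    · simp only [Sum.elim_inl, Sum.map_inl, Function.comp_apply]
      rcases Am.symm x with y | y <;> simp
    · simp
  have hstar : ∀ u : Fin l → Fin N, hodgeStar (stdVec N) μ h₁ a (stdVec N ∘ u) =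
      (k ! : ℝ)⁻¹ * ∑ s : Fin k → Fin N, a (stdVec N ∘ s) * volEntry h₁ μ s u := by
    intro u
    rw [hodgeStar_apply]
    congr 1
    refine Finset.sum_congr rfl fun s _ => ?_
    rw [volEntry, ← Function.comp_assoc, Sum.comp_elim]
  have hinner : ∀ t : Fin r → Fin N, ∑ u : Fin l → Fin N,
      η (stdVec N ∘ t) * hodgeStar (stdVec N) μ h₁ a (stdVec N ∘ u) *
        μ (Sum.elim (stdVec N ∘ Sum.elim t u ∘ (blockEquiv hm).symm) w ∘ (blockEquiv h₂).symm) =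
      ε * l ! * (η (stdVec N ∘ t) *
        a (Sum.elim (stdVec N ∘ t) w ∘ (blockEquiv hk).symm)) := by
    intro t
    have hK := sum_sum_mul_volEntry (h := h₁) hμ a
      (Sum.elim (stdVec N ∘ t) w ∘ (blockEquiv hk).symm)
    have hk0 : (k ! : ℝ) ≠ 0 := by positivity
    calc _ = η (stdVec N ∘ t) * ε * (k ! : ℝ)⁻¹ * ∑ u : Fin l → Fin N,
          (∑ s : Fin k → Fin N, a (stdVec N ∘ s) * volEntry h₁ μ s u) *
          μ (Sum.elim (Sum.elim (stdVec N ∘ t) w ∘ (blockEquiv hk).symm) (stdVec N ∘ u) ∘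
            (blockEquiv h₁).symm) := by
          rw [Finset.mul_sum]
          refine Finset.sum_congr rfl fun u _ => ?_
          rw [hsw, hstar]; ring
      _ = _ := by rw [hK]; field_simp
  simp_rw [hinner, ← Finset.mul_sum]
  have : (m ! : ℝ) ≠ 0 := by positivity
  have : (l ! : ℝ) ≠ 0 := by positivity
  field_simp

/-- The scalar product of two forms on `ℝᴺ` (up to a factor). -/
def formInner {k : ℕ} (a b : (Fin N → ℝ) [⋀^Fin k]→ₗ[ℝ] ℝ) : ℝ :=
  ∑ s : Fin k → Fin N, a (stdVec N ∘ s) * b (stdVec N ∘ s)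

theorem eq_zero_of_formInner_self {k : ℕ} {a : (Fin N → ℝ) [⋀^Fin k]→ₗ[ℝ] ℝ}
    (h : formInner a a = 0) : a = 0 := by
  refine ext_stdVec fun r _ => ?_
  have := (Finset.sum_eq_zero_iff_of_nonneg (fun s _ => mul_self_nonneg _)).1 h r
    (Finset.mem_univ _)
  simpa using this

/-- Contraction is adjoint to exterior multiplication. Only the positivity of the factor matters
afterwards. -/
theorem formInner_wedge {r j m : ℕ} (h : r + j = m) (η : (Fin N → ℝ) [⋀^Fin r]→ₗ[ℝ] ℝ)
    (b : (Fin N → ℝ) [⋀^Fin j]→ₗ[ℝ] ℝ) (a : (Fin N → ℝ) [⋀^Fin m]→ₗ[ℝ] ℝ) :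
    formInner (wedge h η b) a =
      ((r ! : ℝ) * j !)⁻¹ * m ! * formInner b (contraction h (stdVec N) η a) := by
  rw [formInner, sum_wedge_mul h (stdVec N) η b (fun t => a (stdVec N ∘ t))]
  · congr 1
    rw [Finset.sum_comm, formInner]
    refine Finset.sum_congr rfl fun u _ => ?_
    rw [contraction_apply, Finset.mul_sum]
    refine Finset.sum_congr rfl fun t _ => ?_
    rw [← Function.comp_assoc, Sum.comp_elim]
    ring
  · intro σ t
    have := a.map_perm (stdVec N ∘ t) σ
    rw [Units.smul_def, zsmul_eq_mul] at this
    exact this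

instance finiteDimensional_alternating (k : ℕ) :
    FiniteDimensional ℝ ((Fin N → ℝ) [⋀^Fin k]→ₗ[ℝ] ℝ) := by
  let T : ((Fin N → ℝ) [⋀^Fin k]→ₗ[ℝ] ℝ) →ₗ[ℝ] ((Fin k → Fin N) → ℝ) :=
    { toFun := fun a s => a (stdVec N ∘ s)
      map_add' := fun _ _ => rfl
      map_smul' := fun _ _ => rfl }
  exact Module.Finite.of_injective T fun a b hab => ext_stdVec fun r _ => congrFun hab r

/-- An endomorphism `U` with `ker U² = ker U` has a generalised inverse which is a polynomial
in `U`. -/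
theorem exists_polynomial_generalised_inverse {E : Type*} [AddCommGroup E] [Module ℝ E]
    [FiniteDimensional ℝ E] (U : Module.End ℝ E) (hU : ∀ a, U (U a) = 0 → U a = 0) :
    ∃ q : Polynomial ℝ, ∀ a, U (Polynomial.aeval U q (U a)) = U a := by
  have hpow : ∀ (i : ℕ) (a : E), (U ^ (i + 1)) a = 0 → U a = 0 := by
    intro i
    induction i with
    | zero => intro a h; simpa using h
    | succ i ih =>
      intro a h
      refine hU a (ih (U a) ?_)
      rw [pow_succ] at h
      exact h
  have hp : minpoly ℝ U ≠ 0 := minpoly.ne_zero (Algebra.IsIntegral.isIntegral U)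
  -- Split off the root `0` of the minimal polynomial; by the previous step a single factor `U` does
  -- the work of `U ^ i`, so `U r(U) = 0`.
  obtain ⟨i, r, hr0, hr⟩ : ∃ (i : ℕ) (r : Polynomial ℝ), r.coeff 0 ≠ 0 ∧
      minpoly ℝ U = Polynomial.X ^ i * r := by
    obtain ⟨r, hr, hd⟩ := Polynomial.exists_eq_pow_rootMultiplicity_mul_and_not_dvd _ hp 0
    rw [Polynomial.C_0, sub_zero] at hr hd
    exact ⟨_, r, fun h => hd (Polynomial.X_dvd_iff.2 h), hr⟩
  have hUr : ∀ a, U (Polynomial.aeval U r a) = 0 := by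
    intro a
    refine hpow i _ ?_
    have h0 : Polynomial.aeval U (minpoly ℝ U) = 0 := minpoly.aeval ℝ U
    rw [hr, map_mul, map_pow, Polynomial.aeval_X] at h0
    rw [pow_succ', Module.End.mul_apply]
    have := LinearMap.congr_fun h0 a
    rw [Module.End.mul_apply] at this
    rw [this]
    simp
  -- With `r = X d + r(0)`, the relation `U r(U) = 0` reads `U² d(U) = -r(0) U`, so `q = -d / r(0)`
  -- is a generalised inverse.
  refine ⟨Polynomial.C (-(r.coeff 0)⁻¹) * r.divX, fun a => ?_⟩
  have h1 := hUr a
  rw [← Polynomial.X_mul_divX_add r, map_add, map_mul, Polynomial.aeval_X, Polynomial.aeval_C] at h1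
  simp only [LinearMap.add_apply, Module.End.mul_apply, Module.algebraMap_end_apply, map_add,
    map_smul] at h1
  have hcomm : ∀ b, U (Polynomial.aeval U r.divX b) = Polynomial.aeval U r.divX (U b) := by
    intro b
    have : Commute U (Polynomial.aeval U r.divX) := by
      have := (Polynomial.commute_X r.divX)
      simpa using (this.map (Polynomial.aeval U).toRingHom)
    exact LinearMap.congr_fun this.eq b
  rw [map_mul, Polynomial.aeval_C, Module.End.mul_apply, Module.algebraMap_end_apply, map_smul,
    ← hcomm]
  rw [eq_neg_of_add_eq_zero_left h1, smul_neg, neg_smul, neg_neg, smul_smul, inv_mul_cancel₀ hr0,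
    one_smul]

/-- The operator `η ∧ (η ⌟ ·)`. -/
def wedgeContraction {V : Type*} [AddCommGroup V] [Module ℝ V] {r j m : ℕ} (h : r + j = m)
    (e : Fin N → V) (η : V [⋀^Fin r]→ₗ[ℝ] ℝ) : Module.End ℝ (V [⋀^Fin m]→ₗ[ℝ] ℝ) :=
  wedgeBilin h η ∘ₗ contractionHom h e η

/-- The quantifiers matter: `q` depends on `η` and the degree but not on `a`. On the manifold one
polynomial with constant coefficients therefore works at every point. -/
theorem exists_polynomial_contraction {r j m : ℕ} (h : r + j = m)
    (η : (Fin N → ℝ) [⋀^Fin r]→ₗ[ℝ] ℝ) :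
    ∃ q : Polynomial ℝ, ∀ a : (Fin N → ℝ) [⋀^Fin m]→ₗ[ℝ] ℝ,
      contraction h (stdVec N) η (a - wedgeContraction h (stdVec N) η
        (Polynomial.aeval (wedgeContraction h (stdVec N) η) q a)) = 0 := by
  set U := wedgeContraction h (stdVec N) η
  have hc0 : ((r ! : ℝ) * j !)⁻¹ * m ! ≠ 0 := by positivity
  -- The scalar product of `U a` with `a` is a positive multiple of the squared norm of the
  -- contraction of `a`.
  have hker : ∀ a, U a = 0 → contraction h (stdVec N) η a = 0 := by
    intro a ha
    have h1 := formInner_wedge h η (contraction h (stdVec N) η a) a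
    rw [show wedge h η (contraction h (stdVec N) η a) = 0 from ha] at h1
    refine eq_zero_of_formInner_self ?_
    rcases mul_eq_zero.1 (h1.symm.trans (by simp [formInner])) with h2 | h2
    · exact absurd h2 hc0
    · exact h2
  -- If `U (U a) = 0`, then the contraction of `U a` vanishes, and by adjointness `U a` is
  -- orthogonal to itself.
  have hU : ∀ a, U (U a) = 0 → U a = 0 := by
    intro a ha
    have h1 := hker _ ha
    have h2 := formInner_wedge h η (contraction h (stdVec N) η a) (U a)
    rw [h1] at h2
    have h3 : formInner (U a) (U a) = 0 := h2.trans (by simp [formInner])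
    exact eq_zero_of_formInner_self h3
  obtain ⟨q, hq⟩ := exists_polynomial_generalised_inverse U hU
  refine ⟨q, fun a => hker _ ?_⟩
  have hcomm : Polynomial.aeval U q (U a) = U (Polynomial.aeval U q a) := by
    have : Commute U (Polynomial.aeval U q) := by
      simpa using ((Polynomial.commute_X q).map (Polynomial.aeval U).toRingHom)
    exact (LinearMap.congr_fun this.eq a).symm
  rw [map_sub, ← hcomm, hq, sub_self]

end Model

/-! ### Hypercomplex structures and quaternionic bases -/

section Units

variable {V V' : Type*} [AddCommGroup V] [Module ℝ V] [TopologicalSpace V]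
  [AddCommGroup V'] [Module ℝ V'] [TopologicalSpace V']
  {H : Submodule ℝ V} {I J K : V →L[ℝ] V}

/-- The reversed products follow from the cyclic ones: here `I u = J (K u)`, and `J² = -1`. -/
theorem IsHypercomplexOn.J_I (h : IsHypercomplexOn H I J K) {u : V} (hu : u ∈ H) :
    J (I u) = -K u := by
  have h1 := h.J_J (K u) (h.mapsTo_K u hu)
  rwa [h.J_K u hu] at h1

theorem IsHypercomplexOn.K_J (h : IsHypercomplexOn H I J K) {u : V} (hu : u ∈ H) :
    K (J u) = -I u := by
  have h1 := h.K_K (I u) (h.mapsTo_I u hu)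
  rwa [h.K_I u hu] at h1

theorem IsHypercomplexOn.I_K (h : IsHypercomplexOn H I J K) {u : V} (hu : u ∈ H) :
    I (K u) = -J u := by
  have h1 := h.I_I (J u) (h.mapsTo_J u hu)
  rwa [h.I_J u hu] at h1

/-- The form `Ω_I ∧ Ω_I + Ω_J ∧ Ω_J + Ω_K ∧ Ω_K`. -/
def quaternionicForm (g : V →L[ℝ] V →L[ℝ] ℝ) (I J K : V →L[ℝ] V) : V [⋀^Fin 4]→ₗ[ℝ] ℝ :=
  wedge rfl (fundamentalForm g I) (fundamentalForm g I)
    + wedge rfl (fundamentalForm g J) (fundamentalForm g J)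
    + wedge rfl (fundamentalForm g K) (fundamentalForm g K)

theorem fundamentalForm_apply_eq (g : V →L[ℝ] V →L[ℝ] ℝ) (A : V →L[ℝ] V) (v : Fin 2 → V) :
    fundamentalForm g A v = (1 / 2 : ℝ) * (g (A (v 0)) (v 1) - g (A (v 1)) (v 0)) := rfl

theorem fundamentalForm_compLinearMap {g : V →L[ℝ] V →L[ℝ] ℝ} {A : V →L[ℝ] V}
    {g' : V' →L[ℝ] V' →L[ℝ] ℝ} {A' : V' →L[ℝ] V'} {f : V →ₗ[ℝ] V'}
    (h : ∀ u v, g (A u) v = g' (A' (f u)) (f v)) :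
    fundamentalForm g A = (fundamentalForm g' A').compLinearMap f := by
  ext v
  simp only [fundamentalForm_apply_eq, AlternatingMap.compLinearMap_apply, h]

theorem quaternionicForm_compLinearMap {g : V →L[ℝ] V →L[ℝ] ℝ} {I J K : V →L[ℝ] V}
    {g' : V' →L[ℝ] V' →L[ℝ] ℝ} {I' J' K' : V' →L[ℝ] V'} {f : V →ₗ[ℝ] V'}
    (hI : ∀ u v, g (I u) v = g' (I' (f u)) (f v)) (hJ : ∀ u v, g (J u) v = g' (J' (f u)) (f v))
    (hK : ∀ u v, g (K u) v = g' (K' (f u)) (f v)) :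
    quaternionicForm g I J K = (quaternionicForm g' I' J' K').compLinearMap f := by
  rw [quaternionicForm, fundamentalForm_compLinearMap hI, fundamentalForm_compLinearMap hJ,
    fundamentalForm_compLinearMap hK, wedge_compLinearMap, wedge_compLinearMap,
    wedge_compLinearMap]
  rfl

/-- Every vector space with a quaternionic Hermitian structure has a quaternionic orthonormal
basis. -/
theorem exists_quaternionic_basis [FiniteDimensional ℝ V] {n : ℕ} (hn : Module.finrank ℝ V = 4 * n)
    (g : V →L[ℝ] V →L[ℝ] ℝ) (hs : ∀ u v, g u v = g v u) (hp : ∀ v, v ≠ 0 → 0 < g v v)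
    {I J K : V →L[ℝ] V} (h : IsHypercomplexOn ⊤ I J K) (hI : ∀ u v, g (I u) (I v) = g u v)
    (hJ : ∀ u v, g (J u) (J v) = g u v) (hK : ∀ u v, g (K u) (K v) = g u v) :
    ∃ e : Fin n × Fin 4 → V, (∀ c d, g (e c) (e d) = if c = d then 1 else 0) ∧
      (∀ a, e (a, 1) = I (e (a, 0))) ∧ (∀ a, e (a, 2) = J (e (a, 0))) ∧
      (∀ a, e (a, 3) = K (e (a, 0))) := by
  have top : ∀ w : V, w ∈ (⊤ : Submodule ℝ V) := fun _ => trivial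
  have II := fun u => h.I_I u (top u)
  have JJ := fun u => h.J_J u (top u)
  have KK := fun u => h.K_K u (top u)
  have IJ := fun u => h.I_J u (top u)
  have JK := fun u => h.J_K u (top u)
  have KI := fun u => h.K_I u (top u)
  have JI := fun u => h.J_I (top u)
  have KJ := fun u => h.K_J (top u)
  have IK := fun u => h.I_K (top u)
  have sI : ∀ u v, g u (I v) = -g (I u) v := fun u v => by rw [← hI u, II, map_neg]
  have sJ : ∀ u v, g u (J v) = -g (J u) v := fun u v => by rw [← hJ u, JJ, map_neg]
  have sK : ∀ u v, g u (K v) = -g (K u) v := fun u v => by rw [← hK u, KK, map_neg]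
  have zI : ∀ v, g (I v) v = 0 := fun v => by have := sI v v; rw [hs v] at this; linarith
  have zJ : ∀ v, g (J v) v = 0 := fun v => by have := sJ v v; rw [hs v] at this; linarith
  have zK : ∀ v, g (K v) v = 0 := fun v => by have := sK v v; rw [hs v] at this; linarith
  -- The four spanning vectors of the quaternionic line through `v`.
  let U : V → Fin 4 → V := fun v => ![v, I v, J v, K v]
  have hU1 : ∀ v, g v v = 1 → ∀ c d, g (U v c) (U v d) = if c = d then 1 else 0 := by
    intro v hv c d
    fin_cases c <;> fin_cases d <;>
      simp [U, II, JJ, KK, IJ, JK, KI, JI, KJ, IK, sI, sJ, sK, zI, zJ, zK, hv]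
  -- The units are skew for `g` and permute the line of `u` up to signs. Hence orthogonality of `v`
  -- to that line already makes the two lines orthogonal.
  have hU0 : ∀ u v, (∀ c, g (U u c) v = 0) → ∀ c d, g (U u c) (U v d) = 0 := by
    intro u v huv c d
    have h0 := huv 0
    have h1 := huv 1
    have h2 := huv 2
    have h3 := huv 3
    simp only [U, Matrix.cons_val] at h0 h1 h2 h3
    fin_cases c <;> fin_cases d <;>
      simp [U, II, JJ, KK, IJ, JK, KI, JI, KJ, IK, sI, sJ, sK, h0, h1, h2, h3]
  have key : ∀ r ≤ n, ∃ f : Fin r → V, ∀ a b c d, g (U (f a) c) (U (f b) d) =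
      if a = b ∧ c = d then 1 else 0 := by
    intro r
    induction r with
    | zero => exact fun _ => ⟨Fin.elim0, fun a => a.elim0⟩
    | succ r ih =>
      intro hr
      obtain ⟨f, hf⟩ := ih (by omega)
      let T : V →ₗ[ℝ] (Fin r × Fin 4 → ℝ) := LinearMap.pi fun c => (g (U (f c.1) c.2)).toLinearMap
      -- The `r` lines found so far impose `4r < 4n` linear conditions on the next vector.
      have hT : LinearMap.ker T ≠ ⊥ := by
        refine LinearMap.ker_ne_bot_of_finrank_lt ?_
        rw [Module.finrank_fintype_fun_eq_card, Fintype.card_prod, Fintype.card_fin,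
          Fintype.card_fin, hn]
        omega
      obtain ⟨v, hv, hv0⟩ := Submodule.exists_mem_ne_zero_of_ne_bot hT
      have hvU : ∀ a c, g (U (f a) c) v = 0 := fun a c => congrFun (LinearMap.mem_ker.1 hv) (a, c)
      have hpos := hp v hv0
      set w := (Real.sqrt (g v v))⁻¹ • v with hw
      have hww : g w w = 1 := by
        rw [hw, map_smul, map_smul, _root_.smul_apply, smul_eq_mul, smul_eq_mul,
          ← mul_assoc, ← mul_inv, Real.mul_self_sqrt hpos.le, inv_mul_cancel₀ hpos.ne']
      have hwU : ∀ a c, g (U (f a) c) w = 0 := fun a c => by rw [hw, map_smul, hvU, smul_zero]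
      refine ⟨Fin.snoc f w, fun a b c d => ?_⟩
      induction a using Fin.lastCases with
      | last =>
        induction b using Fin.lastCases with
        | last => simp only [Fin.snoc_last, hU1 w hww, true_and]
        | cast b =>
          simp only [Fin.snoc_last, Fin.snoc_castSucc]
          rw [hs, hU0 _ _ (hwU b), if_neg]
          exact fun hc => (Fin.castSucc_lt_last b).ne' hc.1
      | cast a =>
        induction b using Fin.lastCases with
        | last =>
          simp only [Fin.snoc_last, Fin.snoc_castSucc]
          rw [hU0 _ _ (hwU a), if_neg]
          exact fun hc => (Fin.castSucc_lt_last a).ne hc.1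
        | cast b => simp only [Fin.snoc_castSucc, hf, Fin.castSucc_inj]
  obtain ⟨f, hf⟩ := key n le_rfl
  refine ⟨fun c => U (f c.1) c.2, fun c d => ?_, fun a => rfl, fun a => rfl, fun a => rfl⟩
  simp only [hf, Prod.ext_iff]

variable [IsTopologicalAddGroup V] [ContinuousSMul ℝ V]

/-- `A ↦ Ω_A` as a linear map. -/
def fundamentalFormHom (g : V →L[ℝ] V →L[ℝ] ℝ) : (V →L[ℝ] V) →ₗ[ℝ] V [⋀^Fin 2]→ₗ[ℝ] ℝ where
  toFun := fundamentalForm g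
  map_add' A B := by
    ext v
    simp [fundamentalForm_apply_eq]; ring
  map_smul' c A := by
    ext v
    simp [fundamentalForm_apply_eq]; ring

theorem fundamentalFormHom_apply (g : V →L[ℝ] V →L[ℝ] ℝ) (A : V →L[ℝ] V) :
    fundamentalFormHom g A = fundamentalForm g A := rfl

/-- Two hypercomplex structures that span the same space of endomorphisms define the same
`4`-form. -/
theorem quaternionicForm_eq_of_mem_span [Nontrivial V] (g : V →L[ℝ] V →L[ℝ] ℝ)
    {I J K I' J' K' : V →L[ℝ] V} (h : IsHypercomplexOn ⊤ I J K) (h' : IsHypercomplexOn ⊤ I' J' K')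
    (hI : I' ∈ Submodule.span ℝ {I, J, K}) (hJ : J' ∈ Submodule.span ℝ {I, J, K})
    (hK : K' ∈ Submodule.span ℝ {I, J, K}) :
    quaternionicForm g I' J' K' = quaternionicForm g I J K := by
  rw [Submodule.mem_span_triple] at hI hJ hK
  obtain ⟨a₁, a₂, a₃, hI⟩ := hI
  obtain ⟨b₁, b₂, b₃, hJ⟩ := hJ
  obtain ⟨c₁, c₂, c₃, hK⟩ := hK
  obtain ⟨u, hu⟩ := exists_ne (0 : V)
  have top : ∀ w : V, w ∈ (⊤ : Submodule ℝ V) := fun _ => trivial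
  -- The anticommutator of two imaginary quaternions is `-2` times the scalar product of their
  -- coefficients. Evaluated at the nonzero `u`, it turns the hypercomplex relations into
  -- orthonormality of the rows `a`, `b`, `c`.
  have prod : ∀ x₁ x₂ x₃ y₁ y₂ y₃ : ℝ, (x₁ • I + x₂ • J + x₃ • K) ((y₁ • I + y₂ • J + y₃ • K) u) +
      (y₁ • I + y₂ • J + y₃ • K) ((x₁ • I + x₂ • J + x₃ • K) u) =
      (-2 * (x₁ * y₁ + x₂ * y₂ + x₃ * y₃)) • u := by
    intro x₁ x₂ x₃ y₁ y₂ y₃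
    simp only [_root_.add_apply, _root_.smul_apply, map_add, map_smul,
      h.I_I u (top u), h.J_J u (top u), h.K_K u (top u), h.I_J u (top u), h.J_K u (top u),
      h.K_I u (top u), h.J_I (top u), h.K_J (top u), h.I_K (top u)]
    module
  have hval : ∀ {c d : ℝ}, c • u = d • u → c = d := fun hcd => smul_left_injective ℝ hu hcd
  have haa : a₁ * a₁ + a₂ * a₂ + a₃ * a₃ = 1 := by
    have := prod a₁ a₂ a₃ a₁ a₂ a₃
    rw [hI, h'.I_I u (top u)] at this
    have := hval (c := -2) (by rw [← this]; module)
    linarith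
  have hbb : b₁ * b₁ + b₂ * b₂ + b₃ * b₃ = 1 := by
    have := prod b₁ b₂ b₃ b₁ b₂ b₃
    rw [hJ, h'.J_J u (top u)] at this
    have := hval (c := -2) (by rw [← this]; module)
    linarith
  have hcc : c₁ * c₁ + c₂ * c₂ + c₃ * c₃ = 1 := by
    have := prod c₁ c₂ c₃ c₁ c₂ c₃
    rw [hK, h'.K_K u (top u)] at this
    have := hval (c := -2) (by rw [← this]; module)
    linarith
  have hab : a₁ * b₁ + a₂ * b₂ + a₃ * b₃ = 0 := by
    have := prod a₁ a₂ a₃ b₁ b₂ b₃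
    rw [hI, hJ, h'.I_J u (top u), h'.J_I (top u)] at this
    have := hval (c := 0) (by rw [← this]; module)
    linarith
  have hbc : b₁ * c₁ + b₂ * c₂ + b₃ * c₃ = 0 := by
    have := prod b₁ b₂ b₃ c₁ c₂ c₃
    rw [hJ, hK, h'.J_K u (top u), h'.K_J (top u)] at this
    have := hval (c := 0) (by rw [← this]; module)
    linarith
  have hca : c₁ * a₁ + c₂ * a₂ + c₃ * a₃ = 0 := by
    have := prod c₁ c₂ c₃ a₁ a₂ a₃
    rw [hI, hK, h'.K_I u (top u), h'.I_K (top u)] at this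
    have := hval (c := 0) (by rw [← this]; module)
    linarith
  have hR : !![a₁, a₂, a₃; b₁, b₂, b₃; c₁, c₂, c₃] * !![a₁, b₁, c₁; a₂, b₂, c₂; a₃, b₃, c₃] = 1 := by
    ext i j
    fin_cases i <;> fin_cases j <;>
      simp [Matrix.mul_apply, Fin.sum_univ_three] <;> linarith
  -- Orthonormal rows give orthonormal columns, which are what the coefficients of the expanded
  -- `4`-form involve.
  rw [mul_eq_one_comm] at hR
  have e := fun i j => congrFun (congrFun hR i) j
  have e00 := e 0 0
  have e01 := e 0 1
  have e02 := e 0 2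
  have e10 := e 1 0
  have e11 := e 1 1
  have e12 := e 1 2
  have e20 := e 2 0
  have e21 := e 2 1
  have e22 := e 2 2
  simp [Matrix.mul_apply, Fin.sum_univ_three] at e00 e01 e02 e10 e11 e12 e20 e21 e22
  simp only [quaternionicForm, ← fundamentalFormHom_apply, ← wedgeBilin_apply, ← hI, ← hJ, ← hK]
  simp only [map_add, map_smul, LinearMap.add_apply, LinearMap.smul_apply]
  generalize (fundamentalFormHom g) I = X
  generalize (fundamentalFormHom g) J = Y
  generalize (fundamentalFormHom g) K = Z
  generalize wedgeBilin (V := V) _ = B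
  linear_combination (norm := module) e00 • B X X + e01 • B X Y + e02 • B X Z + e10 • B Y X +
    e11 • B Y Y + e12 • B Y Z + e20 • B Z X + e21 • B Z Y + e22 • B Z Z

end Units

/-! ### Contraction in an arbitrary basis -/

section OrthonormalChange

variable {V : Type*} [AddCommGroup V] [Module ℝ V] {N : ℕ}

theorem map_sum_smul_alternating {k : ℕ} (α : V [⋀^Fin k]→ₗ[ℝ] ℝ) (b : Fin N → V)
    (P : Fin k → Fin N → ℝ) :
    α (fun i => ∑ c, P i c • b c) = ∑ r : Fin k → Fin N, (∏ i, P i (r i)) * α (b ∘ r) := by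
  refine (α.toMultilinearMap.map_sum (fun (i : Fin k) (c : Fin N) => P i c • b c)).trans
    (Finset.sum_congr rfl fun r _ => ?_)
  exact α.toMultilinearMap.map_smul_univ _ _

/-- The contraction in terms of an arbitrary basis, with the inverse of its Gram matrix. -/
theorem contraction_eq_sum_basis {r j m : ℕ} (h : r + j = m) (g : V →ₗ[ℝ] V →ₗ[ℝ] ℝ)
    (b : Module.Basis (Fin N) ℝ V) (e : Fin N → V)
    (he : ∀ c d, g (e c) (e d) = if c = d then 1 else 0)
    (η : V [⋀^Fin r]→ₗ[ℝ] ℝ) (a : V [⋀^Fin m]→ₗ[ℝ] ℝ) (w : Fin j → V) :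
    contraction h e η a w = ∑ s : Fin r → Fin N, ∑ t : Fin r → Fin N,
      (∏ i, (Matrix.of fun c d => g (b c) (b d))⁻¹ (s i) (t i)) *
        (η (b ∘ s) * a (Sum.elim (b ∘ t) w ∘ (blockEquiv h).symm)) := by
  let P : Matrix (Fin N) (Fin N) ℝ := Matrix.of fun c d => b.repr (e c) d
  have hP : ∀ c, e c = ∑ d, P c d • b d := fun c => (b.sum_repr (e c)).symm
  -- If `G` is the Gram matrix of `b`, orthonormality of `e` reads `P G Pᵀ = 1`, whence `G⁻¹ = Pᵀ
  -- P`. The right-hand side of the theorem therefore does not involve `e`.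
  have hinv : (Matrix.of fun c d => g (b c) (b d))⁻¹ = P.transpose * P := by
    refine Matrix.inv_eq_right_inv ?_
    rw [← Matrix.mul_assoc]
    refine mul_eq_one_comm.1 ?_
    ext c d
    rw [Matrix.one_apply, ← he c d, hP c, hP d]
    simp only [map_sum, map_smul, LinearMap.sum_apply, LinearMap.smul_apply, Matrix.mul_apply,
      Matrix.of_apply, Matrix.transpose_apply, smul_eq_mul, Finset.mul_sum]
    rw [Finset.sum_comm]
    refine Finset.sum_congr rfl fun x _ => Finset.sum_congr rfl fun y _ => ?_
    ring
  have hη : ∀ t : Fin r → Fin N, η (e ∘ t) =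
      ∑ s : Fin r → Fin N, (∏ i, P (t i) (s i)) * η (b ∘ s) := by
    intro t
    rw [← map_sum_smul_alternating]
    exact congrArg η (funext fun i => hP (t i))
  let R : V [⋀^Fin r]→ₗ[ℝ] ℝ :=
    insertLeft (a.domDomCongr ((Equiv.sumComm _ _).trans (blockEquiv h)).symm) w
  have hR : ∀ u, R u = a (Sum.elim u w ∘ (blockEquiv h).symm) := by
    intro u
    change a (fun i => Sum.elim w u (((Equiv.sumComm _ _).trans (blockEquiv h)).symm i)) = _
    congr 1
    funext i
    generalize blockEquiv h = A
    simp only [Equiv.symm_trans_apply, Function.comp_apply, Equiv.sumComm_symm,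
      Equiv.sumComm_apply]
    rcases A.symm i with x | x <;> rfl
  have ha : ∀ t : Fin r → Fin N, a (Sum.elim (e ∘ t) w ∘ (blockEquiv h).symm) =
      ∑ s : Fin r → Fin N, (∏ i, P (t i) (s i)) *
        a (Sum.elim (b ∘ s) w ∘ (blockEquiv h).symm) := by
    intro t
    simp only [← hR]
    rw [← map_sum_smul_alternating]
    exact congrArg R (funext fun i => hP (t i))
  rw [contraction_apply]
  simp only [hη, ha, hinv, Matrix.mul_apply, Matrix.transpose_apply, Finset.prod_univ_sum,
    Fintype.piFinset_univ, Finset.sum_mul, Finset.mul_sum]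
  rw [Finset.sum_comm, Finset.sum_congr rfl fun s _ => Finset.sum_comm]
  conv_rhs => rw [Finset.sum_comm]
  refine Finset.sum_congr rfl fun s _ => ?_
  refine Finset.sum_congr rfl fun t _ => Finset.sum_congr rfl fun q _ => ?_
  rw [Finset.prod_mul_distrib]
  ring

end OrthonormalChange

/-! ### Forms that vanish on a subspace -/

section Horizontal

variable {V : Type*} [AddCommGroup V] [Module ℝ V]

/-- A form that vanishes when one argument lies in `P` only depends on its arguments modulo `P`. -/
theorem map_eq_of_sub_mem {k : ℕ} {α : V [⋀^Fin k]→ₗ[ℝ] ℝ} {P : Submodule ℝ V}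
    (hα : ∀ v : Fin k → V, (∃ j, v j ∈ P) → α v = 0) {v w : Fin k → V}
    (h : ∀ j, v j - w j ∈ P) : α v = α w := by
  -- Replace the arguments one at a time; each replacement changes the value by that of `α` with one
  -- argument in `P`.
  have key : ∀ s : Finset (Fin k), α (s.piecewise w v) = α v := by
    intro s
    induction s using Finset.induction_on with
    | empty => simp
    | insert i s hi ih =>
      rw [Finset.piecewise_insert, ← ih]
      have h1 := α.map_update_sub (s.piecewise w v) i (v i) (w i)
      rw [hα _ ⟨i, by rw [Function.update_self]; exact h i⟩] at h1
      have h2 : Function.update (s.piecewise w v) i (v i) = s.piecewise w v := by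
        rw [Function.update_eq_self_iff, Finset.piecewise_eq_of_notMem _ _ _ hi]
      rw [h2] at h1
      linarith
  have := key Finset.univ
  rw [Finset.piecewise_univ] at this
  exact this.symm

end Horizontal

/-! ### The standard quaternionic form on `ℝ⁴ⁿ` -/

section ModelForms

/-- The indices of a quaternionic frame. -/
abbrev frameIndex (n : ℕ) : Fin (4 * n) ≃ Fin n × Fin 4 :=
  (finCongr (mul_comm 4 n)).trans finProdFinEquiv.symm

/-- The form `1/2 ∑ B c d (xᶜ ∧ xᵈ)`. -/
def matrixForm {N : ℕ} (B : Fin N → Fin N → ℝ) : (Fin N → ℝ) [⋀^Fin 2]→ₗ[ℝ] ℝ :=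
  let β : (Fin N → ℝ) →ₗ[ℝ] (Fin N → ℝ) →ₗ[ℝ] ℝ := Matrix.toLinearMap₂' ℝ (Matrix.of B)
  { toFun := fun v => (1 / 2 : ℝ) * (β (v 0) (v 1) - β (v 1) (v 0))
    map_update_add' := fun v i a b => by
      fin_cases i <;> simp [Function.update] <;> ring
    map_update_smul' := fun v i c a => by
      fin_cases i <;> simp [Function.update] <;> ring
    map_eq_zero_of_eq' := fun v i j hv hij => by
      fin_cases i <;> fin_cases j <;> simp_all }

theorem matrixForm_apply {N : ℕ} (B : Fin N → Fin N → ℝ) (v : Fin 2 → Fin N → ℝ) :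
    matrixForm B v = (1 / 2 : ℝ) * ((∑ c, ∑ d, v 0 c * v 1 d * B c d) -
      ∑ c, ∑ d, v 1 c * v 0 d * B c d) := by
  change (1 / 2 : ℝ) * (Matrix.toLinearMap₂' ℝ (Matrix.of B) (v 0) (v 1) -
    Matrix.toLinearMap₂' ℝ (Matrix.of B) (v 1) (v 0)) = _
  simp [Matrix.toLinearMap₂'_apply, mul_assoc]

/-- The matrix of an endomorphism that permutes the frame up to signs. -/
def unitMatrix (n : ℕ) (s : Fin 4 → ℝ) (π : Fin 4 → Fin 4) (i j : Fin (4 * n)) : ℝ :=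
  s (frameIndex n i).2 *
    if ((frameIndex n i).1, π (frameIndex n i).2) = frameIndex n j then 1 else 0

/-- The form `Ω` of the standard quaternionic structure of `ℝ⁴ⁿ`. -/
def modelForm (n : ℕ) : (Fin (4 * n) → ℝ) [⋀^Fin 4]→ₗ[ℝ] ℝ :=
  let ωI := matrixForm (unitMatrix n ![1, -1, 1, -1] ![1, 0, 3, 2])
  let ωJ := matrixForm (unitMatrix n ![1, -1, -1, 1] ![2, 3, 0, 1])
  let ωK := matrixForm (unitMatrix n ![1, 1, -1, -1] ![3, 2, 1, 0])
  wedge rfl ωI ωI + wedge rfl ωJ ωJ + wedge rfl ωK ωK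

theorem det_stdVec (N : ℕ) : (Matrix.detRowAlternating : (Fin N → ℝ) [⋀^Fin N]→ₗ[ℝ] ℝ)
    (stdVec N) = 1 := by
  change Matrix.det (fun i => stdVec N i) = 1
  rw [← Matrix.det_one (R := ℝ) (n := Fin N)]
  congr 1
  ext i j
  simp [stdVec, Matrix.one_apply, Pi.single_apply, eq_comm]

end ModelForms

/-! ### Coordinates of a quaternionic frame -/

namespace QuaternionicFrame

variable {V : Type*} [AddCommGroup V] [Module ℝ V] [TopologicalSpace V]
  [IsTopologicalAddGroup V] [ContinuousSMul ℝ V]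
  {n : ℕ} {g : V →L[ℝ] V →L[ℝ] ℝ} {H : Submodule ℝ V} {Q : Submodule ℝ (V →L[ℝ] V)}
  (b : QuaternionicFrame n g H Q)

/-- The coordinates with respect to a frame, extended by zero to the orthogonal complement. -/
def coord : V →ₗ[ℝ] (Fin (4 * n) → ℝ) := LinearMap.pi fun i => (g (b.vec i)).toLinearMap

theorem coord_apply (v : V) (i : Fin (4 * n)) : b.coord v i = g (b.vec i) v := rfl

theorem vec_eq (i : Fin (4 * n)) : b.vec i = b.e (frameIndex n i) := rfl

theorem inner_vec (i j : Fin (4 * n)) : g (b.vec i) (b.vec j) = if i = j then 1 else 0 := by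
  rw [vec_eq, vec_eq, b.orthonormal]
  simp only [EmbeddingLike.apply_eq_iff_eq]

theorem vec_mem (i : Fin (4 * n)) : b.vec i ∈ H := b.e_mem _

theorem coord_comp_vec : b.coord ∘ b.vec = stdVec (4 * n) := by
  funext i j
  rw [Function.comp_apply, coord_apply, inner_vec, stdVec, Pi.single_apply]

theorem star_compLinearMap_coord {k l : ℕ} (h : k + l = 4 * n)
    (a : (Fin (4 * n) → ℝ) [⋀^Fin k]→ₗ[ℝ] ℝ) :
    b.star h (a.compLinearMap b.coord) =
      (hodgeStar (stdVec (4 * n)) Matrix.detRowAlternating h a).compLinearMap b.coord := by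
  have := hodgeStar_compLinearMap b.vec Matrix.detRowAlternating h a b.coord
  rw [coord_comp_vec] at this
  exact this

theorem contraction_compLinearMap_coord {r j m : ℕ} (h : r + j = m)
    (η : (Fin (4 * n) → ℝ) [⋀^Fin r]→ₗ[ℝ] ℝ) (a : (Fin (4 * n) → ℝ) [⋀^Fin m]→ₗ[ℝ] ℝ) :
    contraction h b.vec (η.compLinearMap b.coord) (a.compLinearMap b.coord) =
      (contraction h (stdVec (4 * n)) η a).compLinearMap b.coord := by
  rw [contraction_compLinearMap, coord_comp_vec]

/-- This is left multiplication by `i` on `1, i, j, k`: the first list holds the signs, the second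
the positions. The table is the same for all frames, as are those of `J` and `K`. -/
theorem I_e (c : Fin n × Fin 4) : b.I (b.e c) =
    (![1, -1, 1, -1] : Fin 4 → ℝ) c.2 • b.e (c.1, (![1, 0, 3, 2] : Fin 4 → Fin 4) c.2) := by
  obtain ⟨a, c⟩ := c
  have h := b.hypercomplex
  have h0 := b.e_mem (a, 0)
  fin_cases c <;> simp [b.e_one, b.e_two, b.e_three, h.I_I _ h0, h.I_J _ h0, h.I_K h0]

theorem J_e (c : Fin n × Fin 4) : b.J (b.e c) =
    (![1, -1, -1, 1] : Fin 4 → ℝ) c.2 • b.e (c.1, (![2, 3, 0, 1] : Fin 4 → Fin 4) c.2) := by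
  obtain ⟨a, c⟩ := c
  have h := b.hypercomplex
  have h0 := b.e_mem (a, 0)
  fin_cases c <;> simp [b.e_one, b.e_two, b.e_three, h.J_J _ h0, h.J_K _ h0, h.J_I h0]

theorem K_e (c : Fin n × Fin 4) : b.K (b.e c) =
    (![1, 1, -1, -1] : Fin 4 → ℝ) c.2 • b.e (c.1, (![3, 2, 1, 0] : Fin 4 → Fin 4) c.2) := by
  obtain ⟨a, c⟩ := c
  have h := b.hypercomplex
  have h0 := b.e_mem (a, 0)
  fin_cases c <;> simp [b.e_one, b.e_two, b.e_three, h.K_K _ h0, h.K_I _ h0, h.K_J h0]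

end QuaternionicFrame

/-- The subspaces `H` and `P` are orthogonal complements, and `Q` consists of endomorphisms of `H`,
extended by zero to `P`. -/
structure IsTransverse {V : Type*} [AddCommGroup V] [Module ℝ V] [TopologicalSpace V]
    [IsTopologicalAddGroup V] [ContinuousSMul ℝ V] (g : V →L[ℝ] V →L[ℝ] ℝ) (H P : Submodule ℝ V)
    (Q : Submodule ℝ (V →L[ℝ] V)) : Prop where
  orthogonal : ∀ u ∈ H, ∀ v ∈ P, g u v = 0
  complement : ∀ v, ∃ u ∈ H, v - u ∈ P
  map_eq_zero : ∀ A ∈ Q, ∀ v ∈ P, A v = 0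
  map_mem : ∀ A ∈ Q, ∀ v, A v ∈ H

/-! ### Horizontal forms and `Ω` in frame coordinates -/

namespace QuaternionicFrame

variable {V : Type*} [AddCommGroup V] [Module ℝ V] [TopologicalSpace V]
  [IsTopologicalAddGroup V] [ContinuousSMul ℝ V]
  {n : ℕ} {g : V →L[ℝ] V →L[ℝ] ℝ} {H P : Submodule ℝ V} {Q : Submodule ℝ (V →L[ℝ] V)}
  (b : QuaternionicFrame n g H Q)

theorem sum_coord_of_mem {v : V} (hv : v ∈ H) : ∑ i, b.coord v i • b.vec i = v := by
  have hs : Submodule.span ℝ (Set.range b.vec) = H := by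
    refine Eq.trans (congrArg _ ?_) b.span_eq
    exact (frameIndex n).surjective.range_comp b.e
  rw [← hs] at hv
  induction hv using Submodule.span_induction with
  | mem x hx =>
    obtain ⟨j, rfl⟩ := hx
    simp [coord_apply, inner_vec]
  | zero => simp
  | add x y _ _ hx hy =>
    simp only [map_add, Pi.add_apply, add_smul, Finset.sum_add_distrib, hx, hy]
  | smul c x _ hx =>
    simp only [map_smul, Pi.smul_apply, smul_eq_mul, mul_smul, ← Finset.smul_sum, hx]

theorem sub_sum_coord_mem (h : IsTransverse g H P Q) (v : V) : v - ∑ i, b.coord v i • b.vec i ∈ P := by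
  obtain ⟨u, hu, huv⟩ := h.complement v
  have : b.coord v = b.coord u := by
    funext i
    rw [coord_apply, coord_apply, ← sub_eq_zero, ← map_sub, h.orthogonal _ (b.vec_mem i) _ huv]
  rwa [this, b.sum_coord_of_mem hu]

/-- Every vector differs from its projection `∑ xᵢ eᵢ` by an element of `P`, so the form can be
recovered from its pullback to `ℝ⁴ⁿ` along the frame. -/
theorem exists_eq_compLinearMap_coord (h : IsTransverse g H P Q) {k : ℕ}
    {α : V [⋀^Fin k]→ₗ[ℝ] ℝ} (hα : ∀ v : Fin k → V, (∃ j, v j ∈ P) → α v = 0) :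
    ∃ a : (Fin (4 * n) → ℝ) [⋀^Fin k]→ₗ[ℝ] ℝ, α = a.compLinearMap b.coord := by
  refine ⟨α.compLinearMap (Fintype.linearCombination ℝ b.vec), ?_⟩
  ext v
  refine map_eq_of_sub_mem hα fun j => ?_
  exact b.sub_sum_coord_mem h (v j)

theorem inner_map_eq (h : IsTransverse g H P Q) {A : V →L[ℝ] V} (hA : A ∈ Q)
    (u v : V) : g (A u) v =
    ∑ c, ∑ d, b.coord u c * b.coord v d * g (A (b.vec c)) (b.vec d) := by
  have h1 : A u = A (∑ c, b.coord u c • b.vec c) := by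
    rw [← sub_eq_zero, ← map_sub]
    exact h.map_eq_zero A hA _ (b.sub_sum_coord_mem h u)
  have h2 : g (A u) v = g (A u) (∑ d, b.coord v d • b.vec d) := by
    rw [← sub_eq_zero, ← map_sub]
    exact h.orthogonal _ (h.map_mem A hA u) _ (b.sub_sum_coord_mem h v)
  rw [h2, h1]
  simp only [map_sum, map_smul, _root_.sum_apply, _root_.smul_apply, smul_eq_mul, Finset.mul_sum]
  rw [Finset.sum_comm]
  exact Finset.sum_congr rfl fun c _ => Finset.sum_congr rfl fun d _ => by ring

theorem fundamentalForm_eq_matrixForm (h : IsTransverse g H P Q) {A : V →L[ℝ] V}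
    (hA : A ∈ Q) {s : Fin 4 → ℝ}
    {π : Fin 4 → Fin 4} (hAe : ∀ c, A (b.e c) = s c.2 • b.e (c.1, π c.2)) :
    fundamentalForm g A = (matrixForm (unitMatrix n s π)).compLinearMap b.coord := by
  have hB : ∀ c d, g (A (b.vec c)) (b.vec d) = unitMatrix n s π c d := by
    intro c d
    rw [vec_eq, vec_eq, hAe, map_smul, _root_.smul_apply, smul_eq_mul, b.orthonormal]
    rfl
  ext v
  rw [AlternatingMap.compLinearMap_apply, matrixForm_apply, fundamentalForm_apply_eq,
    b.inner_map_eq h hA, b.inner_map_eq h hA]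
  simp only [hB]

/-- Neither the point nor the frame enters `modelForm n`. This is what allows one polynomial to be
used over the whole manifold. -/
theorem krainesForm_eq (h : IsTransverse g H P Q) :
    b.krainesForm = (modelForm n).compLinearMap b.coord := by
  rw [krainesForm, b.fundamentalForm_eq_matrixForm h b.I_mem b.I_e,
    b.fundamentalForm_eq_matrixForm h b.J_mem b.J_e,
    b.fundamentalForm_eq_matrixForm h b.K_mem b.K_e, wedge_compLinearMap, wedge_compLinearMap,
    wedge_compLinearMap]
  rfl

end QuaternionicFrame

/-! ### Smooth forms on Euclidean space -/

section Euclidean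

variable {q r k : ℕ}

/-- The standard basis of Euclidean space. -/
abbrev euclBasis (q : ℕ) : Module.Basis (Fin q) ℝ (EuclideanSpace ℝ (Fin q)) :=
  (EuclideanSpace.basisFun (Fin q) ℝ).toBasis

theorem toContinuous_apply (α : EuclideanSpace ℝ (Fin q) [⋀^Fin k]→ₗ[ℝ] ℝ)
    (v : Fin k → EuclideanSpace ℝ (Fin q)) : toContinuous α v = α v := rfl

theorem alternating_eq_sum_basis (α : EuclideanSpace ℝ (Fin q) [⋀^Fin k]→L[ℝ] ℝ)
    (v : Fin k → EuclideanSpace ℝ (Fin q)) :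
    α v = ∑ s : Fin k → Fin q, (∏ i, v i (s i)) * α (euclBasis q ∘ s) := by
  have := map_sum_smul_alternating α.toAlternatingMap (euclBasis q) (fun i c => v i c)
  refine Eq.trans ?_ this
  change α v = α _
  congr 1
  funext i
  exact ((euclBasis q).sum_repr (v i)).symm

/-- Finitely many evaluations on basis vectors embed the space of forms in a space `ℝˢ`, and a
linear left inverse of this embedding is continuous. -/
theorem contDiffAt_alternating_iff {E : Type*} [NormedAddCommGroup E] [NormedSpace ℝ E]
    {f : E → EuclideanSpace ℝ (Fin q) [⋀^Fin k]→L[ℝ] ℝ} {y : E} :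
    ContDiffAt ℝ ∞ f y ↔ ∀ v, ContDiffAt ℝ ∞ (fun z => f z v) y := by
  constructor
  · intro h v
    exact (ContinuousAlternatingMap.apply ℝ (EuclideanSpace ℝ (Fin q)) ℝ v).contDiff.contDiffAt.comp
      y h
  · intro h
    let T : (EuclideanSpace ℝ (Fin q) [⋀^Fin k]→L[ℝ] ℝ) →ₗ[ℝ] ((Fin k → Fin q) → ℝ) :=
      { toFun := fun a s => a (euclBasis q ∘ s)
        map_add' := fun _ _ => rfl
        map_smul' := fun _ _ => rfl }
    have hT : LinearMap.ker T = ⊥ := by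
      rw [LinearMap.ker_eq_bot]
      intro a b hab
      ext v
      rw [alternating_eq_sum_basis a, alternating_eq_sum_basis b]
      exact Finset.sum_congr rfl fun s _ => congrArg _ (congrFun hab s)
    obtain ⟨S, hS⟩ := T.exists_leftInverse_of_injective hT
    have hf : f = fun z => S.toContinuousLinearMap (T (f z)) :=
      funext fun z => (LinearMap.congr_fun hS (f z)).symm
    rw [hf]
    refine S.toContinuousLinearMap.contDiff.contDiffAt.comp y ?_
    exact contDiffAt_pi.2 fun s => h _

theorem ContDiffAt.alternating_apply {E : Type*} [NormedAddCommGroup E] [NormedSpace ℝ E]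
    {f : E → EuclideanSpace ℝ (Fin q) [⋀^Fin k]→L[ℝ] ℝ} {y : E} (hf : ContDiffAt ℝ ∞ f y)
    {v : E → Fin k → EuclideanSpace ℝ (Fin q)} (hv : ∀ i, ContDiffAt ℝ ∞ (fun z => v z i) y) :
    ContDiffAt ℝ ∞ (fun z => f z (v z)) y := by
  simp_rw [alternating_eq_sum_basis _ (v _)]
  refine ContDiffAt.sum fun s _ => ContDiffAt.mul (contDiffAt_prod fun i _ => ?_)
    (contDiffAt_alternating_iff.1 hf _)
  exact ((EuclideanSpace.proj (s i) : EuclideanSpace ℝ (Fin q) →L[ℝ] ℝ).contDiff.contDiffAt).comp y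
    (hv i)

theorem ContDiffAt.pullback {a : EuclideanSpace ℝ (Fin q) →
      EuclideanSpace ℝ (Fin q) [⋀^Fin k]→L[ℝ] ℝ}
    {f : EuclideanSpace ℝ (Fin r) → EuclideanSpace ℝ (Fin q)} {y : EuclideanSpace ℝ (Fin r)}
    (ha : ContDiffAt ℝ ∞ a (f y)) (hf : ContDiffAt ℝ ∞ f y) :
    ContDiffAt ℝ ∞ (fun z => (a (f z)).compContinuousLinearMap (fderiv ℝ f z)) y := by
  refine contDiffAt_alternating_iff.2 fun v => ?_
  refine ContDiffAt.alternating_apply (ha.comp y hf) fun i => ?_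
  exact (hf.fderiv_right (m := ∞) (by simp)).clm_apply contDiffAt_const

theorem extDeriv_pullback_of_contDiffAt {a : EuclideanSpace ℝ (Fin q) →
      EuclideanSpace ℝ (Fin q) [⋀^Fin k]→L[ℝ] ℝ}
    {f : EuclideanSpace ℝ (Fin r) → EuclideanSpace ℝ (Fin q)} {y : EuclideanSpace ℝ (Fin r)}
    (ha : ContDiffAt ℝ ∞ a (f y)) (hf : ContDiffAt ℝ ∞ f y) :
    extDeriv (fun z => (a (f z)).compContinuousLinearMap (fderiv ℝ f z)) y =
      (extDeriv a (f y)).compContinuousLinearMap (fderiv ℝ f y) :=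
  extDeriv_pullback (ha.differentiableAt (by simp)) hf
    (by rw [minSmoothness_of_isRCLikeNormedField]; exact WithTop.coe_le_coe.2 le_top)

end Euclidean

/-! ### Pullback of forms and of their exterior derivatives -/

section Manifold

variable {m k r : ℕ} {M : Type*} [TopologicalSpace M]
  [ChartedSpace (EuclideanSpace ℝ (Fin m)) M]

/-- The pullback of a form by a map from a Euclidean space. -/
def pullForm (α : FormField m M k) (c : EuclideanSpace ℝ (Fin r) → M)
    (y : EuclideanSpace ℝ (Fin r)) : EuclideanSpace ℝ (Fin r) [⋀^Fin k]→L[ℝ] ℝ :=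
  toContinuous ((α (c y)).compLinearMap
    (mfderiv 𝓘(ℝ, EuclideanSpace ℝ (Fin r)) (𝓡 m) c y).toLinearMap)

theorem pullForm_apply (α : FormField m M k) (c : EuclideanSpace ℝ (Fin r) → M)
    (y : EuclideanSpace ℝ (Fin r)) (v : Fin k → EuclideanSpace ℝ (Fin r)) :
    pullForm α c y v = α (c y) (fun j => mfderiv 𝓘(ℝ, EuclideanSpace ℝ (Fin r)) (𝓡 m) c y (v j)) :=
  rfl

theorem extDer_apply (α : FormField m M k) (x : M) (v : Fin (k + 1) → TangentSpace (𝓡 m) x) :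
    extDer α x v = extDeriv (inChart α x) (extChartAt (𝓡 m) x x) (fun j =>
      mfderiv (𝓡 m) 𝓘(ℝ, EuclideanSpace ℝ (Fin m)) (extChartAt (𝓡 m) x) x (v j)) := rfl

theorem isSmooth_iff {α : FormField m M k} : IsSmooth α ↔
    ∀ x₀ : M, ∀ y ∈ (extChartAt (𝓡 m) x₀).target, ContDiffAt ℝ ∞ (inChart α x₀) y :=
  forall_congr' fun x₀ => ⟨fun h _ hy => h.contDiffAt ((isOpen_extChartAt_target x₀).mem_nhds hy),
    fun h y hy => (h y hy).contDiffWithinAt⟩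

theorem contDiffAt_extChartAt_comp {c : EuclideanSpace ℝ (Fin r) → M}
    {y : EuclideanSpace ℝ (Fin r)} (hc : ContMDiffAt 𝓘(ℝ, EuclideanSpace ℝ (Fin r)) (𝓡 m) ∞ c y) :
    ContDiffAt ℝ ∞ (extChartAt (𝓡 m) (c y) ∘ c) y :=
  contMDiffAt_iff_contDiffAt.1 (ContMDiffAt.comp y contMDiffAt_extChartAt hc)

variable [IsManifold (𝓡 m) ∞ M]

theorem contMDiffAt_extChartAt_symm {x₀ : M} {y : EuclideanSpace ℝ (Fin m)}
    (hy : y ∈ (extChartAt (𝓡 m) x₀).target) :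
    ContMDiffAt 𝓘(ℝ, EuclideanSpace ℝ (Fin m)) (𝓡 m) ∞ (extChartAt (𝓡 m) x₀).symm y :=
  (contMDiffOn_extChartAt_symm x₀).contMDiffAt ((isOpen_extChartAt_target x₀).mem_nhds hy)

theorem eventually_mdifferentiableAt {E₁ H₁ E₂ H₂ M₁ M₂ : Type*} [NormedAddCommGroup E₁]
    [NormedSpace ℝ E₁] [TopologicalSpace H₁] [NormedAddCommGroup E₂] [NormedSpace ℝ E₂]
    [TopologicalSpace H₂] {I₁ : ModelWithCorners ℝ E₁ H₁} {I₂ : ModelWithCorners ℝ E₂ H₂}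
    [TopologicalSpace M₁] [ChartedSpace H₁ M₁] [TopologicalSpace M₂] [ChartedSpace H₂ M₂]
    [IsManifold I₁ ∞ M₁] [IsManifold I₂ ∞ M₂] {f : M₁ → M₂} {x : M₁}
    (h : ContMDiffAt I₁ I₂ ∞ f x) : ∀ᶠ z in 𝓝 x, MDifferentiableAt I₁ I₂ f z := by
  have h1 : ContMDiffAt I₁ I₂ 1 f x := h.of_le (by simp)
  have : IsManifold I₁ 1 M₁ := IsManifold.of_le (n := ∞) (by simp)
  have : IsManifold I₂ 1 M₂ := IsManifold.of_le (n := ∞) (by simp)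
  filter_upwards [(contMDiffAt_iff_contMDiffAt_nhds (by simp)).1 h1] with z hz using hz.mdifferentiableAt (by simp)

/-- In a chart, a pulled back form is a pulled back form between Euclidean spaces. -/
theorem pullForm_eventuallyEq (α : FormField m M k) {c : EuclideanSpace ℝ (Fin r) → M}
    {y : EuclideanSpace ℝ (Fin r)} (hc : ContMDiffAt 𝓘(ℝ, EuclideanSpace ℝ (Fin r)) (𝓡 m) ∞ c y) :
    pullForm α c =ᶠ[𝓝 y] fun z =>
      (inChart α (c y) (extChartAt (𝓡 m) (c y) (c z))).compContinuousLinearMap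
        (fderiv ℝ (extChartAt (𝓡 m) (c y) ∘ c) z) := by
  have hs : ∀ᶠ z in 𝓝 y, c z ∈ (extChartAt (𝓡 m) (c y)).source :=
    hc.continuousAt (extChartAt_source_mem_nhds (I := 𝓡 m) (c y))
  filter_upwards [eventually_mdifferentiableAt hc, hs.eventually_nhds] with z hz hzs
  have hzs' := hzs.self_of_nhds
  have hcomp : c =ᶠ[𝓝 z] (extChartAt (𝓡 m) (c y)).symm ∘ (extChartAt (𝓡 m) (c y) ∘ c) := by
    filter_upwards [hzs] with w hw using ((extChartAt (𝓡 m) (c y)).left_inv hw).symm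
  have hψ : MDifferentiableAt (𝓡 m) 𝓘(ℝ, EuclideanSpace ℝ (Fin m)) (extChartAt (𝓡 m) (c y))
      (c z) := mdifferentiableAt_extChartAt (by simpa using hzs')
  have hh := hψ.comp z hz
  have hψs : MDifferentiableAt 𝓘(ℝ, EuclideanSpace ℝ (Fin m)) (𝓡 m)
      (extChartAt (𝓡 m) (c y)).symm ((extChartAt (𝓡 m) (c y) ∘ c) z) :=
    (contMDiffAt_extChartAt_symm ((extChartAt (𝓡 m) (c y)).map_source hzs')).mdifferentiableAt
      (by simp)
  ext v
  have hd : mfderiv 𝓘(ℝ, EuclideanSpace ℝ (Fin r)) (𝓡 m) c z = _ :=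
    hcomp.mfderiv_eq.trans (mfderiv_comp z hψs hh)
  rw [mfderiv_eq_fderiv] at hd
  have hpt : (extChartAt (𝓡 m) (c y)).symm (extChartAt (𝓡 m) (c y) (c z)) = c z :=
    (extChartAt (𝓡 m) (c y)).left_inv hzs'
  rw [pullForm_apply, hd]
  change _ = α ((extChartAt (𝓡 m) (c y)).symm (extChartAt (𝓡 m) (c y) (c z))) _
  rw [hpt]
  rfl

theorem IsSmooth.contDiffAt_pullForm {α : FormField m M k} (hα : IsSmooth α)
    {c : EuclideanSpace ℝ (Fin r) → M} {y : EuclideanSpace ℝ (Fin r)}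
    (hc : ContMDiffAt 𝓘(ℝ, EuclideanSpace ℝ (Fin r)) (𝓡 m) ∞ c y) :
    ContDiffAt ℝ ∞ (pullForm α c) y := by
  refine ContDiffAt.congr_of_eventuallyEq ?_ (pullForm_eventuallyEq α hc)
  exact ContDiffAt.pullback (a := inChart α (c y)) (f := extChartAt (𝓡 m) (c y) ∘ c)
    (isSmooth_iff.1 hα _ _ (mem_extChartAt_target (c y))) (contDiffAt_extChartAt_comp hc)

/-- Naturality of `d` reduces to the Euclidean case in the chart at `c y`, which is the very chart
in which `extDer` is computed at that point. -/
theorem IsSmooth.extDeriv_pullForm {α : FormField m M k} (hα : IsSmooth α)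
    {c : EuclideanSpace ℝ (Fin r) → M} {y : EuclideanSpace ℝ (Fin r)}
    (hc : ContMDiffAt 𝓘(ℝ, EuclideanSpace ℝ (Fin r)) (𝓡 m) ∞ c y) :
    extDeriv (pullForm α c) y = pullForm (extDer α) c y := by
  rw [(pullForm_eventuallyEq α hc).extDeriv_eq]
  refine (extDeriv_pullback_of_contDiffAt (a := inChart α (c y))
    (f := extChartAt (𝓡 m) (c y) ∘ c)
    (isSmooth_iff.1 hα _ _ (mem_extChartAt_target (c y))) (contDiffAt_extChartAt_comp hc)).trans ?_
  have hψ : MDifferentiableAt (𝓡 m) 𝓘(ℝ, EuclideanSpace ℝ (Fin m)) (extChartAt (𝓡 m) (c y))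
      (c y) := mdifferentiableAt_extChartAt (mem_chart_source _ _)
  have hd := mfderiv_comp y hψ (hc.mdifferentiableAt (by simp))
  rw [mfderiv_eq_fderiv] at hd
  rw [hd]
  rfl

end Manifold

/-! ### Local form of the submersions; local pullbacks are basic -/

namespace FoliationCocycle

variable {n p : ℕ} {ι M N : Type*}
  [TopologicalSpace M] [ChartedSpace (EuclideanSpace ℝ (Fin (4 * n + p))) M]
  [TopologicalSpace N] [ChartedSpace (EuclideanSpace ℝ (Fin (4 * n))) N]
  (F : FoliationCocycle n p ι M N) {i : ι} {x₀ : M}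

/-- The normal form of a submersion: in suitable charts it is a linear projection `π`. The linear
right inverse `s` will later provide local sections. -/
theorem exists_adapted_chart (hx : x₀ ∈ F.U i) :
    ∃ (A : OpenPartialHomeomorph M (EuclideanSpace ℝ (Fin (4 * n + p))))
      (B : OpenPartialHomeomorph N (EuclideanSpace ℝ (Fin (4 * n))))
      (π : EuclideanSpace ℝ (Fin (4 * n + p)) →L[ℝ] EuclideanSpace ℝ (Fin (4 * n)))
      (s : EuclideanSpace ℝ (Fin (4 * n)) →L[ℝ] EuclideanSpace ℝ (Fin (4 * n + p))),
      A ∈ IsManifold.maximalAtlas (𝓡 (4 * n + p)) ∞ M ∧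
      B ∈ IsManifold.maximalAtlas (𝓡 (4 * n)) ∞ N ∧ x₀ ∈ A.source ∧
      (∀ z ∈ A.source, F.f i z ∈ B.source) ∧ (∀ w, π (s w) = w) ∧
      ∀ z ∈ A.source, B (F.f i z) = π (A z) := by
  have h := F.submersion i x₀ hx
  refine ⟨h.domChart, h.codChart, (ContinuousLinearMap.fst ℝ _ h.complement).comp
    (h.equiv : EuclideanSpace ℝ (Fin (4 * n + p)) →L[ℝ] _),
    (h.equiv.symm : _ →L[ℝ] EuclideanSpace ℝ (Fin (4 * n + p))).comp
      (ContinuousLinearMap.inl ℝ _ h.complement), h.domChart_mem_maximalAtlas,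
    h.codChart_mem_maximalAtlas, h.mem_domChart_source, h.source_subset_preimage_source,
    fun w => by simp, fun z hz => ?_⟩
  have hz' : h.domChart z ∈ (h.domChart.extend (𝓡 (4 * n + p))).target := by
    have := (h.domChart.extend (𝓡 (4 * n + p))).map_source
      (by rwa [OpenPartialHomeomorph.extend_source])
    exact this
  have := h.writtenInCharts hz'
  simp only [Function.comp_apply] at this
  change h.codChart (F.f i (h.domChart.symm (h.domChart z))) = _ at this
  rw [h.domChart.left_inv hz] at this
  exact this

theorem contMDiffAt_f (hx : x₀ ∈ F.U i) :
    ContMDiffAt (𝓡 (4 * n + p)) (𝓡 (4 * n)) ∞ (F.f i) x₀ :=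
  (F.submersion i x₀ hx).contMDiffAt

theorem mdifferentiableAt_f (hx : x₀ ∈ F.U i) :
    MDifferentiableAt (𝓡 (4 * n + p)) (𝓡 (4 * n)) (F.f i) x₀ :=
  (F.contMDiffAt_f hx).mdifferentiableAt (by simp)

theorem df_eq_comp {j : ι} (hi : x₀ ∈ F.U i) (hj : x₀ ∈ F.U j)
    (v : TangentSpace (𝓡 (4 * n + p)) x₀) :
    (F.df i x₀ v : EuclideanSpace ℝ (Fin (4 * n))) =
      mfderiv (𝓡 (4 * n)) (𝓡 (4 * n)) (F.γ i j) (F.f j x₀) (F.df j x₀ v) := by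
  have hγ : MDifferentiableAt (𝓡 (4 * n)) (𝓡 (4 * n)) (F.γ i j) (F.f j x₀) :=
    (F.localDiffeo i j ⟨_, x₀, ⟨hi, hj⟩, rfl⟩).mdifferentiableAt (by simp)
  have he : F.f i =ᶠ[𝓝 x₀] F.γ i j ∘ F.f j := by
    filter_upwards [((F.isOpen_U i).inter (F.isOpen_U j)).mem_nhds ⟨hi, hj⟩] with z hz
      using F.compat i j z hz
  have hd : mfderiv (𝓡 (4 * n + p)) (𝓡 (4 * n)) (F.f i) x₀ = _ :=
    he.mfderiv_eq.trans (mfderiv_comp x₀ hγ (F.mdifferentiableAt_f hj))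
  exact congrArg (fun T : EuclideanSpace ℝ (Fin (4 * n + p)) →L[ℝ]
    EuclideanSpace ℝ (Fin (4 * n)) => T v) hd

/-- By the cocycle relation `df_j` is `dγ_ji ∘ df_i`, so `ker df_i ⊆ ker df_j` for all admissible
`j`, and the intersection is the kernel for any one index. -/
theorem mem_leafTangent_iff (hx : x₀ ∈ F.U i) {v : TangentSpace (𝓡 (4 * n + p)) x₀} :
    v ∈ F.leafTangent x₀ ↔ F.df i x₀ v = 0 := by
  constructor
  · intro h
    rw [leafTangent, Submodule.mem_iInf] at h
    have := h i
    rw [Submodule.mem_iInf] at this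
    exact this hx
  · intro h
    rw [leafTangent, Submodule.mem_iInf]
    intro j
    rw [Submodule.mem_iInf]
    intro hj
    have := F.df_eq_comp hj hx v
    rw [h] at this
    exact this.trans (map_zero _)

/-- In adapted charts `π = dB ∘ df ∘ dA⁻¹` is surjective. Hence so is `dB`, which is then injective
by equality of dimensions and can be cancelled. -/
theorem df_surjective (hx : x₀ ∈ F.U i) : Function.Surjective (F.df i x₀) := by
  obtain ⟨A, B, π, s, hA, hB, hxA, hAB, hπ, hfπ⟩ := F.exists_adapted_chart hx
  have hBd : MDifferentiableAt (𝓡 (4 * n)) 𝓘(ℝ, EuclideanSpace ℝ (Fin (4 * n))) B (F.f i x₀) :=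
    ((contMDiffOn_of_mem_maximalAtlas hB).contMDiffAt
      (B.open_source.mem_nhds (hAB _ hxA))).mdifferentiableAt (by simp)
  have hAd : MDifferentiableAt 𝓘(ℝ, EuclideanSpace ℝ (Fin (4 * n + p))) (𝓡 (4 * n + p)) A.symm
      (A x₀) :=
    ((contMDiffOn_symm_of_mem_maximalAtlas hA).contMDiffAt
      (A.open_target.mem_nhds (A.map_source hxA))).mdifferentiableAt (by simp)
  have hfd : MDifferentiableAt (𝓡 (4 * n + p)) (𝓡 (4 * n)) (F.f i) (A.symm (A x₀)) := by
    rw [A.left_inv hxA]; exact F.mdifferentiableAt_f hx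
  have hBd' : MDifferentiableAt (𝓡 (4 * n)) 𝓘(ℝ, EuclideanSpace ℝ (Fin (4 * n))) B
      ((F.f i ∘ A.symm) (A x₀)) := by
    rw [Function.comp_apply, A.left_inv hxA]; exact hBd
  have he : B ∘ (F.f i ∘ A.symm) =ᶠ[𝓝 (A x₀)] π := by
    filter_upwards [A.open_target.mem_nhds (A.map_source hxA)] with y hy
    rw [Function.comp_apply, Function.comp_apply, hfπ _ (A.map_target hy), A.right_inv hy]
  have h1 := mfderiv_comp (A x₀) hBd' (hfd.comp _ hAd)
  rw [mfderiv_comp (A x₀) hfd hAd, he.mfderiv_eq] at h1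
  rw [A.left_inv hxA] at h1
  rw [mfderiv_eq_fderiv, π.fderiv] at h1
  let D : EuclideanSpace ℝ (Fin (4 * n)) →L[ℝ] EuclideanSpace ℝ (Fin (4 * n)) :=
    mfderiv (𝓡 (4 * n)) 𝓘(ℝ, EuclideanSpace ℝ (Fin (4 * n))) B (F.f i x₀)
  let C : EuclideanSpace ℝ (Fin (4 * n + p)) →L[ℝ] EuclideanSpace ℝ (Fin (4 * n + p)) :=
    mfderiv 𝓘(ℝ, EuclideanSpace ℝ (Fin (4 * n + p))) (𝓡 (4 * n + p)) A.symm (A x₀)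
  let T : EuclideanSpace ℝ (Fin (4 * n + p)) →L[ℝ] EuclideanSpace ℝ (Fin (4 * n)) := F.df i x₀
  have h2 : π = D.comp (T.comp C) := by
    rw [h1]
    simp only [D, T, C, df, Function.comp_apply]
    congr 1
    rw [A.left_inv hxA]
  have hD : Function.Surjective D := by
    intro w
    refine ⟨T (C (s w)), ?_⟩
    have := congrArg (fun L : EuclideanSpace ℝ (Fin (4 * n + p)) →L[ℝ]
      EuclideanSpace ℝ (Fin (4 * n)) => L (s w)) h2
    exact this.symm.trans (hπ w)
  have hDi : Function.Injective D := (LinearMap.injective_iff_surjective (f := D.toLinearMap)).2 hD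
  intro w
  refine ⟨C (s (D w)), hDi ?_⟩
  have := congrArg (fun L : EuclideanSpace ℝ (Fin (4 * n + p)) →L[ℝ]
      EuclideanSpace ℝ (Fin (4 * n)) => L (s (D w))) h2
  exact this.symm.trans (hπ _)

variable (i x₀) in
/-- The submersion `f_i` in the chart of `N` at `f_i(x₀)`. -/
def localProj : M → EuclideanSpace ℝ (Fin (4 * n)) := extChartAt (𝓡 (4 * n)) (F.f i x₀) ∘ F.f i

theorem eventually_mem_source (hx : x₀ ∈ F.U i) :
    ∀ᶠ z in 𝓝 x₀, z ∈ F.U i ∧ F.f i z ∈ (extChartAt (𝓡 (4 * n)) (F.f i x₀)).source := by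
  have h : ∀ᶠ z in 𝓝 x₀, z ∈ F.U i := (F.isOpen_U i).mem_nhds hx
  exact h.and
    ((F.contMDiffAt_f hx).continuousAt (extChartAt_source_mem_nhds (I := 𝓡 (4 * n)) (F.f i x₀)))

variable [IsManifold (𝓡 (4 * n)) ∞ N]

theorem mdifferentiableAt_localProj {z : M} (hz : z ∈ F.U i)
    (hs : F.f i z ∈ (extChartAt (𝓡 (4 * n)) (F.f i x₀)).source) :
    MDifferentiableAt (𝓡 (4 * n + p)) 𝓘(ℝ, EuclideanSpace ℝ (Fin (4 * n))) (F.localProj i x₀) z :=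
  (mdifferentiableAt_extChartAt (by simpa using hs)).comp z (F.mdifferentiableAt_f hz)

theorem contMDiffAt_localProj {z : M} (hz : z ∈ F.U i)
    (hs : F.f i z ∈ (extChartAt (𝓡 (4 * n)) (F.f i x₀)).source) :
    ContMDiffAt (𝓡 (4 * n + p)) 𝓘(ℝ, EuclideanSpace ℝ (Fin (4 * n))) ∞ (F.localProj i x₀) z :=
  ContMDiffAt.comp z (contMDiffAt_extChartAt' (by simpa using hs)) (F.contMDiffAt_f hz)

theorem mfderiv_localProj {z : M} (hz : z ∈ F.U i)
    (hs : F.f i z ∈ (extChartAt (𝓡 (4 * n)) (F.f i x₀)).source)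
    (v : TangentSpace (𝓡 (4 * n + p)) z) :
    mfderiv (𝓡 (4 * n + p)) 𝓘(ℝ, EuclideanSpace ℝ (Fin (4 * n))) (F.localProj i x₀) z v =
      mfderiv (𝓡 (4 * n)) 𝓘(ℝ, EuclideanSpace ℝ (Fin (4 * n)))
        (extChartAt (𝓡 (4 * n)) (F.f i x₀)) (F.f i z) (F.df i z v) :=
  congrArg (fun T : EuclideanSpace ℝ (Fin (4 * n + p)) →L[ℝ]
    EuclideanSpace ℝ (Fin (4 * n)) => T v) (mfderiv_comp z
      (mdifferentiableAt_extChartAt (by simpa using hs)) (F.mdifferentiableAt_f hz))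

variable (i x₀) in
/-- Near `x₀`, the form `α` is the pullback of a smooth form by the submersion `f_i`. -/
def IsPullbackAt {k : ℕ} (α : FormField (4 * n + p) M k) : Prop :=
  ∃ a : EuclideanSpace ℝ (Fin (4 * n)) → EuclideanSpace ℝ (Fin (4 * n)) [⋀^Fin k]→L[ℝ] ℝ,
    ContDiffAt ℝ ∞ a (F.localProj i x₀ x₀) ∧ ∀ᶠ z in 𝓝 x₀, ∀ v, α z v =
      a (F.localProj i x₀ z) (fun j => mfderiv (𝓡 (4 * n + p))
        𝓘(ℝ, EuclideanSpace ℝ (Fin (4 * n))) (F.localProj i x₀) z (v j))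

variable [IsManifold (𝓡 (4 * n + p)) ∞ M]

/-- Both `α` and, by naturality, `dα` are locally pulled back by the submersion, whose differential
kills the leaf directions. -/
theorem isBasic_of_isPullbackAt {k : ℕ} {α : FormField (4 * n + p) M k}
    (h : ∀ x, ∃ i, x ∈ F.U i ∧ F.IsPullbackAt i x α) : F.IsBasic α := by
  -- The point `x` and the equation for it are kept separate because two cases are needed:
  -- smoothness at any point of any chart, and `d` at the centre of its own chart.
  have key : ∀ (x₀ : M) (y : EuclideanSpace ℝ (Fin (4 * n + p))),
      y ∈ (extChartAt (𝓡 (4 * n + p)) x₀).target → ∀ x,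
      (extChartAt (𝓡 (4 * n + p)) x₀).symm y = x → ∀ i, x ∈ F.U i →
      ∀ a : EuclideanSpace ℝ (Fin (4 * n)) → EuclideanSpace ℝ (Fin (4 * n)) [⋀^Fin k]→L[ℝ] ℝ,
      (∀ᶠ z in 𝓝 x, ∀ v, α z v =
      a (F.localProj i x z) (fun j => mfderiv (𝓡 (4 * n + p))
        𝓘(ℝ, EuclideanSpace ℝ (Fin (4 * n))) (F.localProj i x) z (v j))) →
      (inChart α x₀ =ᶠ[𝓝 y] fun w =>
        (a ((F.localProj i x ∘ (extChartAt (𝓡 (4 * n + p)) x₀).symm) w)).compContinuousLinearMap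
          (fderiv ℝ (F.localProj i x ∘ (extChartAt (𝓡 (4 * n + p)) x₀).symm) w)) ∧
      ContDiffAt ℝ ∞ (F.localProj i x ∘ (extChartAt (𝓡 (4 * n + p)) x₀).symm) y := by
    rintro x₀ y hy x rfl i hi a ha
    have hc := contMDiffAt_extChartAt_symm (m := 4 * n + p) hy
    refine ⟨?_, contMDiffAt_iff_contDiffAt.1 (ContMDiffAt.comp y
      (F.contMDiffAt_localProj hi (mem_extChartAt_source _)) hc)⟩
    filter_upwards [hc.continuousAt.eventually ha,
      hc.continuousAt.eventually (F.eventually_mem_source hi),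
      (isOpen_extChartAt_target x₀).mem_nhds hy] with w hw hw2 hwt
    have hd := mfderiv_comp w (F.mdifferentiableAt_localProj hw2.1 hw2.2)
      ((contMDiffAt_extChartAt_symm (m := 4 * n + p) hwt).mdifferentiableAt (by simp))
    rw [mfderiv_eq_fderiv] at hd
    ext v
    rw [hd]
    exact hw _
  refine ⟨isSmooth_iff.2 fun x₀ y hy => ?_, fun x v => ?_, fun x v => ?_⟩
  · obtain ⟨i, hi, a, ha, hα⟩ := h ((extChartAt (𝓡 (4 * n + p)) x₀).symm y)
    obtain ⟨h1, h2⟩ := key x₀ y hy _ rfl i hi a hα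
    exact (ContDiffAt.pullback ha h2).congr_of_eventuallyEq h1
  · rintro ⟨j, hj⟩
    obtain ⟨i, hi, a, ha, hα⟩ := h x
    rw [hα.self_of_nhds]
    refine ContinuousAlternatingMap.map_coord_zero _ j ?_
    rw [F.mfderiv_localProj hi (mem_extChartAt_source _), (F.mem_leafTangent_iff hi).1 hj, map_zero]
    rfl
  · rintro ⟨j, hj⟩
    obtain ⟨i, hi, a, ha, hα⟩ := h x
    have hx : (extChartAt (𝓡 (4 * n + p)) x).symm (extChartAt (𝓡 (4 * n + p)) x x) = x :=
      extChartAt_to_inv x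
    obtain ⟨h1, h2⟩ := key x _ (mem_extChartAt_target x) x hx i hi a hα
    rw [extDer_apply, h1.extDeriv_eq, extDeriv_pullback_of_contDiffAt (by
      rw [Function.comp_apply, hx]; exact ha) h2]
    refine ContinuousAlternatingMap.map_coord_zero (extDeriv a _)
      (m := fun j => fderiv ℝ (F.localProj i x ∘ (extChartAt (𝓡 (4 * n + p)) x).symm)
        (extChartAt (𝓡 (4 * n + p)) x x) (mfderiv (𝓡 (4 * n + p))
          𝓘(ℝ, EuclideanSpace ℝ (Fin (4 * n + p))) (extChartAt (𝓡 (4 * n + p)) x) x (v j))) j ?_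
    have hψ : MDifferentiableAt (𝓡 (4 * n + p)) 𝓘(ℝ, EuclideanSpace ℝ (Fin (4 * n + p)))
        (extChartAt (𝓡 (4 * n + p)) x) x := mdifferentiableAt_extChartAt (mem_chart_source _ _)
    have hd := mfderiv_comp (I' := 𝓘(ℝ, EuclideanSpace ℝ (Fin (4 * n + p))))
      (I'' := 𝓘(ℝ, EuclideanSpace ℝ (Fin (4 * n))))
      (g := F.localProj i x ∘ (extChartAt (𝓡 (4 * n + p)) x).symm) x
      (h2.differentiableAt (by simp)).mdifferentiableAt hψ
    have he : (F.localProj i x ∘ (extChartAt (𝓡 (4 * n + p)) x).symm) ∘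
        extChartAt (𝓡 (4 * n + p)) x =ᶠ[𝓝 x] F.localProj i x := by
      filter_upwards [extChartAt_source_mem_nhds (I := 𝓡 (4 * n + p)) x] with z hz
      simp only [Function.comp_apply, (extChartAt (𝓡 (4 * n + p)) x).left_inv hz]
    rw [he.mfderiv_eq, mfderiv_eq_fderiv] at hd
    have h3 := congrArg (fun T : EuclideanSpace ℝ (Fin (4 * n + p)) →L[ℝ]
      EuclideanSpace ℝ (Fin (4 * n)) => T (v j)) hd
    refine Eq.trans h3.symm ?_
    refine (F.mfderiv_localProj hi (mem_extChartAt_source _) (v j)).trans ?_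
    rw [(F.mem_leafTangent_iff hi).1 hj, map_zero]
    rfl

end FoliationCocycle

/-- A horizontal form with horizontal exterior derivative is constant along the fibres. -/
theorem eq_of_horizontal {m k : ℕ} {E : Type*} [AddCommGroup E] [Module ℝ E]
    {b : EuclideanSpace ℝ (Fin m) → EuclideanSpace ℝ (Fin m) [⋀^Fin k]→L[ℝ] ℝ}
    {W : Set (EuclideanSpace ℝ (Fin m))} (hW : IsOpen W) (hWc : Convex ℝ W)
    (hb : ∀ y ∈ W, DifferentiableAt ℝ b y) (π : EuclideanSpace ℝ (Fin m) →ₗ[ℝ] E)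
    (hh : ∀ y ∈ W, ∀ v : Fin k → EuclideanSpace ℝ (Fin m), (∃ j, π (v j) = 0) → b y v = 0)
    (hd : ∀ y ∈ W, ∀ v : Fin (k + 1) → EuclideanSpace ℝ (Fin m), (∃ j, π (v j) = 0) →
      extDeriv b y v = 0) {y y' : EuclideanSpace ℝ (Fin m)} (hy : y ∈ W) (hy' : y' ∈ W)
    (hyy' : π y = π y') : b y = b y' := by
  ext v
  -- Insert `(u, v)` in the formula for `extDeriv`: every term but the derivative of `b(v)` along
  -- `u` still has `u` among its arguments, and `b` vanishes on such arguments near `z`.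
  have hder : ∀ z ∈ W, ∀ u, π u = 0 → fderiv ℝ (fun w => b w v) z u = 0 := by
    intro z hz u hu
    have h1 := hd z hz (Fin.cons u v) ⟨0, by simpa using hu⟩
    rw [extDeriv_apply (hb z hz), Fin.sum_univ_succ, Finset.sum_eq_zero] at h1
    · simpa using h1
    · intro j _
      have : (fun w => b w (j.succ.removeNth (Fin.cons u v : Fin (k + 1) → _))) =ᶠ[𝓝 z]
          fun _ => 0 := by
        filter_upwards [hW.mem_nhds hz] with w hw
        have hk : 0 < k := by have := j.2; omega
        refine hh w hw _ ⟨⟨0, hk⟩, ?_⟩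
        have h0 : j.succ.succAbove ⟨0, hk⟩ = (0 : Fin (k + 1)) := by
          rw [Fin.succAbove_of_castSucc_lt]
          · rfl
          · exact Fin.lt_def.2 (by simp)
        rw [Fin.removeNth_apply, h0, Fin.cons_zero, hu]
      rw [this.fderiv_eq]
      simp
  have hseg : ∀ t ∈ Set.Icc (0 : ℝ) 1, y + t • (y' - y) ∈ W := by
    intro t ht
    have := hWc.add_smul_sub_mem hy hy' ht
    exact this
  have hderiv : ∀ t ∈ Set.Icc (0 : ℝ) 1,
      HasDerivAt (fun t : ℝ => b (y + t • (y' - y)) v) 0 t := by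
    intro t ht
    have hz := hseg t ht
    have h1 : HasFDerivAt (fun w => b w v) (fderiv ℝ (fun w => b w v) (y + t • (y' - y)))
        (y + t • (y' - y)) :=
      (((ContinuousAlternatingMap.apply ℝ (EuclideanSpace ℝ (Fin m)) ℝ v).differentiableAt).comp _
        (hb _ hz)).hasFDerivAt
    have h2 : HasDerivAt (fun t : ℝ => y + t • (y' - y)) (y' - y) t := by
      simpa using ((hasDerivAt_id t).smul_const (y' - y)).const_add y
    have h3 := h1.comp_hasDerivAt t h2
    rw [hder _ hz _ (by rw [map_sub, hyy', sub_self])] at h3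
    exact h3
  -- The segment from `y` to `y'` stays in the convex set and has direction in `ker π`.
  have := constant_of_has_deriv_right_zero (f := fun t : ℝ => b (y + t • (y' - y)) v)
    (fun t ht => (hderiv t ht).continuousAt.continuousWithinAt)
    (fun t ht => (hderiv t (Set.Ico_subset_Icc_self ht)).hasDerivWithinAt) 1
    (Set.right_mem_Icc.2 zero_le_one)
  simpa using this.symm

/-! ### Basic forms are local pullbacks -/

namespace FoliationCocycle

variable {n p : ℕ} {ι M N : Type*}
  [TopologicalSpace M] [ChartedSpace (EuclideanSpace ℝ (Fin (4 * n + p))) M]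
  [TopologicalSpace N] [ChartedSpace (EuclideanSpace ℝ (Fin (4 * n))) N]
  {F : FoliationCocycle n p ι M N} {i : ι} {x₀ : M}
  [IsManifold (𝓡 (4 * n + p)) ∞ M] [IsManifold (𝓡 (4 * n)) ∞ N]

/-- Pull `α` back by a local section of `f_i` and then by `f_i`. This moves the base point along its
plaque and changes vectors by leaf directions; a basic form notices neither. -/
theorem IsBasic.isPullbackAt {k : ℕ} {α : FormField (4 * n + p) M k} (hα : F.IsBasic α)
    (hx : x₀ ∈ F.U i) : F.IsPullbackAt i x₀ α := by
  obtain ⟨A, B, π, s, hA, hB, hxA, hAB, hπ, hfπ⟩ := F.exists_adapted_chart hx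
  set y₁ := A x₀ with hy₁
  have hy₁A : y₁ ∈ A.target := A.map_source hxA
  have hAs : ∀ y ∈ A.target, ContMDiffAt 𝓘(ℝ, EuclideanSpace ℝ (Fin (4 * n + p)))
      (𝓡 (4 * n + p)) ∞ A.symm y := fun y hy =>
    (contMDiffOn_symm_of_mem_maximalAtlas hA).contMDiffAt (A.open_target.mem_nhds hy)
  have hAd : ∀ z ∈ A.source, ContMDiffAt (𝓡 (4 * n + p))
      𝓘(ℝ, EuclideanSpace ℝ (Fin (4 * n + p))) ∞ A z := fun z hz =>
    (contMDiffOn_of_mem_maximalAtlas hA).contMDiffAt (A.open_source.mem_nhds hz)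
  have hBd : ∀ z ∈ B.source, ContMDiffAt (𝓡 (4 * n))
      𝓘(ℝ, EuclideanSpace ℝ (Fin (4 * n))) ∞ B z := fun z hz =>
    (contMDiffOn_of_mem_maximalAtlas hB).contMDiffAt (B.open_source.mem_nhds hz)
  have hBs : ∀ y ∈ B.target, ContMDiffAt 𝓘(ℝ, EuclideanSpace ℝ (Fin (4 * n)))
      (𝓡 (4 * n)) ∞ B.symm y := fun y hy =>
    (contMDiffOn_symm_of_mem_maximalAtlas hB).contMDiffAt (B.open_target.mem_nhds hy)
  -- vectors in the kernel of `π` are tangent to the leaves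
  have hker : ∀ᶠ y in 𝓝 y₁, ∀ v, π v = 0 →
      mfderiv 𝓘(ℝ, EuclideanSpace ℝ (Fin (4 * n + p))) (𝓡 (4 * n + p)) A.symm y v ∈
        F.leafTangent (A.symm y) := by
    have hU : ∀ᶠ y in 𝓝 y₁, A.symm y ∈ F.U i := by
      refine (hAs _ hy₁A).continuousAt.eventually ((F.isOpen_U i).mem_nhds ?_)
      rw [hy₁, A.left_inv hxA]; exact hx
    filter_upwards [hU, A.open_target.mem_nhds hy₁A] with y hyU hyA v hv
    rw [F.mem_leafTangent_iff hyU]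
    have hyB : π y ∈ B.target := by
      rw [← A.right_inv hyA, ← hfπ _ (A.map_target hyA)]
      exact B.map_source (hAB _ (A.map_target hyA))
    have he : F.f i ∘ A.symm =ᶠ[𝓝 y] B.symm ∘ π := by
      filter_upwards [A.open_target.mem_nhds hyA] with w hw
      rw [Function.comp_apply, Function.comp_apply]
      conv_rhs => rw [← A.right_inv hw, ← hfπ _ (A.map_target hw),
        B.left_inv (hAB _ (A.map_target hw))]
    have h1 := mfderiv_comp y (F.mdifferentiableAt_f hyU) ((hAs y hyA).mdifferentiableAt (by simp))
    have h2 := mfderiv_comp y ((hBs _ hyB).mdifferentiableAt (by simp))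
      (π.differentiableAt (x := y)).mdifferentiableAt
    rw [he.mfderiv_eq] at h1
    have h3 := congrArg (fun T : EuclideanSpace ℝ (Fin (4 * n + p)) →L[ℝ]
      EuclideanSpace ℝ (Fin (4 * n)) => T v) (h1.symm.trans h2)
    refine Eq.trans h3 ?_
    rw [mfderiv_eq_fderiv, π.fderiv]
    change mfderiv 𝓘(ℝ, EuclideanSpace ℝ (Fin (4 * n))) (𝓡 (4 * n)) B.symm (π y) (π v) = 0
    rw [hv]
    exact map_zero (mfderiv 𝓘(ℝ, EuclideanSpace ℝ (Fin (4 * n))) (𝓡 (4 * n)) B.symm (π y))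
  -- A ball in the adapted chart is convex, as `eq_of_horizontal` requires.
  obtain ⟨ε, hε, hball⟩ := Metric.mem_nhds_iff.1
    (Filter.inter_mem (A.open_target.mem_nhds hy₁A) hker)
  set b := pullForm α A.symm with hbdef
  have hbh : ∀ y ∈ Metric.ball y₁ ε, ∀ v : Fin k → EuclideanSpace ℝ (Fin (4 * n + p)),
      (∃ j, π (v j) = 0) → b y v = 0 := by
    rintro y hy v ⟨j, hj⟩
    exact hα.horizontal _ _ ⟨j, (hball hy).2 _ hj⟩
  have hconst : ∀ y ∈ Metric.ball y₁ ε, ∀ y' ∈ Metric.ball y₁ ε, π y = π y' → b y = b y' := by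
    intro y hy y' hy' hyy'
    refine eq_of_horizontal Metric.isOpen_ball (convex_ball y₁ ε) (fun z hz => ?_) π.toLinearMap
      hbh (fun z hz v hv => ?_) hy hy' hyy'
    · exact (hα.smooth.contDiffAt_pullForm (hAs z (hball hz).1)).differentiableAt (by simp)
    · obtain ⟨j, hj⟩ := hv
      rw [hα.smooth.extDeriv_pullForm (hAs z (hball hz).1)]
      exact hα.extDer_horizontal _ _ ⟨j, (hball hz).2 _ hj⟩
  -- the section of `f_i` through `x₀`
  let P : EuclideanSpace ℝ (Fin (4 * n + p)) → EuclideanSpace ℝ (Fin (4 * n + p)) :=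
    fun y => y₁ + s (π y - π y₁)
  have hPy₁ : P y₁ = y₁ := by simp [P]
  have hPc : ContDiff ℝ ∞ P := by
    simp only [P]; fun_prop
  have hPd : ∀ y, fderiv ℝ P y = s.comp π := by
    intro y
    have : HasFDerivAt P (s.comp π) y := by
      have := (s.hasFDerivAt (x := π y - π y₁)).comp y ((π.hasFDerivAt (x := y)).sub_const (π y₁))
      exact this.const_add y₁
    exact this.fderiv
  have hπP : ∀ y, π (P y) = π y := by
    intro y
    simp [P, hπ]
  -- The section has to be expressed in the preferred chart of `N` at `f_i(x₀)`, since
  -- `IsPullbackAt` refers to it; the adapted chart `B` only intervenes in between.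
  let τ : EuclideanSpace ℝ (Fin (4 * n)) → EuclideanSpace ℝ (Fin (4 * n + p)) :=
    fun w => y₁ + s (B ((extChartAt (𝓡 (4 * n)) (F.f i x₀)).symm w) - π y₁)
  let σ := A.symm ∘ τ
  set ψ := extChartAt (𝓡 (4 * n)) (F.f i x₀) with hψ
  have hψx : ψ.symm (ψ (F.f i x₀)) = F.f i x₀ := extChartAt_to_inv _
  have hτ₀ : τ (F.localProj i x₀ x₀) = y₁ := by
    simp only [τ, localProj, Function.comp_apply, ← hψ, hψx, hfπ _ hxA, ← hy₁]
    simp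
  have hσ : ContMDiffAt 𝓘(ℝ, EuclideanSpace ℝ (Fin (4 * n))) (𝓡 (4 * n + p)) ∞ σ
      (F.localProj i x₀ x₀) := by
    refine ContMDiffAt.comp _ (by rw [hτ₀]; exact hAs y₁ hy₁A) ?_
    have h1 : ContMDiffAt 𝓘(ℝ, EuclideanSpace ℝ (Fin (4 * n))) (𝓡 (4 * n)) ∞ ψ.symm
        (F.localProj i x₀ x₀) := contMDiffAt_extChartAt_symm (mem_extChartAt_target _)
    have h2 : ContMDiffAt (𝓡 (4 * n)) 𝓘(ℝ, EuclideanSpace ℝ (Fin (4 * n))) ∞ B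
        (ψ.symm (F.localProj i x₀ x₀)) := by
      change ContMDiffAt _ _ _ _ (ψ.symm (ψ (F.f i x₀)))
      rw [hψx]; exact hBd _ (hAB _ hxA)
    have h2 := ContMDiffAt.comp (F.localProj i x₀ x₀) h2 h1
    have h3 : ContDiff ℝ ∞ fun w : EuclideanSpace ℝ (Fin (4 * n)) => y₁ + s (w - π y₁) := by
      fun_prop
    exact ContMDiffAt.comp (F.localProj i x₀ x₀) (g := fun w => y₁ + s (w - π y₁))
      (f := B ∘ ψ.symm) h3.contMDiff.contMDiffAt h2
  refine ⟨pullForm α σ, hα.smooth.contDiffAt_pullForm hσ, ?_⟩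
  have hφc : ContinuousAt (F.localProj i x₀) x₀ :=
    (F.contMDiffAt_localProj hx (mem_extChartAt_source _)).continuousAt
  have hPA : ∀ᶠ z in 𝓝 x₀, P (A z) ∈ Metric.ball y₁ ε := by
    have hc : ContinuousAt (fun z => P (A z)) x₀ :=
      hPc.continuous.continuousAt.comp (hAd x₀ hxA).continuousAt
    refine hc.eventually (Metric.isOpen_ball.mem_nhds ?_)
    change P (A x₀) ∈ _
    rw [← hy₁, hPy₁]; exact Metric.mem_ball_self hε
  have hAball : ∀ᶠ z in 𝓝 x₀, A z ∈ Metric.ball y₁ ε :=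
    (hAd x₀ hxA).continuousAt.eventually (Metric.ball_mem_nhds y₁ hε)
  have hsrc := F.eventually_mem_source hx
  -- The section after the submersion is the affine map `P` read in the chart `A`.
  have hcomp : ∀ᶠ z in 𝓝 x₀, σ (F.localProj i x₀ z) = A.symm (P (A z)) := by
    filter_upwards [hsrc, A.open_source.mem_nhds hxA] with z hz hzA
    simp only [σ, τ, P, localProj, Function.comp_apply]
    rw [← hψ, ψ.left_inv hz.2, hfπ z hzA]
  filter_upwards [hφc.eventually (eventually_mdifferentiableAt hσ), hPA, hAball, hsrc,
    hcomp.eventually_nhds, A.open_source.mem_nhds hxA] with z hzσ hzP hzb hzs hzc hzA v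
  have hzAz : A.symm (A z) = z := A.left_inv hzA
  have hAz := (hAd z hzA).mdifferentiableAt (by simp : (∞ : WithTop ℕ∞) ≠ 0)
  have hPz : MDifferentiableAt 𝓘(ℝ, EuclideanSpace ℝ (Fin (4 * n + p)))
      𝓘(ℝ, EuclideanSpace ℝ (Fin (4 * n + p))) P (A z) :=
    (hPc.differentiable (by simp) (A z)).mdifferentiableAt
  have hd₁ := mfderiv_comp z hzσ (F.mdifferentiableAt_localProj hzs.1 hzs.2)
  have hd₂ := mfderiv_comp z (g := A.symm) (f := P ∘ A)
    ((hAs _ (hball hzP).1).mdifferentiableAt (by simp)) (hPz.comp z hAz)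
  rw [mfderiv_comp z hPz hAz, mfderiv_eq_fderiv, hPd] at hd₂
  have hzc' : σ ∘ F.localProj i x₀ =ᶠ[𝓝 z] A.symm ∘ (P ∘ A) := hzc
  rw [hzc'.mfderiv_eq, hd₂] at hd₁
  have hd₃ := mfderiv_comp z ((hAs _ (A.map_source hzA)).mdifferentiableAt (by simp)) hAz
  have hid : A.symm ∘ A =ᶠ[𝓝 z] id := by
    filter_upwards [A.open_source.mem_nhds hzA] with w hw using A.left_inv hw
  rw [hid.mfderiv_eq, mfderiv_id] at hd₃
  let dA : EuclideanSpace ℝ (Fin (4 * n + p)) →L[ℝ] EuclideanSpace ℝ (Fin (4 * n + p)) :=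
    mfderiv (𝓡 (4 * n + p)) 𝓘(ℝ, EuclideanSpace ℝ (Fin (4 * n + p))) A z
  have e1 : α z v = b (A z) (fun j => dA (v j)) := by
    rw [hbdef, pullForm_apply]
    have : ∀ (z' : M) (hz' : z' = z) (v' : Fin k → EuclideanSpace ℝ (Fin (4 * n + p))),
        (∀ j, v' j = v j) → α z v = α z' v' := by
      rintro _ rfl v' hv'
      congr 1
      exact funext fun j => (hv' j).symm
    refine this _ hzAz _ fun j => ?_
    exact (congrArg (fun T : EuclideanSpace ℝ (Fin (4 * n + p)) →L[ℝ]
      EuclideanSpace ℝ (Fin (4 * n + p)) => T (v j)) hd₃).symm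
  -- First move the base point within the fibre of `π`, then replace each vector by one congruent to
  -- it modulo `ker π`.
  have e2 : b (A z) (fun j => dA (v j)) = b (P (A z)) (fun j => s (π (dA (v j)))) := by
    rw [hconst _ hzb _ hzP (hπP _).symm]
    refine map_eq_of_sub_mem (α := (b (P (A z))).toAlternatingMap) (P := LinearMap.ker π.toLinearMap)
      (fun v hv => hbh _ hzP v hv) fun j => ?_
    rw [LinearMap.mem_ker, map_sub]
    exact sub_eq_zero.2 (hπ _).symm
  have e3 : b (P (A z)) (fun j => s (π (dA (v j)))) = pullForm α σ (F.localProj i x₀ z)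
      (fun j => mfderiv (𝓡 (4 * n + p)) 𝓘(ℝ, EuclideanSpace ℝ (Fin (4 * n)))
        (F.localProj i x₀) z (v j)) := by
    rw [hbdef, pullForm_apply]
    have : ∀ (z' : M) (hz' : z' = A.symm (P (A z)))
        (w : Fin k → EuclideanSpace ℝ (Fin (4 * n + p)))
        (v' : Fin k → EuclideanSpace ℝ (Fin (4 * n + p))),
        (∀ j, w j = v' j) → α (A.symm (P (A z))) w = α z' v' := by
      rintro _ rfl w v' hv'
      congr 1
      exact funext hv'
    refine this _ hzc.self_of_nhds _ _ fun j => ?_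
    exact congrArg (fun T : EuclideanSpace ℝ (Fin (4 * n + p)) →L[ℝ]
      EuclideanSpace ℝ (Fin (4 * n + p)) => T (v j)) hd₁
  rw [e1, e2, e3]

end FoliationCocycle

/-! ### Linear algebra of a Riemannian submersion at a point -/

section Projection

variable {V V' : Type*} [NormedAddCommGroup V] [NormedSpace ℝ V]
  [NormedAddCommGroup V'] [NormedSpace ℝ V']

/-- `H` is the orthogonal complement of the kernel `P` of `T`, and `T` restricts to an isometry of
`H` onto `V'`. -/
structure IsMetricProjection (g : V →L[ℝ] V →L[ℝ] ℝ) (g' : V' →L[ℝ] V' →L[ℝ] ℝ)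
    (T : V →L[ℝ] V') (H P : Submodule ℝ V) : Prop where
  symm : ∀ u v, g u v = g v u
  pos : ∀ v, v ≠ 0 → 0 < g v v
  mem_normal : ∀ u, u ∈ H ↔ ∀ v ∈ P, g v u = 0
  mem_kernel : ∀ v, v ∈ P ↔ T v = 0
  surjective : Function.Surjective T
  isometry : ∀ u ∈ H, ∀ v ∈ H, g' (T u) (T v) = g u v

namespace IsMetricProjection

variable {g : V →L[ℝ] V →L[ℝ] ℝ} {g' : V' →L[ℝ] V' →L[ℝ] ℝ}
  {T : V →L[ℝ] V'} {H P : Submodule ℝ V}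

/-- A positive definite form is nondegenerate on `P`, so `g v` restricted to `P` is represented by
some `p ∈ P`, and `v - p` is orthogonal to `P`. -/
theorem exists_sub_mem [FiniteDimensional ℝ V] (h : IsMetricProjection g g' T H P) (v : V) : ∃ u ∈ H, v - u ∈ P := by
  let β : P →ₗ[ℝ] Module.Dual ℝ P :=
    { toFun := fun p => (g p).toLinearMap ∘ₗ P.subtype
      map_add' := fun p q => by ext; simp
      map_smul' := fun c p => by ext; simp }
  have hinj : Function.Injective β := by
    refine LinearMap.ker_eq_bot.1 (LinearMap.ker_eq_bot'.2 fun p hp => ?_)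
    by_contra hne
    have h1 := h.pos p (fun h0 => hne (Subtype.ext h0))
    have h2 : g p p = 0 := LinearMap.congr_fun hp p
    rw [h2] at h1
    exact lt_irrefl _ h1
  have hsurj : Function.Surjective β :=
    (LinearMap.injective_iff_surjective_of_finrank_eq_finrank
      (Subspace.dual_finrank_eq (K := ℝ) (V := P)).symm).1 hinj
  obtain ⟨p, hp⟩ := hsurj ((g v).toLinearMap ∘ₗ P.subtype)
  refine ⟨v - p, (h.mem_normal _).2 fun w hw => ?_, by simp⟩
  have h1 : g p w = g v w := LinearMap.congr_fun hp ⟨w, hw⟩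
  rw [map_sub, h.symm w v, h.symm w p, h1, sub_self]

theorem exists_mem [FiniteDimensional ℝ V] (h : IsMetricProjection g g' T H P) (w : V') : ∃ u ∈ H, T u = w := by
  obtain ⟨v, rfl⟩ := h.surjective w
  obtain ⟨u, hu, hv⟩ := h.exists_sub_mem v
  refine ⟨u, hu, ?_⟩
  rw [h.mem_kernel, map_sub, sub_eq_zero] at hv
  exact hv.symm

theorem eq_of_map_eq (h : IsMetricProjection g g' T H P) {u v : V} (hu : u ∈ H) (hv : v ∈ H)
    (huv : T u = T v) : u = v := by
  by_contra hne
  have h1 := h.pos (u - v) (sub_ne_zero.2 hne)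
  have h2 := h.isometry _ (H.sub_mem hu hv) _ (H.sub_mem hu hv)
  rw [map_sub, huv, sub_self, map_zero] at h2
  rw [← h2] at h1
  simp at h1

theorem exists_section [FiniteDimensional ℝ V] (h : IsMetricProjection g g' T H P) :
    ∃ s : V' →ₗ[ℝ] V, (∀ w, T (s w) = w) ∧ (∀ w, s w ∈ H) ∧
    ∀ u ∈ H, s (T u) = u := by
  choose s hs hT using h.exists_mem
  refine ⟨⟨⟨s, fun a b => h.eq_of_map_eq (hs _) (H.add_mem (hs _) (hs _)) ?_⟩,
    fun c a => h.eq_of_map_eq (hs _) (H.smul_mem _ (hs _)) ?_⟩, hT, hs,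
    fun u hu => h.eq_of_map_eq (hs _) hu (hT _)⟩
  · rw [map_add, hT, hT, hT]
  · simp [hT]

theorem isTransverse [FiniteDimensional ℝ V] (h : IsMetricProjection g g' T H P) {Q : Submodule ℝ (V →L[ℝ] V)}
    (h₀ : ∀ A ∈ Q, ∀ v ∈ P, A v = 0)
    (hm : ∀ A ∈ Q, ∀ v, A v ∈ H) : IsTransverse g H P Q where
  orthogonal := fun u hu v hv => by rw [h.symm]; exact (h.mem_normal u).1 hu v hv
  complement := h.exists_sub_mem
  map_eq_zero := h₀
  map_mem := hm

/-- `T` identifies `H` isometrically with `V'`. A quaternionic basis downstairs lifts through the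
inverse `s`, and an endomorphism `A'` lifts to `s ∘ A' ∘ T`, which kills `P`. -/
theorem nonempty_quaternionicFrame [FiniteDimensional ℝ V] (h : IsMetricProjection g g' T H P)
    [FiniteDimensional ℝ V'] {n : ℕ}
    (hn : Module.finrank ℝ V' = 4 * n)
    (hs : ∀ u v, g' u v = g' v u) (hp : ∀ v, v ≠ 0 → 0 < g' v v) {I J K : V' →L[ℝ] V'}
    (hh : IsHypercomplexOn ⊤ I J K) (hI : ∀ u v, g' (I u) (I v) = g' u v)
    (hJ : ∀ u v, g' (J u) (J v) = g' u v) (hK : ∀ u v, g' (K u) (K v) = g' u v)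
    {Q : Submodule ℝ (V →L[ℝ] V)}
    (hQ : ∀ A : V →L[ℝ] V, (∀ v ∈ P, A v = 0) → (∀ v, A v ∈ H) →
      (∃ A' ∈ ({I, J, K} : Set (V' →L[ℝ] V')), T.comp A = A'.comp T) → A ∈ Q) :
    Nonempty (QuaternionicFrame n g H Q) := by
  obtain ⟨e, he, e1, e2, e3⟩ := exists_quaternionic_basis hn g' hs hp hh hI hJ hK
  obtain ⟨s, hTs, hsH, hsT⟩ := h.exists_section
  let S : V' →L[ℝ] V := LinearMap.toContinuousLinearMap s
  have hS : ∀ A' ∈ ({I, J, K} : Set (V' →L[ℝ] V')), S.comp (A'.comp T) ∈ Q := by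
    intro A' hA'
    refine hQ _ (fun v hv => ?_) (fun v => hsH _) ⟨A', hA', ?_⟩
    · change s (A' (T v)) = 0
      rw [(h.mem_kernel v).1 hv, map_zero, map_zero]
    · ext v
      exact hTs _
  have hli : LinearIndependent ℝ e := by
    rw [Fintype.linearIndependent_iff]
    intro c hc d
    have := congrArg (g' (e d)) hc
    simpa [he] using this
  have htop : Submodule.span ℝ (Set.range e) = ⊤ :=
    hli.span_eq_top_of_card_eq_finrank' (by simp [hn, mul_comm])
  have hmul : ∀ {A' B' C' : V' →L[ℝ] V'}, (∀ u, A' (B' u) = C' u) → ∀ u : V,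
      s (A' (T (s (B' (T u))))) = s (C' (T u)) := by
    intro A' B' C' hABC u
    rw [hTs, hABC]
  have hneg : ∀ {A' : V' →L[ℝ] V'}, (∀ u, A' (A' u) = -u) → ∀ u ∈ H,
      s (A' (T (s (A' (T u))))) = -u := by
    intro A' hA u hu
    rw [hTs, hA, map_neg, hsT u hu]
  exact ⟨{
    I := S.comp (I.comp T)
    J := S.comp (J.comp T)
    K := S.comp (K.comp T)
    I_mem := hS _ (by simp)
    J_mem := hS _ (by simp)
    K_mem := hS _ (by simp)
    hypercomplex :=
      { mapsTo_I := fun _ _ => hsH _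
        mapsTo_J := fun _ _ => hsH _
        mapsTo_K := fun _ _ => hsH _
        I_I := hneg fun u => hh.I_I u trivial
        J_J := hneg fun u => hh.J_J u trivial
        K_K := hneg fun u => hh.K_K u trivial
        I_J := fun u _ => hmul (fun u => hh.I_J u trivial) u
        J_K := fun u _ => hmul (fun u => hh.J_K u trivial) u
        K_I := fun u _ => hmul (fun u => hh.K_I u trivial) u }
    e := s ∘ e
    e_mem := fun c => hsH _
    orthonormal := fun c d => by
      rw [← he, Function.comp_apply, Function.comp_apply, ← h.isometry _ (hsH _) _ (hsH _), hTs,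
        hTs]
    span_eq := by
      rw [Set.range_comp, ← Submodule.map_span, htop, Submodule.map_top]
      ext u
      exact ⟨fun ⟨w, hw⟩ => hw ▸ hsH w, fun hu => ⟨T u, hsT u hu⟩⟩
    e_one := fun a => by
      change s _ = s (I (T (s _)))
      rw [hTs, e1]
    e_two := fun a => by
      change s _ = s (J (T (s _)))
      rw [hTs, e2]
    e_three := fun a => by
      change s _ = s (K (T (s _)))
      rw [hTs, e3] }⟩

/-- The units of the frame descend along `T` to a hypercomplex structure in the span of `I, J, K`,
and any two such structures define the same `4`-form. Hence the arbitrary frame does not affect `Ω`.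
-/
theorem krainesForm_eq [FiniteDimensional ℝ V] (h : IsMetricProjection g g' T H P) [Nontrivial V'] {n : ℕ} {Q : Submodule ℝ (V →L[ℝ] V)}
    (b : QuaternionicFrame n g H Q) {I J K : V' →L[ℝ] V'} (hh : IsHypercomplexOn ⊤ I J K)
    (hm : ∀ A ∈ Q, ∀ v, A v ∈ H)
    (hQ : ∀ A ∈ Q, ∃ A' ∈ Submodule.span ℝ {I, J, K}, T.comp A = A'.comp T) :
    b.krainesForm = (quaternionicForm g' I J K).compLinearMap T.toLinearMap := by
  obtain ⟨I', hI', eI⟩ := hQ _ b.I_mem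
  obtain ⟨J', hJ', eJ⟩ := hQ _ b.J_mem
  obtain ⟨K', hK', eK⟩ := hQ _ b.K_mem
  have eI := fun u => DFunLike.congr_fun eI u
  have eJ := fun u => DFunLike.congr_fun eJ u
  have eK := fun u => DFunLike.congr_fun eK u
  simp only [ContinuousLinearMap.comp_apply] at eI eJ eK
  have hb := b.hypercomplex
  have hh' : IsHypercomplexOn ⊤ I' J' K' := by
    refine ⟨fun _ _ => trivial, fun _ _ => trivial, fun _ _ => trivial, ?_, ?_, ?_, ?_, ?_, ?_⟩ <;>
      intro w _ <;> obtain ⟨u, hu, rfl⟩ := h.exists_mem w <;> simp only [← eI, ← eJ, ← eK]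
    · rw [hb.I_I u hu, map_neg]
    · rw [hb.J_J u hu, map_neg]
    · rw [hb.K_K u hu, map_neg]
    · rw [hb.I_J u hu]
    · rw [hb.J_K u hu]
    · rw [hb.K_I u hu]
  have key : ∀ (A : V →L[ℝ] V) (A' : V' →L[ℝ] V'), A ∈ Q → (∀ u, T (A u) = A' (T u)) →
      ∀ u v, g (A u) v = g' (A' (T u)) (T v) := by
    intro A A' hA hAA u v
    obtain ⟨w, hw, hvw⟩ := h.exists_sub_mem v
    have h1 : g (A u) (v - w) = 0 := by
      rw [h.symm]; exact (h.mem_normal _).1 (hm A hA u) _ hvw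
    rw [map_sub, sub_eq_zero] at h1
    rw [h.mem_kernel, map_sub, sub_eq_zero] at hvw
    rw [h1, hvw, ← hAA, h.isometry _ (hm A hA u) _ hw]
  rw [← quaternionicForm_eq_of_mem_span g' hh hh' hI' hJ' hK']
  exact quaternionicForm_compLinearMap (key _ _ b.I_mem eI) (key _ _ b.J_mem eJ)
    (key _ _ b.K_mem eK)

end IsMetricProjection

end Projection

/-! ### Normal frames and the form `Ω` -/

namespace FoliationCocycle

variable {n p : ℕ} {ι M N : Type*}
  [TopologicalSpace M] [ChartedSpace (EuclideanSpace ℝ (Fin (4 * n + p))) M]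
  [TopologicalSpace N] [ChartedSpace (EuclideanSpace ℝ (Fin (4 * n))) N]
  [IsManifold (𝓡 (4 * n + p)) ∞ M] [IsManifold (𝓡 (4 * n)) ∞ N]
  {F : FoliationCocycle n p ι M N} {g : Metric (4 * n + p) M} {S : QuaternionKahler n N}
  {i : ι} {x : M}

theorem isMetricProjection (hg : F.IsBundleLike g S) (hx : x ∈ F.U i) :
    IsMetricProjection (V := EuclideanSpace ℝ (Fin (4 * n + p)))
      (V' := EuclideanSpace ℝ (Fin (4 * n))) (g.inner x) (S.g.inner (F.f i x)) (F.df i x)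
      (F.normal g x) (F.leafTangent x) where
  symm := g.symm x
  pos := g.pos x
  mem_normal := fun _ => Iff.rfl
  mem_kernel := fun _ => F.mem_leafTangent_iff hx
  surjective := F.df_surjective hx
  isometry := hg i x hx

theorem isTransverse_normal (hg : F.IsBundleLike g S) (x : M) :
    IsTransverse (g.inner x) (F.normal g x) (F.leafTangent x) (F.normalQ g S x) := by
  obtain ⟨i, hi⟩ := F.cover x
  exact (isMetricProjection hg hi).isTransverse (fun A hA => hA.1) (fun A hA => hA.2.1)

/-- `normalQ` imposes a condition for every index; as the `γ_ij` preserve `Q`, the condition for one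
index implies the others. -/
theorem mem_normalQ (hS : F.IsTransverselyQK S) (hx : x ∈ F.U i)
    {A : TangentSpace (𝓡 (4 * n + p)) x →L[ℝ] TangentSpace (𝓡 (4 * n + p)) x}
    (h₀ : ∀ v ∈ F.leafTangent x, A v = 0) (hm : ∀ v, A v ∈ F.normal g x)
    (hA : ∃ B ∈ S.Q (F.f i x), (F.df i x).comp A = B.comp (F.df i x)) : A ∈ F.normalQ g S x := by
  refine ⟨h₀, hm, fun j hj => ?_⟩
  obtain ⟨B, hB, e⟩ := hA
  obtain ⟨B', hB', e'⟩ := hS.preserves j i (F.f i x) ⟨x, ⟨hj, hx⟩, rfl⟩ B hB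
  -- `B'` lives over `γ_ji(f_i x)`, which equals `f_j x` only propositionally.
  have transport : ∀ y y' : N, y = y' → ∀ B ∈ S.Q y', ∃ B' ∈ S.Q y,
      ∀ w : EuclideanSpace ℝ (Fin (4 * n)), (B' w : EuclideanSpace ℝ (Fin (4 * n))) = B w := by
    rintro y _ rfl B hB
    exact ⟨B, hB, fun _ => rfl⟩
  obtain ⟨B'', hB'', e''⟩ := transport _ _ (F.compat j i x ⟨hj, hx⟩) B' hB'
  refine ⟨B'', hB'', ContinuousLinearMap.ext fun v => ?_⟩
  have h1 := DFunLike.congr_fun e v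
  have h2 := DFunLike.congr_fun e' (F.df i x v)
  refine (F.df_eq_comp hj hx (A v)).trans ?_
  refine (congrArg _ h1).trans (h2.trans ?_)
  refine (congrArg B' (F.df_eq_comp hj hx v).symm).trans (e'' _).symm

theorem nonempty_normalFrame (hS : F.IsTransverselyQK S) (hg : F.IsBundleLike g S) (x : M) :
    Nonempty (F.NormalFrame g S x) := by
  obtain ⟨i, hi⟩ := F.cover x
  obtain ⟨W, -, hW, I, J, K, h⟩ := S.locally_spanned (F.f i x)
  obtain ⟨-, -, -, hh, hQ, ho⟩ := h _ hW
  refine (isMetricProjection hg hi).nonempty_quaternionicFrame (n := n) (by simp)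
    (S.g.symm _) (S.g.pos _) hh (ho _ (by simp)) (ho _ (by simp)) (ho _ (by simp))
    fun A h₀ hm hA => mem_normalQ hS hi h₀ hm ?_
  obtain ⟨A', hA', e⟩ := hA
  exact ⟨A', hQ ▸ Submodule.subset_span hA', e⟩

/-- The zero space has no endomorphism space of rank `3`. This supplies the nonzero vector on which
hypercomplex structures are compared. -/
theorem nontrivial_of_rank (S : QuaternionKahler n N) (y : N) :
    Nontrivial (EuclideanSpace ℝ (Fin (4 * n))) := by
  by_contra hne
  rw [not_nontrivial_iff_subsingleton] at hne
  have h1 := S.rank_eq y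
  have : Subsingleton (S.Q y) := by
    refine ⟨fun a b => Subtype.ext ?_⟩
    refine ContinuousLinearMap.ext fun v => ?_
    exact hne.elim _ _
  rw [Module.finrank_zero_of_subsingleton] at h1
  omega

theorem Omega_eq (hS : F.IsTransverselyQK S) (hg : F.IsBundleLike g S) (hx : x ∈ F.U i)
    {I J K : TangentSpace (𝓡 (4 * n)) (F.f i x) →L[ℝ] TangentSpace (𝓡 (4 * n)) (F.f i x)}
    (hh : IsHypercomplexOn ⊤ I J K) (hQ : S.Q (F.f i x) = Submodule.span ℝ {I, J, K}) :
    F.Omega g S x = (quaternionicForm (S.g.inner (F.f i x)) I J K).compLinearMap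
      (F.df i x).toLinearMap := by
  have := nontrivial_of_rank S (F.f i x)
  rw [Omega, dif_pos (nonempty_normalFrame hS hg x)]
  refine (isMetricProjection hg hx).krainesForm_eq _ hh (fun A hA => hA.2.1) fun A hA => ?_
  obtain ⟨B, hB, e⟩ := hA.2.2 i hx
  exact ⟨B, hQ ▸ hB, e⟩

end FoliationCocycle

/-! ### Smoothness of metrics and endomorphisms along parametrisations -/

section Bundles

open Bundle

variable {m r : ℕ} {N : Type*} [TopologicalSpace N]
  [ChartedSpace (EuclideanSpace ℝ (Fin m)) N] [IsManifold (𝓡 m) ∞ N]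

theorem contMDiffAt_mfderiv_apply {c : EuclideanSpace ℝ (Fin r) → N} {y : EuclideanSpace ℝ (Fin r)}
    (hc : ContMDiffAt 𝓘(ℝ, EuclideanSpace ℝ (Fin r)) (𝓡 m) ∞ c y) (u : EuclideanSpace ℝ (Fin r)) :
    ContMDiffAt 𝓘(ℝ, EuclideanSpace ℝ (Fin r)) (𝓡 m).tangent ∞
      (fun z => (⟨c z, mfderiv 𝓘(ℝ, EuclideanSpace ℝ (Fin r)) (𝓡 m) c z u⟩ : TangentBundle (𝓡 m) N))
      y := by
  have : IsManifold (𝓡 m) 1 N := IsManifold.of_le (n := ∞) (by simp)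
  have h1 := ContMDiffAt.mfderiv_const (m := ∞) hc (by simp)
  have h2 : ContMDiffAt 𝓘(ℝ, EuclideanSpace ℝ (Fin r)) (𝓘(ℝ, EuclideanSpace ℝ (Fin r))).tangent ∞
      (fun z => (⟨z, u⟩ : TangentBundle 𝓘(ℝ, EuclideanSpace ℝ (Fin r))
        (EuclideanSpace ℝ (Fin r)))) y := by
    refine (contMDiffAt_section (IB := 𝓘(ℝ, EuclideanSpace ℝ (Fin r)))
      (E := fun z : EuclideanSpace ℝ (Fin r) => TangentSpace 𝓘(ℝ, EuclideanSpace ℝ (Fin r)) z)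
      (s := fun _ => u) y).2 ?_
    simp
    exact contMDiffAt_const
  exact ContMDiffAt.clm_apply_of_inCoordinates (b₁ := id) (b₂ := c)
      (E₁ := fun z : EuclideanSpace ℝ (Fin r) => TangentSpace 𝓘(ℝ, EuclideanSpace ℝ (Fin r)) z)
      (E₂ := fun z : N => TangentSpace (𝓡 m) z) (v := fun _ => u) h1 h2 hc

theorem contDiffAt_inner (g : Metric m N) {c : EuclideanSpace ℝ (Fin r) → N} {y : EuclideanSpace ℝ (Fin r)}
    (hc : ContMDiffAt 𝓘(ℝ, EuclideanSpace ℝ (Fin r)) (𝓡 m) ∞ c y)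
    {X Y : ∀ z : EuclideanSpace ℝ (Fin r), TangentSpace (𝓡 m) (c z)}
    (hX : ContMDiffAt 𝓘(ℝ, EuclideanSpace ℝ (Fin r)) (𝓡 m).tangent ∞
      (fun z => (⟨c z, X z⟩ : TangentBundle (𝓡 m) N)) y)
    (hY : ContMDiffAt 𝓘(ℝ, EuclideanSpace ℝ (Fin r)) (𝓡 m).tangent ∞
      (fun z => (⟨c z, Y z⟩ : TangentBundle (𝓡 m) N)) y) :
    ContDiffAt ℝ ∞ (fun z => g.inner (c z) (X z) (Y z)) y := by
  rw [← contMDiffAt_iff_contDiffAt]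
  have h1 : ContMDiffAt 𝓘(ℝ, EuclideanSpace ℝ (Fin r)) ((𝓡 m).prod 𝓘(ℝ, ℝ)) ∞
      (fun z => TotalSpace.mk' ℝ (E := Trivial N ℝ) (c z) (g.inner (c z) (X z) (Y z))) y := by
    refine ContMDiffAt.clm_bundle_apply₂ (F₁ := EuclideanSpace ℝ (Fin m)) (F₂ := EuclideanSpace ℝ (Fin m)) (F₃ := ℝ)
      (ContMDiffAt.comp (g := fun x => TotalSpace.mk' (EuclideanSpace ℝ (Fin m) →L[ℝ] EuclideanSpace ℝ (Fin m) →L[ℝ] ℝ) x (g.inner x)) y (g.contMDiff (c y)) hc) hX hY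
  simp only [contMDiffAt_totalSpace] at h1
  exact h1.2

theorem contMDiffAt_end_apply {c : EuclideanSpace ℝ (Fin r) → N} {y : EuclideanSpace ℝ (Fin r)}
    (hc : ContMDiffAt 𝓘(ℝ, EuclideanSpace ℝ (Fin r)) (𝓡 m) ∞ c y)
    {A : ∀ y : N, TangentSpace (𝓡 m) y →L[ℝ] TangentSpace (𝓡 m) y} (hA : SmoothEndAt A (c y))
    {X : ∀ z : EuclideanSpace ℝ (Fin r), TangentSpace (𝓡 m) (c z)}
    (hX : ContMDiffAt 𝓘(ℝ, EuclideanSpace ℝ (Fin r)) (𝓡 m).tangent ∞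
      (fun z => (⟨c z, X z⟩ : TangentBundle (𝓡 m) N)) y) :
    ContMDiffAt 𝓘(ℝ, EuclideanSpace ℝ (Fin r)) (𝓡 m).tangent ∞
      (fun z => (⟨c z, A (c z) (X z)⟩ : TangentBundle (𝓡 m) N)) y := 
  ContMDiffAt.clm_bundle_apply (F₁ := EuclideanSpace ℝ (Fin m)) (F₂ := EuclideanSpace ℝ (Fin m)) 
    (ContMDiffAt.comp (g := endSection A) y hA hc) hX

theorem contDiffAt_pullForm_fundamentalForm (g : Metric m N) {c : EuclideanSpace ℝ (Fin r) → N}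
    {y : EuclideanSpace ℝ (Fin r)}
    (hc : ContMDiffAt 𝓘(ℝ, EuclideanSpace ℝ (Fin r)) (𝓡 m) ∞ c y)
    {A : ∀ y : N, TangentSpace (𝓡 m) y →L[ℝ] TangentSpace (𝓡 m) y} (hA : SmoothEndAt A (c y)) :
    ContDiffAt ℝ ∞ (pullForm (fun w => fundamentalForm (g.inner w) (A w)) c) y := by
  refine contDiffAt_alternating_iff.2 fun v => ?_
  have key : ∀ u v, ContDiffAt ℝ ∞ (fun z => g.inner (c z)
      (A (c z) (mfderiv 𝓘(ℝ, EuclideanSpace ℝ (Fin r)) (𝓡 m) c z u))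
      (mfderiv 𝓘(ℝ, EuclideanSpace ℝ (Fin r)) (𝓡 m) c z v)) y := fun u v =>
    contDiffAt_inner g hc (contMDiffAt_end_apply hc hA (contMDiffAt_mfderiv_apply hc u))
      (contMDiffAt_mfderiv_apply hc v)
  exact contDiffAt_const.mul ((key (v 0) (v 1)).sub (key (v 1) (v 0)))

/-- The Gram matrix of the coordinate fields of a parametrisation. -/
def gramMatrix (g : Metric m N) (c : EuclideanSpace ℝ (Fin r) → N) (y : EuclideanSpace ℝ (Fin r)) :
    Matrix (Fin r) (Fin r) ℝ :=
  Matrix.of fun a b => g.inner (c y)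
    (mfderiv 𝓘(ℝ, EuclideanSpace ℝ (Fin r)) (𝓡 m) c y (euclBasis r a))
    (mfderiv 𝓘(ℝ, EuclideanSpace ℝ (Fin r)) (𝓡 m) c y (euclBasis r b))

theorem contDiffAt_gramMatrix (g : Metric m N) {c : EuclideanSpace ℝ (Fin r) → N}
    {y : EuclideanSpace ℝ (Fin r)}
    (hc : ContMDiffAt 𝓘(ℝ, EuclideanSpace ℝ (Fin r)) (𝓡 m) ∞ c y) (a b : Fin r) :
    ContDiffAt ℝ ∞ (fun z => gramMatrix g c z a b) y :=
  contDiffAt_inner g hc (contMDiffAt_mfderiv_apply hc _) (contMDiffAt_mfderiv_apply hc _)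

end Bundles

/-! ### Smoothness of inverse matrices, wedges and contractions -/

section Smooth

variable {E : Type*} [NormedAddCommGroup E] [NormedSpace ℝ E] {y : E}

theorem contDiffAt_det {r : ℕ} {A : E → Matrix (Fin r) (Fin r) ℝ}
    (hA : ∀ a b, ContDiffAt ℝ ∞ (fun z => A z a b) y) :
    ContDiffAt ℝ ∞ (fun z => (A z).det) y := by
  simp_rw [Matrix.det_apply]
  refine ContDiffAt.sum fun σ _ => ?_
  simp_rw [Units.smul_def, zsmul_eq_mul]
  exact contDiffAt_const.mul (contDiffAt_prod fun a _ => hA _ _)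

/-- By Cramer's rule the entries of the inverse are quotients of determinants. -/
theorem contDiffAt_matrix_inv {r : ℕ} {A : E → Matrix (Fin r) (Fin r) ℝ}
    (hA : ∀ a b, ContDiffAt ℝ ∞ (fun z => A z a b) y) (h : (A y).det ≠ 0) (a b : Fin r) :
    ContDiffAt ℝ ∞ (fun z => (A z)⁻¹ a b) y := by
  simp_rw [Matrix.inv_def, Ring.inverse_eq_inv', Matrix.smul_apply, smul_eq_mul,
    Matrix.adjugate_apply]
  refine ((contDiffAt_det hA).inv h).mul (contDiffAt_det fun c d => ?_)
  simp_rw [Matrix.updateRow_apply]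
  split_ifs
  · exact contDiffAt_const
  · exact hA _ _

variable {q : ℕ}

theorem ContDiffAt.wedge {k l m : ℕ} (h : k + l = m)
    {a : E → EuclideanSpace ℝ (Fin q) [⋀^Fin k]→L[ℝ] ℝ}
    {b : E → EuclideanSpace ℝ (Fin q) [⋀^Fin l]→L[ℝ] ℝ} (ha : ContDiffAt ℝ ∞ a y)
    (hb : ContDiffAt ℝ ∞ b y) :
    ContDiffAt ℝ ∞ (fun z => toContinuous
      (QKFoliation.wedge h (a z).toAlternatingMap (b z).toAlternatingMap)) y := by
  refine contDiffAt_alternating_iff.2 fun v => ?_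
  simp_rw [toContinuous_apply, wedge_apply]
  refine contDiffAt_const.mul (ContDiffAt.sum fun σ _ => ?_)
  exact contDiffAt_const.mul ((contDiffAt_alternating_iff.1 ha _).mul
    (contDiffAt_alternating_iff.1 hb _))

/-- The contraction in terms of a basis `b`, where `A` is the inverse of its Gram matrix. -/
def gramContraction {V : Type*} [AddCommGroup V] [Module ℝ V] {N r j m : ℕ} (h : r + j = m)
    (A : Matrix (Fin N) (Fin N) ℝ) (b : Fin N → V) (η : V [⋀^Fin r]→ₗ[ℝ] ℝ)
    (a : V [⋀^Fin m]→ₗ[ℝ] ℝ) : V [⋀^Fin j]→ₗ[ℝ] ℝ :=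
  ∑ s : Fin r → Fin N, ∑ t : Fin r → Fin N, ((∏ i, A (s i) (t i)) * η (b ∘ s)) •
    insertLeft (a.domDomCongr (blockEquiv h).symm) (b ∘ t)

theorem gramContraction_apply {V : Type*} [AddCommGroup V] [Module ℝ V] {N r j m : ℕ}
    (h : r + j = m) (A : Matrix (Fin N) (Fin N) ℝ) (b : Fin N → V) (η : V [⋀^Fin r]→ₗ[ℝ] ℝ)
    (a : V [⋀^Fin m]→ₗ[ℝ] ℝ) (w : Fin j → V) :
    gramContraction h A b η a w = ∑ s : Fin r → Fin N, ∑ t : Fin r → Fin N,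
      (∏ i, A (s i) (t i)) * (η (b ∘ s) * a (Sum.elim (b ∘ t) w ∘ (blockEquiv h).symm)) := by
  simp_rw [gramContraction, alternating_sum_apply, AlternatingMap.smul_apply, smul_eq_mul,
    mul_assoc]
  rfl

theorem ContDiffAt.gramContraction {r j m : ℕ} (h : r + j = m)
    {A : E → Matrix (Fin q) (Fin q) ℝ}
    {η : E → EuclideanSpace ℝ (Fin q) [⋀^Fin r]→L[ℝ] ℝ}
    {a : E → EuclideanSpace ℝ (Fin q) [⋀^Fin m]→L[ℝ] ℝ}
    (hA : ∀ c d, ContDiffAt ℝ ∞ (fun z => A z c d) y)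
    (hη : ContDiffAt ℝ ∞ η y) (ha : ContDiffAt ℝ ∞ a y) :
    ContDiffAt ℝ ∞ (fun z => toContinuous (QKFoliation.gramContraction h (A z) (euclBasis q)
      (η z).toAlternatingMap (a z).toAlternatingMap)) y := by
  refine contDiffAt_alternating_iff.2 fun v => ?_
  simp_rw [toContinuous_apply, gramContraction_apply]
  refine ContDiffAt.sum fun s _ => ContDiffAt.sum fun t _ => ?_
  exact (contDiffAt_prod fun i _ => hA _ _).mul ((contDiffAt_alternating_iff.1 hη _).mul
    (contDiffAt_alternating_iff.1 ha _))

end Smooth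

/-- A vector in the kernel of the Gram matrix would be the coordinate vector of a nonzero tangent
vector of length zero. -/
theorem det_gramMatrix_ne_zero {m : ℕ} {N : Type*} [TopologicalSpace N]
    [ChartedSpace (EuclideanSpace ℝ (Fin m)) N] [IsManifold (𝓡 m) ∞ N] (g : Metric m N)
    {c : EuclideanSpace ℝ (Fin m) → N} {y : EuclideanSpace ℝ (Fin m)}
    (hc : Function.Injective (mfderiv 𝓘(ℝ, EuclideanSpace ℝ (Fin m)) (𝓡 m) c y)) :
    (gramMatrix g c y).det ≠ 0 := by
  intro hdet
  obtain ⟨w, hw, h0⟩ := Matrix.exists_mulVec_eq_zero_iff.2 hdet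
  let C : EuclideanSpace ℝ (Fin m) →L[ℝ] EuclideanSpace ℝ (Fin m) :=
    mfderiv 𝓘(ℝ, EuclideanSpace ℝ (Fin m)) (𝓡 m) c y
  let γ : EuclideanSpace ℝ (Fin m) →L[ℝ] EuclideanSpace ℝ (Fin m) →L[ℝ] ℝ := g.inner (c y)
  have hγ : ∀ v, v ≠ 0 → 0 < γ v v := g.pos (c y)
  have hw' : ∑ a, w a • euclBasis m a ≠ 0 := by
    intro h
    exact hw (funext (Fintype.linearIndependent_iff.1 (euclBasis m).linearIndependent w h))
  have hC : C (∑ a, w a • euclBasis m a) ≠ 0 := by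
    intro h
    exact hw' (hc (h.trans (map_zero C).symm))
  have h1 : γ (C (∑ a, w a • euclBasis m a)) (C (∑ a, w a • euclBasis m a)) =
      dotProduct w (Matrix.mulVec (gramMatrix g c y) w) := by
    have hA : ∀ a b, gramMatrix g c y a b = γ (C (euclBasis m a)) (C (euclBasis m b)) :=
      fun _ _ => rfl
    simp only [map_sum, map_smul, _root_.sum_apply, _root_.smul_apply, smul_eq_mul, dotProduct,
      Matrix.mulVec, hA, Finset.mul_sum]
    rw [Finset.sum_comm]
    exact Finset.sum_congr rfl fun a _ => Finset.sum_congr rfl fun b _ => by ring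
  have h2 := hγ _ hC
  rw [h1, h0, dotProduct_zero] at h2
  exact lt_irrefl _ h2

/-! ### Local pullbacks are stable under `Ω ∧ ·` and contraction with `Ω` -/

namespace FoliationCocycle

variable {n p : ℕ} {ι M N : Type*}
  [TopologicalSpace M] [ChartedSpace (EuclideanSpace ℝ (Fin (4 * n + p))) M]
  [TopologicalSpace N] [ChartedSpace (EuclideanSpace ℝ (Fin (4 * n))) N]
  {F : FoliationCocycle n p ι M N} {i : ι} {x₀ : M}

theorem eventually_eq_compLinearMap {k : ℕ} {α : FormField (4 * n + p) M k}
    {a : EuclideanSpace ℝ (Fin (4 * n)) → EuclideanSpace ℝ (Fin (4 * n)) [⋀^Fin k]→L[ℝ] ℝ}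
    (h : ∀ᶠ z in 𝓝 x₀, ∀ v, α z v = a (F.localProj i x₀ z) (fun j => mfderiv (𝓡 (4 * n + p))
        𝓘(ℝ, EuclideanSpace ℝ (Fin (4 * n))) (F.localProj i x₀) z (v j))) :
    ∀ᶠ z in 𝓝 x₀, α z = (a (F.localProj i x₀ z)).toAlternatingMap.compLinearMap
      (mfderiv (𝓡 (4 * n + p)) 𝓘(ℝ, EuclideanSpace ℝ (Fin (4 * n)))
        (F.localProj i x₀) z).toLinearMap :=
  h.mono fun _ hz => AlternatingMap.ext hz

theorem IsPullbackAt.congr {k : ℕ} {α β : FormField (4 * n + p) M k} (hα : F.IsPullbackAt i x₀ α)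
    (h : ∀ᶠ z in 𝓝 x₀, β z = α z) : F.IsPullbackAt i x₀ β := by
  obtain ⟨a, ha, he⟩ := hα
  refine ⟨a, ha, ?_⟩
  filter_upwards [he, h] with z hz h v
  rw [h, hz]

theorem IsPullbackAt.add {k : ℕ} {α β : FormField (4 * n + p) M k} (hα : F.IsPullbackAt i x₀ α)
    (hβ : F.IsPullbackAt i x₀ β) : F.IsPullbackAt i x₀ (fun z => α z + β z) := by
  obtain ⟨a, ha, hea⟩ := hα
  obtain ⟨b, hb, heb⟩ := hβ
  refine ⟨fun y => a y + b y, ha.add hb, ?_⟩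
  filter_upwards [hea, heb] with z hza hzb v
  rw [AlternatingMap.add_apply, hza, hzb]
  rfl

theorem IsPullbackAt.smul {k : ℕ} {α : FormField (4 * n + p) M k} (hα : F.IsPullbackAt i x₀ α)
    (c : ℝ) : F.IsPullbackAt i x₀ (fun z => c • α z) := by
  obtain ⟨a, ha, hea⟩ := hα
  refine ⟨fun y => c • a y, ha.const_smul c, ?_⟩
  filter_upwards [hea] with z hza v
  rw [AlternatingMap.smul_apply, hza]
  rfl

theorem IsPullbackAt.wedge {k l m : ℕ} (h : k + l = m) {α : FormField (4 * n + p) M k}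
    {β : FormField (4 * n + p) M l} (hα : F.IsPullbackAt i x₀ α)
    (hβ : F.IsPullbackAt i x₀ β) :
    F.IsPullbackAt i x₀ (fun z => QKFoliation.wedge h (α z) (β z)) := by
  obtain ⟨a, ha, hea⟩ := hα
  obtain ⟨b, hb, heb⟩ := hβ
  refine ⟨_, ContDiffAt.wedge h ha hb, ?_⟩
  filter_upwards [eventually_eq_compLinearMap hea, eventually_eq_compLinearMap heb]
    with z hza hzb v
  rw [hza, hzb]
  exact congrArg (fun τ : EuclideanSpace ℝ (Fin (4 * n + p)) [⋀^Fin m]→ₗ[ℝ] ℝ => τ v)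
    (wedge_compLinearMap h _ _ _)

variable (F i x₀) in
/-- The inverse of the chart of `N` at `f_i(x₀)`. -/
abbrev chartSymm : EuclideanSpace ℝ (Fin (4 * n)) → N :=
  (extChartAt (𝓡 (4 * n)) (F.f i x₀)).symm

theorem chartSymm_localProj {z : M}
    (hs : F.f i z ∈ (extChartAt (𝓡 (4 * n)) (F.f i x₀)).source) :
    F.chartSymm i x₀ (F.localProj i x₀ z) = F.f i z :=
  (extChartAt (𝓡 (4 * n)) (F.f i x₀)).left_inv hs

variable [IsManifold (𝓡 (4 * n)) ∞ N]

theorem contMDiffAt_chartSymm {z : M}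
    (hs : F.f i z ∈ (extChartAt (𝓡 (4 * n)) (F.f i x₀)).source) :
    ContMDiffAt 𝓘(ℝ, EuclideanSpace ℝ (Fin (4 * n))) (𝓡 (4 * n)) ∞ (F.chartSymm i x₀)
      (F.localProj i x₀ z) :=
  contMDiffAt_extChartAt_symm ((extChartAt (𝓡 (4 * n)) (F.f i x₀)).map_source hs)

theorem mfderiv_chartSymm_localProj {z : M} (hz : z ∈ F.U i)
    (hs : F.f i z ∈ (extChartAt (𝓡 (4 * n)) (F.f i x₀)).source)
    (v : TangentSpace (𝓡 (4 * n + p)) z) :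
    (mfderiv 𝓘(ℝ, EuclideanSpace ℝ (Fin (4 * n))) (𝓡 (4 * n)) (F.chartSymm i x₀)
      (F.localProj i x₀ z) (mfderiv (𝓡 (4 * n + p)) 𝓘(ℝ, EuclideanSpace ℝ (Fin (4 * n)))
        (F.localProj i x₀) z v) : EuclideanSpace ℝ (Fin (4 * n))) = F.df i z v := by
  have h := mfderiv_comp z ((F.contMDiffAt_chartSymm hs).mdifferentiableAt (by simp))
    (F.mdifferentiableAt_localProj hz hs)
  have he : F.chartSymm i x₀ ∘ F.localProj i x₀ =ᶠ[𝓝 z] F.f i := by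
    filter_upwards [(F.contMDiffAt_f hz).continuousAt
      ((isOpen_extChartAt_source (F.f i x₀)).mem_nhds hs)] with w hw
      using F.chartSymm_localProj hw
  rw [he.mfderiv_eq] at h
  exact congrArg (fun T : EuclideanSpace ℝ (Fin (4 * n + p)) →L[ℝ]
    EuclideanSpace ℝ (Fin (4 * n)) => T v) h.symm

theorem isPullbackAt_of_contDiffAt (hx : x₀ ∈ F.U i) {k : ℕ} {θ : FormField (4 * n) N k}
    (hθ : ContDiffAt ℝ ∞ (pullForm θ (F.chartSymm i x₀)) (F.localProj i x₀ x₀)) :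
    F.IsPullbackAt i x₀ (fun z => (θ (F.f i z)).compLinearMap (F.df i z).toLinearMap) := by
  refine ⟨_, hθ, ?_⟩
  filter_upwards [F.eventually_mem_source hx] with z hz v
  have transport : ∀ (y y' : N) (_ : y = y') (w w' : Fin k → EuclideanSpace ℝ (Fin (4 * n)))
      (_ : ∀ j, w j = w' j), θ y w = θ y' w' := by
    rintro y _ rfl w w' hw
    exact congrArg (θ y) (funext hw)
  exact (transport _ _ (F.chartSymm_localProj hz.2) _ _
    fun j => F.mfderiv_chartSymm_localProj hz.1 hz.2 (v j)).symm

theorem isPullbackAt_fundamentalForm (hx : x₀ ∈ F.U i) (g : Metric (4 * n) N)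
    {A : ∀ y : N, TangentSpace (𝓡 (4 * n)) y →L[ℝ] TangentSpace (𝓡 (4 * n)) y}
    (hA : SmoothEndAt A (F.f i x₀)) :
    F.IsPullbackAt i x₀ (fun z => (fundamentalForm (g.inner (F.f i z)) (A (F.f i z))).compLinearMap
      (F.df i z).toLinearMap) := by
  have hs := mem_extChartAt_source (I := 𝓡 (4 * n)) (F.f i x₀)
  refine isPullbackAt_of_contDiffAt (θ := fun w => fundamentalForm (g.inner w) (A w)) hx ?_
  refine contDiffAt_pullForm_fundamentalForm g (F.contMDiffAt_chartSymm hs) ?_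
  rwa [F.chartSymm_localProj hs]

variable [IsManifold (𝓡 (4 * n + p)) ∞ M] {g : Metric (4 * n + p) M} {S : QuaternionKahler n N}

/-- Near `f_i(x₀)` smooth units span `Q`, and `Omega_eq` says that they compute `Ω` although the
frames used to define it vary arbitrarily with the point. -/
theorem isPullbackAt_Omega (hS : F.IsTransverselyQK S) (hg : F.IsBundleLike g S)
    (hx : x₀ ∈ F.U i) : F.IsPullbackAt i x₀ (F.Omega g S) := by
  obtain ⟨W, hWo, hW, I, J, K, h⟩ := S.locally_spanned (F.f i x₀)
  have hI := isPullbackAt_fundamentalForm hx S.g (h _ hW).1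
  have hJ := isPullbackAt_fundamentalForm hx S.g (h _ hW).2.1
  have hK := isPullbackAt_fundamentalForm hx S.g (h _ hW).2.2.1
  refine (((hI.wedge rfl hI).add (hJ.wedge rfl hJ)).add (hK.wedge rfl hK)).congr ?_
  filter_upwards [F.eventually_mem_source hx,
    (F.contMDiffAt_f hx).continuousAt (hWo.mem_nhds hW)] with z hz hzW
  obtain ⟨-, -, -, hh, hQ, -⟩ := h _ hzW
  rw [Omega_eq hS hg hz.1 hh hQ, quaternionicForm, wedge_compLinearMap, wedge_compLinearMap,
    wedge_compLinearMap]
  rfl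

open scoped Classical in
variable (F g S) in
/-- The contraction of a form with `Ω`. -/
def contr {j k : ℕ} (h : 4 + j = k) (α : FormField (4 * n + p) M k) :
    FormField (4 * n + p) M j := fun x =>
  if h' : Nonempty (F.NormalFrame g S x) then
    contraction h h'.some.vec (F.Omega g S x) (α x) else 0

/-- The frames `h'.some` need not vary continuously. Their images in the chart of `N` are
orthonormal, so the contraction can be rewritten with the coordinate basis and the inverse Gram
matrix, both smooth. -/
theorem IsPullbackAt.contr (hS : F.IsTransverselyQK S) (hg : F.IsBundleLike g S)
    (hx : x₀ ∈ F.U i) {j k : ℕ} (h : 4 + j = k) {α : FormField (4 * n + p) M k}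
    (hα : F.IsPullbackAt i x₀ α) : F.IsPullbackAt i x₀ (F.contr g S h α) := by
  obtain ⟨a, ha, hea⟩ := hα
  obtain ⟨o, ho, heo⟩ := isPullbackAt_Omega hS hg hx
  set c := F.chartSymm i x₀ with hc
  have hs := mem_extChartAt_source (I := 𝓡 (4 * n)) (F.f i x₀)
  have hdet : (gramMatrix S.g c (F.localProj i x₀ x₀)).det ≠ 0 := by
    refine det_gramMatrix_ne_zero S.g ?_
    let C : EuclideanSpace ℝ (Fin (4 * n)) →L[ℝ] EuclideanSpace ℝ (Fin (4 * n)) :=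
      mfderiv 𝓘(ℝ, EuclideanSpace ℝ (Fin (4 * n))) (𝓡 (4 * n)) c (F.localProj i x₀ x₀)
    have hC : Function.Surjective C := by
      intro w
      obtain ⟨v, hv⟩ := F.df_surjective hx w
      exact ⟨_, (F.mfderiv_chartSymm_localProj hx hs v).trans hv⟩
    exact (LinearMap.injective_iff_surjective (f := C.toLinearMap)).2 hC
  refine ⟨_, ContDiffAt.gramContraction h (contDiffAt_matrix_inv
    (contDiffAt_gramMatrix S.g (F.contMDiffAt_chartSymm hs)) hdet) ho ha, ?_⟩
  filter_upwards [eventually_eq_compLinearMap hea, eventually_eq_compLinearMap heo,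
    F.eventually_mem_source hx] with z hza hzo hz v
  have hne := nonempty_normalFrame hS hg z
  rw [FoliationCocycle.contr, dif_pos hne, hza, hzo]
  set b := hne.some
  let D : EuclideanSpace ℝ (Fin (4 * n + p)) →L[ℝ] EuclideanSpace ℝ (Fin (4 * n)) :=
    mfderiv (𝓡 (4 * n + p)) 𝓘(ℝ, EuclideanSpace ℝ (Fin (4 * n))) (F.localProj i x₀) z
  let C : EuclideanSpace ℝ (Fin (4 * n)) →L[ℝ] EuclideanSpace ℝ (Fin (4 * n)) :=
    mfderiv 𝓘(ℝ, EuclideanSpace ℝ (Fin (4 * n))) (𝓡 (4 * n)) c (F.localProj i x₀ z)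
  let γ : EuclideanSpace ℝ (Fin (4 * n)) →L[ℝ] EuclideanSpace ℝ (Fin (4 * n)) →L[ℝ] ℝ :=
    S.g.inner (c (F.localProj i x₀ z))
  -- The transverse metric in the chart of `N`; the frame is orthonormal for it because `f_i` is a
  -- Riemannian submersion.
  let G : EuclideanSpace ℝ (Fin (4 * n)) →ₗ[ℝ] EuclideanSpace ℝ (Fin (4 * n)) →ₗ[ℝ] ℝ :=
    LinearMap.mk₂ ℝ (fun u v => γ (C u) (C v)) (by simp) (by simp) (by simp) (by simp)
  have hG : ∀ s t, G (D (b.vec s)) (D (b.vec t)) = if s = t then 1 else 0 := by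
    intro s t
    have transport : ∀ (y y' : N) (_ : y = y') (u u' w w' : EuclideanSpace ℝ (Fin (4 * n)))
        (_ : u = u') (_ : w = w'), S.g.inner y u w = S.g.inner y' u' w' := by
      rintro y _ rfl u _ w _ rfl rfl
      rfl
    refine (transport _ _ (F.chartSymm_localProj hz.2) _ _ _ _
      (F.mfderiv_chartSymm_localProj hz.1 hz.2 (b.vec s))
      (F.mfderiv_chartSymm_localProj hz.1 hz.2 (b.vec t))).trans ?_
    rw [← b.inner_vec]
    exact hg i z hz.1 _ (b.vec_mem s) _ (b.vec_mem t)
  have h1 := contraction_eq_sum_basis h G (euclBasis (4 * n)) (D ∘ b.vec) hG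
    (o (F.localProj i x₀ z)).toAlternatingMap (a (F.localProj i x₀ z)).toAlternatingMap
    (fun j => D (v j))
  refine Eq.trans ?_ (h1.trans (gramContraction_apply _ _ _ _ _ _).symm)
  exact congrArg (fun τ : EuclideanSpace ℝ (Fin (4 * n + p)) [⋀^Fin j]→ₗ[ℝ] ℝ => τ v)
    (contraction_compLinearMap h b.vec _ _ D.toLinearMap)

end FoliationCocycle

/-! ### Effective forms and the decomposition -/

namespace FoliationCocycle

variable {n p : ℕ} {ι M N : Type*}
  [TopologicalSpace M] [ChartedSpace (EuclideanSpace ℝ (Fin (4 * n + p))) M]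
  [TopologicalSpace N] [ChartedSpace (EuclideanSpace ℝ (Fin (4 * n))) N]
  [IsManifold (𝓡 (4 * n + p)) ∞ M] [IsManifold (𝓡 (4 * n)) ∞ N]
  {F : FoliationCocycle n p ι M N} {g : Metric (4 * n + p) M} {S : QuaternionKahler n N}

theorem Omega_eq_compLinearMap_coord (hg : F.IsBundleLike g S) {x : M}
    (h : Nonempty (F.NormalFrame g S x)) :
    F.Omega g S x = (modelForm n).compLinearMap h.some.coord := by
  rw [Omega, dif_pos h, h.some.krainesForm_eq (isTransverse_normal hg x)]

theorem contr_apply (hg : F.IsBundleLike g S) {x : M} (h' : Nonempty (F.NormalFrame g S x))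
    {j k : ℕ} (h : 4 + j = k) {α : FormField (4 * n + p) M k}
    {a : (Fin (4 * n) → ℝ) [⋀^Fin k]→ₗ[ℝ] ℝ} (ha : α x = a.compLinearMap h'.some.coord) :
    F.contr g S h α x =
      (contraction h (stdVec (4 * n)) (modelForm n) a).compLinearMap h'.some.coord := by
  rw [contr, dif_pos h', Omega_eq_compLinearMap_coord hg h', ha,
    h'.some.contraction_compLinearMap_coord]

/-- In frame coordinates `Λ` is a scalar multiple of the contraction with `Ω`; in degrees above `4n`
it vanishes by definition. -/
theorem isEffective_of_contr_eq_zero (hg : F.IsBundleLike g S) {j k : ℕ} (h : 4 + j = k)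
    {α : FormField (4 * n + p) M k} (hα : F.IsBasic α) (h0 : F.contr g S h α = 0) :
    F.IsEffective g S α := by
  obtain rfl : j = k - 4 := by omega
  rw [IsEffective, Lam]
  split_ifs with hk
  swap
  · rfl
  funext x
  rw [starBar]
  split_ifs with h'
  swap
  · rfl
  obtain ⟨a, ha⟩ := h'.some.exists_eq_compLinearMap_coord (isTransverse_normal hg x)
    (hα.horizontal x)
  have hc := contr_apply hg h' h ha
  rw [h0] at hc
  rw [starBar, dif_pos h', Omega_eq_compLinearMap_coord hg h', ha,
    h'.some.star_compLinearMap_coord, wedge_compLinearMap, h'.some.star_compLinearMap_coord,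
    hodgeStar_wedge_hodgeStar h rfl _ _ (det_stdVec _)]
  ext v
  have := congrArg (fun τ => τ v) hc
  change _ * contraction _ _ _ _ _ = (0 : ℝ)
  exact mul_eq_zero_of_right _ this.symm

theorem isEffective_of_lt_four {k : ℕ} (hk : k < 4) (α : FormField (4 * n + p) M k) :
    F.IsEffective g S α := by
  rw [IsEffective, Lam, dif_neg (by omega)]

theorem isBasic_iff_isPullbackAt {k : ℕ} {α : FormField (4 * n + p) M k} :
    F.IsBasic α ↔ ∀ x i, x ∈ F.U i → F.IsPullbackAt i x α :=
  ⟨fun h _ _ hx => h.isPullbackAt hx, fun h => F.isBasic_of_isPullbackAt fun x =>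
    (F.cover x).imp fun i hi => ⟨hi, h x i hi⟩⟩

theorem IsBasic.add {k : ℕ} {α β : FormField (4 * n + p) M k} (hα : F.IsBasic α)
    (hβ : F.IsBasic β) : F.IsBasic (fun x => α x + β x) :=
  isBasic_iff_isPullbackAt.2 fun _ _ hx => (hα.isPullbackAt hx).add (hβ.isPullbackAt hx)

theorem IsBasic.smul {k : ℕ} {α : FormField (4 * n + p) M k} (hα : F.IsBasic α) (c : ℝ) :
    F.IsBasic (fun x => c • α x) :=
  isBasic_iff_isPullbackAt.2 fun _ _ hx => (hα.isPullbackAt hx).smul c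

theorem IsBasic.sum {k : ℕ} {κ : Type*} (s : Finset κ) {α₀ : FormField (4 * n + p) M k}
    (h₀ : F.IsBasic α₀) {α : κ → FormField (4 * n + p) M k} (hα : ∀ c, F.IsBasic (α c)) :
    F.IsBasic (fun x => ∑ c ∈ s, α c x) := by
  classical
  induction s using Finset.induction_on with
  -- The zero form is basic as `0 • α₀`; this is the role of `α₀`.
  | empty => simpa using h₀.smul 0
  | insert c s hc ih => simpa [Finset.sum_insert hc] using (hα c).add ih

theorem IsBasic.wedge_Omega (hS : F.IsTransverselyQK S) (hg : F.IsBundleLike g S) {j k : ℕ}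
    (h : 4 + j = k) {α : FormField (4 * n + p) M j} (hα : F.IsBasic α) :
    F.IsBasic (fun x => wedge h (F.Omega g S x) (α x)) :=
  isBasic_iff_isPullbackAt.2 fun _ _ hx =>
    (isPullbackAt_Omega hS hg hx).wedge h (hα.isPullbackAt hx)

theorem IsBasic.contr (hS : F.IsTransverselyQK S) (hg : F.IsBundleLike g S) {j k : ℕ}
    (h : 4 + j = k) {α : FormField (4 * n + p) M k} (hα : F.IsBasic α) :
    F.IsBasic (F.contr g S h α) :=
  isBasic_iff_isPullbackAt.2 fun _ _ hx => (hα.isPullbackAt hx).contr hS hg hx h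

/-- A basic form differs from an effective one by the product of `Ω` with a basic form. -/
theorem exists_basic_contr_eq_zero (hS : F.IsTransverselyQK S) (hg : F.IsBundleLike g S)
    {j k : ℕ} (h : 4 + j = k) {α : FormField (4 * n + p) M k} (hα : F.IsBasic α) :
    ∃ β : FormField (4 * n + p) M j, F.IsBasic β ∧
      F.contr g S h (fun x => α x + (-1 : ℝ) • wedge h (F.Omega g S x) (β x)) = 0 := by
  -- The polynomial is fixed before any point of `M`.
  obtain ⟨q, hq⟩ := exists_polynomial_contraction h (modelForm n)
  set U₀ := wedgeContraction h (stdVec (4 * n)) (modelForm n)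
  let U : FormField (4 * n + p) M k → FormField (4 * n + p) M k :=
    fun θ x => wedge h (F.Omega g S x) (F.contr g S h θ x)
  have hU : ∀ i, F.IsBasic (U^[i] α) := by
    intro i
    induction i with
    | zero => exact hα
    | succ i ih =>
      rw [Function.iterate_succ_apply']
      exact (ih.contr hS hg h).wedge_Omega hS hg h
  -- `θ = q(U) α`, written as an explicit sum of iterates so that it is visibly basic; then `β` is
  -- the contraction of `θ` and `Ω ∧ β = U q(U) α`.
  let θ : FormField (4 * n + p) M k :=
    fun x => ∑ i ∈ Finset.range (q.natDegree + 1), q.coeff i • U^[i] α x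
  have hθ : F.IsBasic θ := IsBasic.sum _ hα fun i => (hU i).smul _
  refine ⟨F.contr g S h θ, hθ.contr hS hg h, funext fun x => ?_⟩
  have h' := nonempty_normalFrame hS hg x
  obtain ⟨a, ha⟩ := h'.some.exists_eq_compLinearMap_coord (isTransverse_normal hg x)
    (hα.horizontal x)
  have hL : ∀ {η : FormField (4 * n + p) M k} {b : (Fin (4 * n) → ℝ) [⋀^Fin k]→ₗ[ℝ] ℝ},
      η x = b.compLinearMap h'.some.coord →
      U η x = (U₀ b).compLinearMap h'.some.coord := by
    intro η b hb
    simp only [U]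
    rw [contr_apply hg h' h hb, Omega_eq_compLinearMap_coord hg h', wedge_compLinearMap]
    rfl
  have hUx : ∀ i, U^[i] α x = ((U₀ ^ i) a).compLinearMap h'.some.coord := by
    intro i
    induction i with
    | zero => exact ha
    | succ i ih =>
      rw [Function.iterate_succ_apply', hL ih, pow_succ']
      rfl
  have hθx : θ x = (Polynomial.aeval U₀ q a).compLinearMap h'.some.coord := by
    ext v
    simp only [θ, Polynomial.aeval_eq_sum_range, LinearMap.sum_apply, LinearMap.smul_apply,
      alternating_sum_apply, AlternatingMap.smul_apply, AlternatingMap.compLinearMap_apply, hUx]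
  rw [contr_apply hg h' h (a := a - U₀ (Polynomial.aeval U₀ q a)), hq]
  · rfl
  · have := hL hθx
    simp only [U] at this
    rw [this, ha]
    ext v
    simp [sub_eq_add_neg]

theorem L_castDegree {k l : ℕ} (h : k = l) (θ : FormField (4 * n + p) M k) (x : M) :
    wedge (Nat.add_comm 4 l) (F.Omega g S x) (castDegree h (θ x)) =
      castDegree (by omega) (F.L g S θ x) := by
  subst h
  rfl

theorem castDegree_Lpow_congr (γ : ∀ d, FormField (4 * n + p) M d) {d d' i k : ℕ} (hd : d = d')
    (h : d + 4 * i = k) (h' : d' + 4 * i = k) (x : M) :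
    castDegree h (F.Lpow g S (γ d) i x) = castDegree h' (F.Lpow g S (γ d') i x) := by
  subst hd
  rfl

/-- The decomposition of a basic form into effective forms. -/
theorem exists_effective_decomposition (hS : F.IsTransverselyQK S) (hg : F.IsBundleLike g S)
    (k : ℕ) (α : FormField (4 * n + p) M k) (hα : F.IsBasic α) :
    ∃ γ : ∀ d, FormField (4 * n + p) M d,
      (∀ i ≤ k / 4, F.IsBasic (γ (k - 4 * i)) ∧ F.IsEffective g S (γ (k - 4 * i))) ∧
      ∀ x : M, α x = ∑ i ∈ Finset.range (k / 4 + 1), if h : 4 * i ≤ k then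
        castDegree (Nat.sub_add_cancel h) (F.Lpow g S (γ (k - 4 * i)) i x) else 0 := by
  classical
  induction k using Nat.strong_induction_on with
  | _ k ih =>
  rcases lt_or_ge k 4 with hk | hk
  -- The family `γ` is indexed by all degrees, so that the induction need not transport along
  -- equalities of degrees; values outside the degrees `k - 4 * i` are irrelevant.
  · refine ⟨Function.update 0 k α, ?_, fun x => ?_⟩
    · intro i hi
      obtain rfl : i = 0 := by omega
      simpa using ⟨hα, isEffective_of_lt_four hk α⟩
    · rw [show k / 4 = 0 by omega]
      simp
      rfl
  · obtain ⟨j, rfl⟩ : ∃ j, k = j + 4 := ⟨k - 4, by omega⟩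
    obtain ⟨β, hβ, hc⟩ := exists_basic_contr_eq_zero hS hg (Nat.add_comm 4 j) hα
    set αe : FormField (4 * n + p) M (j + 4) :=
      fun x => α x + (-1 : ℝ) • wedge (Nat.add_comm 4 j) (F.Omega g S x) (β x) with hαe
    have hαeb : F.IsBasic αe := hα.add ((hβ.wedge_Omega hS hg _).smul _)
    obtain ⟨γ, hγ, hsum⟩ := ih j (by omega) β hβ
    have hupd : ∀ i, Function.update γ (j + 4) αe (j + 4 - 4 * (i + 1)) =
        γ (j + 4 - 4 * (i + 1)) := fun i => Function.update_of_ne (by omega) _ _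
    -- The effective part takes the new top degree. The components of `β` keep their degrees `j - 4
    -- * i = j + 4 - 4 * (i + 1)`, and each acquires one more factor `L`.
    refine ⟨Function.update γ (j + 4) αe, ?_, fun x => ?_⟩
    · rintro (_ | i) hi
      · simpa using ⟨hαeb, isEffective_of_contr_eq_zero hg _ hαeb hc⟩
      · rw [hupd, show j + 4 - 4 * (i + 1) = j - 4 * i by omega]
        exact hγ i (by omega)
    · rw [show (j + 4) / 4 = j / 4 + 1 by omega, Finset.sum_range_succ']
      have h0 : α x = wedge (Nat.add_comm 4 j) (F.Omega g S x) (β x) + αe x := by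
        rw [hαe]
        module
      rw [h0, hsum x, ← wedgeBilin_apply, map_sum]
      congr 1
      · refine Finset.sum_congr rfl fun i hi => ?_
        have hi' : 4 * i ≤ j := by
          rw [Finset.mem_range] at hi
          omega
        rw [dif_pos hi', dif_pos (by omega), wedgeBilin_apply, L_castDegree, hupd]
        exact castDegree_Lpow_congr (i := i + 1) γ (by omega) _ _ x
      · simp
        rfl

end FoliationCocycle

end QKFoliation

end

theorem mainTheorem5 (n p : ℕ) (ι M N : Type*)
    [TopologicalSpace M] [T2Space M] [SecondCountableTopology M]
    [ChartedSpace (EuclideanSpace ℝ (Fin (4 * n + p))) M] [IsManifold (𝓡 (4 * n + p)) ∞ M]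
    [TopologicalSpace N] [T2Space N] [SecondCountableTopology N]
    [ChartedSpace (EuclideanSpace ℝ (Fin (4 * n))) N] [IsManifold (𝓡 (4 * n)) ∞ N]
    (g : QKFoliation.Metric (4 * n + p) M)
    (S : QKFoliation.QuaternionKahler n N)
    (F : QKFoliation.FoliationCocycle n p ι M N)
    (hS : F.IsTransverselyQK S) (hg : F.IsBundleLike g S)
    (k : ℕ) (hk : k ≤ n + 1)
    (α : QKFoliation.FormField (4 * n + p) M k) (hα : F.IsBasic α) :
    ∃ αe : (i : Fin (k / 4 + 1)) → QKFoliation.FormField (4 * n + p) M (k - 4 * (i : ℕ)),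
      (∀ i, F.IsBasic (αe i) ∧ F.IsEffective g S (αe i)) ∧
      ∀ x : M, α x = ∑ i : Fin (k / 4 + 1),
        QKFoliation.castDegree (show k - 4 * (i : ℕ) + 4 * (i : ℕ) = k by omega)
          (F.Lpow g S (αe i) (i : ℕ) x) := by
  obtain ⟨γ, hγ, hsum⟩ :=
    QKFoliation.FoliationCocycle.exists_effective_decomposition hS hg k α hα
  refine ⟨fun i => γ (k - 4 * (i : ℕ)), fun i => hγ i (by omega), fun x => ?_⟩
  rw [hsum x, Finset.sum_range]
  exact Finset.sum_congr rfl fun i _ => dif_pos (by omega)
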